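/- Let $(M,g)$ be a closed (compact, without boundary), connected smooth Riemannian manifold of dimension $m$. A singular Riemannian foliation $\mathcal F$ of $(M,g)$ is a decomposition of $M$ into connected injectively immersed smooth submanifolds (the leaves), possibly of different dimensions, such that (i) every geodesic orthogonal to one leaf is orthogonal to all the leaves that it meets, and (ii) for every leaf $L$ and $p\in L$ one has $T_pL=\operatorname{span}\{X_p \mid X\in\mathcal X_{\mathcal F}\}$, where $\mathcal X_{\mathcal F}$ is the set of smooth vector fields on $M$ that are everywhere tangent to the leaves. Let $\mathcal C^\infty(M)^{\mathcal F}$ be the space of smooth functions $u\colon M\to\mathbb R$ that are constant on each leaf. Let $H^1_g(M)$ be the completion of $\mathcal C^\infty(M)$ with respect to the norm of the inner product $$\langle u,v\rangle_{H^1_g(M)}=\int_M \big(\langle\nabla_g u,\nabla_g v\rangle_g+uv\big)\,dV_g ,$$ and let $H^1_g(M)^{\mathcal F}$ be the closure of $\mathcal C^\infty(M)^{\mathcal F}$ in $H^1_g(M)$. Let $\mathcal F$ be a singular Riemannian foliation of $(M,g)$ all of whose leaves are closed subsets of $M$. Assume that $\mathcal F$ is nontrivial, i.e. $\mathcal F\neq\{M\}$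 and $\mathcal F\neq\{\{p\}\mid p\in M\}$, and that $\kappa_{\mathcal F}:=\min\{\dim L\mid L\in\mathcal F\}\geq 1$. Then for every $k\in\mathbb N$ there exist functions $u_1,\dots,u_k\in\mathcal C^\infty(M)^{\mathcal F}$ that are nonnegative, not identically zero, and have pairwise disjoint (closed) supports. Moreover, $H^1_g(M)^{\mathcal F}$ is infinite dimensional. -/

import Mathlib

open scoped Manifold ContDiff Topology
open Bundle MeasureTheory Set

namespace FoliatedGeometry
noncomputable section
universe u

/-- Smooth Riemannian metrics on a smooth `m`-manifold without boundary. -/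
abbrev SmoothMetric (m : ℕ) (M : Type u) [TopologicalSpace M]
    [ChartedSpace (EuclideanSpace ℝ (Fin m)) M] [IsManifold (𝓡 m) ∞ M] :=
  ContMDiffRiemannianMetric (𝓡 m) ∞ (EuclideanSpace ℝ (Fin m))
    (fun x : M => TangentSpace (𝓡 m) x)

variable {m : ℕ} {M : Type u} [TopologicalSpace M]
  [ChartedSpace (EuclideanSpace ℝ (Fin m)) M] [IsManifold (𝓡 m) ∞ M]

/-! ### The metric in a chart, geodesics -/

/-- `Dφ⁻¹(y)` for the chart `φ` around `x`, as a map into the tangent space at `φ⁻¹(y)`. -/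
def chartFrame (x : M) (y : EuclideanSpace ℝ (Fin m)) :
    EuclideanSpace ℝ (Fin m) →L[ℝ] TangentSpace (𝓡 m) ((extChartAt (𝓡 m) x).symm y) :=
  mfderiv (𝓡 m) (𝓡 m) (extChartAt (𝓡 m) x).symm y

/-- The metric in the chart around `x`, at the point `y` of the chart target:
`g(Dφ⁻¹(y) v, Dφ⁻¹(y) w)`. -/
def chartMetric (g : SmoothMetric m M) (x : M) (y v w : EuclideanSpace ℝ (Fin m)) : ℝ :=
  g.inner ((extChartAt (𝓡 m) x).symm y) (chartFrame x y v) (chartFrame x y w)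

/-- The Christoffel symbols of the first kind in the chart around `x`, contracted with the
vectors `a`, `b`, `w`:
`½ (∂ₐ g(b, w) + ∂_b g(a, w) - ∂_w g(a, b))`. -/
def christoffel (g : SmoothMetric m M) (x : M) (y a b w : EuclideanSpace ℝ (Fin m)) : ℝ :=
  (fderiv ℝ (fun z => chartMetric g x z b w) y a
    + fderiv ℝ (fun z => chartMetric g x z a w) y b
    - fderiv ℝ (fun z => chartMetric g x z a b) y w) / 2

/-- The geodesic equation of the curve `γ` at the time `t` in the chart around `x`, tested
against all `w`: with `c = φ ∘ γ`, `g(c'', w) + Γ(c', c'; w) = 0`. -/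
def GeodesicEquationAt (g : SmoothMetric m M) (γ : ℝ → M) (x : M) (t : ℝ) : Prop :=
  ∀ w : EuclideanSpace ℝ (Fin m),
    chartMetric g x (extChartAt (𝓡 m) x (γ t))
        (deriv (deriv (fun s => extChartAt (𝓡 m) x (γ s))) t) w
      + christoffel g x (extChartAt (𝓡 m) x (γ t))
          (deriv (fun s => extChartAt (𝓡 m) x (γ s)) t)
          (deriv (fun s => extChartAt (𝓡 m) x (γ s)) t) w = 0

/-- `γ` is a geodesic on the open interval `J`. The geodesic equation does not depend on the chart,
so it is enough to ask for it in one chart around each point. -/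
structure IsGeodesicOn (g : SmoothMetric m M) (γ : ℝ → M) (J : Set ℝ) : Prop where
  isOpen : IsOpen J
  ordConnected : J.OrdConnected
  contMDiffOn : ContMDiffOn 𝓘(ℝ, ℝ) (𝓡 m) 2 γ J
  equation : ∀ t ∈ J, ∃ x : M, γ t ∈ (chartAt (EuclideanSpace ℝ (Fin m)) x).source ∧
    GeodesicEquationAt g γ x t

/-- The velocity `γ'(t)`. -/
def velocity (γ : ℝ → M) (t : ℝ) : TangentSpace (𝓡 m) (γ t) :=
  mfderiv 𝓘(ℝ, ℝ) (𝓡 m) γ t (1 : ℝ)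

/-! ### Singular Riemannian foliations -/

/-- A decomposition of `M` into connected injectively immersed submanifolds (the leaves), possibly
of different dimensions. -/
structure LeafDecomposition (m : ℕ) (M : Type u) [TopologicalSpace M]
    [ChartedSpace (EuclideanSpace ℝ (Fin m)) M] where
  Index : Type u
  Leaf : Index → Type u
  dim : Index → ℕ
  [topology : ∀ i, TopologicalSpace (Leaf i)]
  [charted : ∀ i, ChartedSpace (EuclideanSpace ℝ (Fin (dim i))) (Leaf i)]
  [isManifold : ∀ i, IsManifold (𝓡 (dim i)) ∞ (Leaf i)]
  [t2 : ∀ i, T2Space (Leaf i)]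
  [secondCountable : ∀ i, SecondCountableTopology (Leaf i)]
  [connected : ∀ i, ConnectedSpace (Leaf i)]
  incl : ∀ i, Leaf i → M
  isImmersion : ∀ i, Manifold.IsImmersion (𝓡 (dim i)) (𝓡 m) ∞ (incl i)
  /-- every point of `M` is hit exactly once by exactly one leaf -/
  bijective : Function.Bijective (fun q : Σ i, Leaf i => incl q.1 q.2)

attribute [instance] LeafDecomposition.topology LeafDecomposition.charted
  LeafDecomposition.isManifold LeafDecomposition.t2 LeafDecomposition.secondCountable
  LeafDecomposition.connected

namespace LeafDecomposition
variable (F : LeafDecomposition m M)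

/-- The leaves as subsets of `M`. -/
def leafSet (i : F.Index) : Set M := range (F.incl i)

/-- The tangent space `T_p L` of the leaf `L` through `p`, as a subset of `T_p M`. -/
def leafTangent (p : M) : Set (TangentSpace (𝓡 m) p) :=
  {v | ∃ (i : F.Index) (ξ : TangentBundle (𝓡 (F.dim i)) (F.Leaf i)),
    tangentMap (𝓡 (F.dim i)) (𝓡 m) (F.incl i) ξ = ⟨p, v⟩}

/-- `v ∈ T_p M` is orthogonal to the leaf through `p`. -/
def IsNormal (g : SmoothMetric m M) (p : M) (v : TangentSpace (𝓡 m) p) : Prop :=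
  ∀ w ∈ F.leafTangent p, g.inner p v w = 0

/-- The smooth vector fields on `M` that are everywhere tangent to the leaves. -/
def tangentFields : Set (∀ p : M, TangentSpace (𝓡 m) p) :=
  {X | ContMDiff (𝓡 m) (𝓡 m).tangent ∞ (fun p => (⟨p, X p⟩ : TangentBundle (𝓡 m) M)) ∧
    ∀ p, X p ∈ F.leafTangent p}

/-- The smallest dimension of a leaf. -/
def kappa : ℕ := sInf (range F.dim)

/-- The foliation is neither `{M}` nor `{{p} | p ∈ M}`. -/
def IsNontrivial : Prop :=
  range F.leafSet ≠ {univ} ∧ range F.leafSet ≠ range (fun p : M => ({p} : Set M))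

/-- Every leaf is a closed subset of `M`. -/
def HasClosedLeaves : Prop := ∀ i, IsClosed (F.leafSet i)

/-- The smooth functions on `M` that are constant on each leaf. -/
def invariantFunctions : Submodule ℝ C^∞⟮𝓡 m, M; ℝ⟯ where
  carrier := {u | ∀ i, ∀ p ∈ F.leafSet i, ∀ q ∈ F.leafSet i, u p = u q}
  add_mem' hu hv i p hp q hq :=
    congrArg₂ (· + ·) (hu i p hp q hq) (hv i p hp q hq)
  zero_mem' _ _ _ _ _ := rfl
  smul_mem' c _ hu i p hp q hq := congrArg (c * ·) (hu i p hp q hq)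

end LeafDecomposition

/-- A singular Riemannian foliation of `(M, g)`. -/
structure SingularRiemannianFoliation (g : SmoothMetric m M) extends LeafDecomposition m M where
  /-- a geodesic orthogonal to one leaf is orthogonal to all the leaves that it meets -/
  transnormal : ∀ (γ : ℝ → M) (J : Set ℝ), IsGeodesicOn g γ J →
    ∀ t₀ ∈ J, toLeafDecomposition.IsNormal g (γ t₀) (velocity γ t₀) →
      ∀ t ∈ J, toLeafDecomposition.IsNormal g (γ t) (velocity γ t)
  /-- `T_p L` is spanned by the values at `p` of the vector fields tangent to the leaves -/
  smooth : ∀ p : M, toLeafDecomposition.leafTangent p =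
    (Submodule.span ℝ {v | ∃ X ∈ toLeafDecomposition.tangentFields, X p = v} :
      Set (TangentSpace (𝓡 m) p))

/-! ### The Riemannian volume -/

/-- The matrix `(g_{ij})` in the chart around `x`. -/
def gramMatrix (g : SmoothMetric m M) (x : M) (y : EuclideanSpace ℝ (Fin m)) :
    Matrix (Fin m) (Fin m) ℝ :=
  Matrix.of fun i j => chartMetric g x y (EuclideanSpace.basisFun (Fin m) ℝ i)
    (EuclideanSpace.basisFun (Fin m) ℝ j)

section
variable [MeasurableSpace M]
/-- The measure `√(det g_{ij}) dy` on the domain of the chart around `x`. -/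
def chartVolume (g : SmoothMetric m M) (x : M) : Measure M :=
  Measure.map (extChartAt (𝓡 m) x).symm
    ((volume.restrict (extChartAt (𝓡 m) x).target).withDensity
      fun y => ENNReal.ofReal √(gramMatrix g x y).det)
end

lemma symm_eq_mfderiv (x : M) {y : EuclideanSpace ℝ (Fin m)}
    (hy : y ∈ (extChartAt (𝓡 m) x).target) (v : EuclideanSpace ℝ (Fin m)) :
    (trivializationAt (EuclideanSpace ℝ (Fin m)) (TangentSpace (𝓡 m)) x).symm
        ((extChartAt (𝓡 m) x).symm y) v = mfderiv (𝓡 m) (𝓡 m) (extChartAt (𝓡 m) x).symm y v := by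
  have hs : (extChartAt (𝓡 m) x).symm y ∈ (chartAt (EuclideanSpace ℝ (Fin m)) x).source := by
    simpa using (extChartAt (𝓡 m) x).map_target hy
  have h := TangentBundle.symmL_trivializationAt (I := 𝓡 m) hs
  rw [(extChartAt (𝓡 m) x).right_inv hy] at h
  have := congrArg (fun f => f v) h
  simp only [modelWithCornersSelf_coe, range_id, mfderivWithin_univ] at this
  refine Eq.trans ?_ this
  exact (Trivialization.symmL_apply (R := ℝ) _ hs v).symm

lemma contMDiffOn_inner_symm (g : SmoothMetric m M) (x : M) (v w : EuclideanSpace ℝ (Fin m)) :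
    ContMDiffOn (𝓡 m) 𝓘(ℝ, ℝ) ∞ (fun p => g.inner p
      ((trivializationAt (EuclideanSpace ℝ (Fin m)) (TangentSpace (𝓡 m)) x).symm p v)
      ((trivializationAt (EuclideanSpace ℝ (Fin m)) (TangentSpace (𝓡 m)) x).symm p w))
      (chartAt (EuclideanSpace ℝ (Fin m)) x).source := by
  have hsec : ∀ v : EuclideanSpace ℝ (Fin m), ContMDiffOn (𝓡 m) ((𝓡 m).prod (𝓡 m)) ∞
      (fun p => TotalSpace.mk' (EuclideanSpace ℝ (Fin m)) (E := TangentSpace (𝓡 m)) p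
        ((trivializationAt (EuclideanSpace ℝ (Fin m)) (TangentSpace (𝓡 m)) x).symm p v))
      (chartAt (EuclideanSpace ℝ (Fin m)) x).source := by
    intro v
    set e := trivializationAt (EuclideanSpace ℝ (Fin m)) (TangentSpace (𝓡 m)) x
    have h1 := (e.contMDiffOn_symm (IB := 𝓡 m) (n := ∞)).comp
      (s := e.baseSet) (f := fun p => (p, v))
      ((contMDiff_id.prodMk contMDiff_const).contMDiffOn) (by
        intro p hp
        simpa [e.mem_target] using hp)
    refine h1.congr fun p hp => ?_
    exact (e.mk_symm hp v)
  have := (g.contMDiff.contMDiffOn (s := (chartAt (EuclideanSpace ℝ (Fin m)) x).source)).clm_bundle_apply₂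
    (F₃ := ℝ) (E₃ := fun _ : M => ℝ) (hsec v) (hsec w)
  intro p hp
  have h2 := this p hp
  simp only [contMDiffWithinAt_totalSpace] at h2
  exact h2.2

lemma chartMetric_eq (g : SmoothMetric m M) (x : M) {y : EuclideanSpace ℝ (Fin m)}
    (hy : y ∈ (extChartAt (𝓡 m) x).target) (v w : EuclideanSpace ℝ (Fin m)) :
    chartMetric g x y v w = g.inner ((extChartAt (𝓡 m) x).symm y)
      ((trivializationAt (EuclideanSpace ℝ (Fin m)) (TangentSpace (𝓡 m)) x).symm
        ((extChartAt (𝓡 m) x).symm y) v)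
      ((trivializationAt (EuclideanSpace ℝ (Fin m)) (TangentSpace (𝓡 m)) x).symm
        ((extChartAt (𝓡 m) x).symm y) w) := by
  rw [symm_eq_mfderiv x hy, symm_eq_mfderiv x hy]; rfl

lemma contDiffOn_chartMetric (g : SmoothMetric m M) (x : M) (v w : EuclideanSpace ℝ (Fin m)) :
    ContDiffOn ℝ ∞ (fun y => chartMetric g x y v w) (extChartAt (𝓡 m) x).target := by
  rw [← contMDiffOn_iff_contDiffOn]
  refine ((contMDiffOn_inner_symm g x v w).comp (contMDiffOn_extChartAt_symm x) ?_).congr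
    fun y hy => chartMetric_eq g x hy v w
  intro y hy
  simpa using (extChartAt (𝓡 m) x).map_target hy

lemma mfderiv_symm_transition (x x' : M) {y : EuclideanSpace ℝ (Fin m)}
    (hy : y ∈ (extChartAt (𝓡 m) x').target)
    (hx : (extChartAt (𝓡 m) x').symm y ∈ (extChartAt (𝓡 m) x).source)
    (v : EuclideanSpace ℝ (Fin m)) :
    HasFDerivAt (extChartAt (𝓡 m) x ∘ (extChartAt (𝓡 m) x').symm)
      (fderiv ℝ (extChartAt (𝓡 m) x ∘ (extChartAt (𝓡 m) x').symm) y) y ∧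
    (⟨(extChartAt (𝓡 m) x').symm y, mfderiv (𝓡 m) (𝓡 m) (extChartAt (𝓡 m) x').symm y v⟩ :
      TangentBundle (𝓡 m) M) =
    ⟨(extChartAt (𝓡 m) x).symm ((extChartAt (𝓡 m) x ∘ (extChartAt (𝓡 m) x').symm) y),
      mfderiv (𝓡 m) (𝓡 m) (extChartAt (𝓡 m) x).symm
        ((extChartAt (𝓡 m) x ∘ (extChartAt (𝓡 m) x').symm) y)
      (fderiv ℝ (extChartAt (𝓡 m) x ∘ (extChartAt (𝓡 m) x').symm) y v)⟩ := by
  have ht' : (extChartAt (𝓡 m) x').target ∈ 𝓝 y := extChartAt_target_mem_nhds' hy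
  have hc' : ContMDiffAt (𝓡 m) (𝓡 m) ∞ (extChartAt (𝓡 m) x').symm y :=
    (contMDiffOn_extChartAt_symm x').contMDiffAt ht'
  have hc : ContMDiffAt (𝓡 m) (𝓡 m) ∞ (extChartAt (𝓡 m) x) ((extChartAt (𝓡 m) x').symm y) :=
    contMDiffAt_extChartAt' (by simpa using hx)
  have hcs : ContMDiffAt (𝓡 m) (𝓡 m) ∞ (extChartAt (𝓡 m) x).symm
      ((extChartAt (𝓡 m) x ∘ (extChartAt (𝓡 m) x').symm) y) :=
    (contMDiffOn_extChartAt_symm x).contMDiffAt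
      (extChartAt_target_mem_nhds' ((extChartAt (𝓡 m) x).map_source hx))
  have hτ : ContMDiffAt (𝓡 m) (𝓡 m) ∞ (extChartAt (𝓡 m) x ∘ (extChartAt (𝓡 m) x').symm) y :=
    hc.comp y hc'
  have hτd := (hτ.mdifferentiableAt (by simp))
  refine ⟨hτd.differentiableAt.hasFDerivAt, ?_⟩
  have hev : ((extChartAt (𝓡 m) x).symm ∘ (extChartAt (𝓡 m) x ∘ (extChartAt (𝓡 m) x').symm))
      =ᶠ[𝓝 y] (extChartAt (𝓡 m) x').symm := by
    filter_upwards [hc'.continuousAt.preimage_mem_nhds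
      ((isOpen_extChartAt_source (I := 𝓡 m) x).mem_nhds hx)] with z hz
    exact (extChartAt (𝓡 m) x).left_inv hz
  have h1 := tangentMap_comp_at (I := 𝓡 m) (I' := 𝓡 m) (I'' := 𝓡 m)
    (f := (extChartAt (𝓡 m) x ∘ (extChartAt (𝓡 m) x').symm)) (g := (extChartAt (𝓡 m) x).symm)
    (⟨y, v⟩ : TangentBundle (𝓡 m) (EuclideanSpace ℝ (Fin m)))
    (hcs.mdifferentiableAt (by simp)) hτd
  have h2 : tangentMap (𝓡 m) (𝓡 m) ((extChartAt (𝓡 m) x).symm ∘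
      (extChartAt (𝓡 m) x ∘ (extChartAt (𝓡 m) x').symm))
      (⟨y, v⟩ : TangentBundle (𝓡 m) (EuclideanSpace ℝ (Fin m))) =
      tangentMap (𝓡 m) (𝓡 m) (extChartAt (𝓡 m) x').symm ⟨y, v⟩ := by
    refine Bundle.TotalSpace.ext hev.eq_of_nhds ?_
    have h3 := congrArg (fun L : EuclideanSpace ℝ (Fin m) →L[ℝ] EuclideanSpace ℝ (Fin m) => L v)
      (hev.mfderiv_eq (I := 𝓡 m) (I' := 𝓡 m))
    exact heq_of_eq h3
  rw [h2] at h1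
  simp only [tangentMap, mfderiv_eq_fderiv] at h1
  exact h1

lemma chartMetric_transition (g : SmoothMetric m M) (x x' : M) {y : EuclideanSpace ℝ (Fin m)}
    (hy : y ∈ (extChartAt (𝓡 m) x').target)
    (hx : (extChartAt (𝓡 m) x').symm y ∈ (extChartAt (𝓡 m) x).source)
    (v w : EuclideanSpace ℝ (Fin m)) :
    chartMetric g x' y v w =
      chartMetric g x ((extChartAt (𝓡 m) x ∘ (extChartAt (𝓡 m) x').symm) y)
        (fderiv ℝ (extChartAt (𝓡 m) x ∘ (extChartAt (𝓡 m) x').symm) y v)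
        (fderiv ℝ (extChartAt (𝓡 m) x ∘ (extChartAt (𝓡 m) x').symm) y w) := by
  have key : ∀ (p q : M) (a b : TangentSpace (𝓡 m) p) (c d : TangentSpace (𝓡 m) q),
      (⟨p, a⟩ : TangentBundle (𝓡 m) M) = ⟨q, c⟩ → (⟨p, b⟩ : TangentBundle (𝓡 m) M) = ⟨q, d⟩ →
      g.inner p a b = g.inner q c d := by
    intro p q a b c d h1 h2
    cases h1; cases h2; rfl
  exact key _ _ _ _ _ _ (mfderiv_symm_transition x x' hy hx v).2
    (mfderiv_symm_transition x x' hy hx w).2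


lemma det_gramMatrix_transition (g : SmoothMetric m M) (x x' : M) {y : EuclideanSpace ℝ (Fin m)}
    (hy : y ∈ (extChartAt (𝓡 m) x').target)
    (hx : (extChartAt (𝓡 m) x').symm y ∈ (extChartAt (𝓡 m) x).source) :
    (gramMatrix g x' y).det =
      (fderiv ℝ (extChartAt (𝓡 m) x ∘ (extChartAt (𝓡 m) x').symm) y).det ^ 2 *
        (gramMatrix g x ((extChartAt (𝓡 m) x ∘ (extChartAt (𝓡 m) x').symm) y)).det := by
  set b := (EuclideanSpace.basisFun (Fin m) ℝ).toBasis
  set L := fderiv ℝ (extChartAt (𝓡 m) x ∘ (extChartAt (𝓡 m) x').symm) y with hL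
  set z := (extChartAt (𝓡 m) x ∘ (extChartAt (𝓡 m) x').symm) y with hz
  set P := LinearMap.toMatrix b b L.toLinearMap
  have hP : P.det = L.det := LinearMap.det_toMatrix b _
  have hsum : ∀ i, L (EuclideanSpace.basisFun (Fin m) ℝ i) =
      ∑ k, P k i • EuclideanSpace.basisFun (Fin m) ℝ k := by
    intro i
    have := b.sum_repr (L (EuclideanSpace.basisFun (Fin m) ℝ i))
    rw [← this]
    simp [P, b, LinearMap.toMatrix_apply]
  -- bilinearity of the metric in a chart
  have hbil : ∀ a c : Fin m → ℝ, chartMetric g x z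
      (∑ k, a k • EuclideanSpace.basisFun (Fin m) ℝ k)
      (∑ l, c l • EuclideanSpace.basisFun (Fin m) ℝ l) =
      ∑ k, ∑ l, a k * c l * gramMatrix g x z k l := by
    intro a c
    simp only [gramMatrix, Matrix.of_apply, chartMetric, map_sum, map_smul, _root_.sum_apply,
      _root_.smul_apply, smul_eq_mul]
    rw [Finset.sum_comm]
    simp only [Finset.mul_sum, mul_assoc]
    refine Finset.sum_congr rfl fun k _ => Finset.sum_congr rfl fun l _ => ?_
    ring
  have : gramMatrix g x' y = P.transpose * gramMatrix g x z * P := by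
    ext i j
    rw [gramMatrix, Matrix.of_apply, chartMetric_transition g x x' hy hx, ← hL, hsum, hsum, ← hz,
      hbil]
    simp only [Matrix.mul_apply, Matrix.transpose_apply, Finset.sum_mul]
    rw [Finset.sum_comm]
    refine Finset.sum_congr rfl fun k _ => Finset.sum_congr rfl fun l _ => ?_
    ring
  rw [this, Matrix.det_mul, Matrix.det_mul, Matrix.det_transpose, hP]
  ring

lemma continuousOn_gramMatrix (g : SmoothMetric m M) (x : M) :
    ContinuousOn (gramMatrix g x) (extChartAt (𝓡 m) x).target := by
  refine continuousOn_pi.2 fun i => continuousOn_pi.2 fun j => ?_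
  exact (contDiffOn_chartMetric g x _ _).continuousOn

lemma continuousOn_volumeDensity (g : SmoothMetric m M) (x : M) :
    ContinuousOn (fun y => ENNReal.ofReal √(gramMatrix g x y).det) (extChartAt (𝓡 m) x).target :=
  ENNReal.continuous_ofReal.comp_continuousOn <| Real.continuous_sqrt.comp_continuousOn <|
    (continuous_id.matrix_det).comp_continuousOn (continuousOn_gramMatrix g x)

section
variable [MeasurableSpace M] [BorelSpace M]

lemma chartVolume_apply (g : SmoothMetric m M) (x : M) {s : Set M} (hs : MeasurableSet s) :
    chartVolume g x s = ∫⁻ y in (extChartAt (𝓡 m) x).target ∩ (extChartAt (𝓡 m) x).symm ⁻¹' s,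
      ENNReal.ofReal √(gramMatrix g x y).det := by
  have ht : MeasurableSet (extChartAt (𝓡 m) x).target := (isOpen_extChartAt_target x).measurableSet
  have hm : AEMeasurable (extChartAt (𝓡 m) x).symm
      (volume.restrict (extChartAt (𝓡 m) x).target) :=
    (continuousOn_extChartAt_symm x).aemeasurable ht
  rw [chartVolume, Measure.map_apply_of_aemeasurable
    (hm.mono_ac (withDensity_absolutelyContinuous _ _)) hs]
  have hnull : NullMeasurableSet ((extChartAt (𝓡 m) x).symm ⁻¹' s)
      (volume.restrict (extChartAt (𝓡 m) x).target) := hm.nullMeasurableSet_preimage hs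
  rw [withDensity_apply₀ _ hnull, Measure.restrict_restrict₀ hnull, inter_comm]

lemma chartVolume_eq_of_subset (g : SmoothMetric m M) (x x' : M) {s : Set M} (hs : MeasurableSet s)
    (hx : s ⊆ (extChartAt (𝓡 m) x).source) (hx' : s ⊆ (extChartAt (𝓡 m) x').source) :
    chartVolume g x s = chartVolume g x' s := by
  set τ := extChartAt (𝓡 m) x ∘ (extChartAt (𝓡 m) x').symm with hτ
  set A := (extChartAt (𝓡 m) x').target ∩ (extChartAt (𝓡 m) x').symm ⁻¹' s with hA
  have hAm : MeasurableSet A := by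
    have h1 := (continuousOn_iff_continuous_domRestrict.1
      (continuousOn_extChartAt_symm (I := 𝓡 m) x')).measurable hs
    have h2 := (isOpen_extChartAt_target (I := 𝓡 m) x').measurableSet.subtype_image h1
    convert h2 using 1
    ext y
    simp [hA, Set.domRestrict, and_comm]
  have himg : (extChartAt (𝓡 m) x).target ∩ (extChartAt (𝓡 m) x).symm ⁻¹' s = τ '' A := by
    ext z
    constructor
    · rintro ⟨hz, hzs⟩
      refine ⟨extChartAt (𝓡 m) x' ((extChartAt (𝓡 m) x).symm z),
        ⟨(extChartAt (𝓡 m) x').map_source (hx' hzs), ?_⟩, ?_⟩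
      · rw [mem_preimage, (extChartAt (𝓡 m) x').left_inv (hx' hzs)]; exact hzs
      · rw [hτ, Function.comp_apply, (extChartAt (𝓡 m) x').left_inv (hx' hzs),
          (extChartAt (𝓡 m) x).right_inv hz]
    · rintro ⟨y, ⟨hy, hys⟩, rfl⟩
      refine ⟨(extChartAt (𝓡 m) x).map_source (hx hys), ?_⟩
      rw [mem_preimage, hτ, Function.comp_apply, (extChartAt (𝓡 m) x).left_inv (hx hys)]
      exact hys
  have hinj : InjOn τ A := by
    intro y hy z hz hyz
    have := (extChartAt (𝓡 m) x).injOn (hx hy.2) (hx hz.2) hyz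
    exact (extChartAt (𝓡 m) x').symm.injOn hy.1 hz.1 this
  rw [chartVolume_apply g x hs, chartVolume_apply g x' hs, himg,
    lintegral_image_eq_lintegral_abs_det_fderiv_mul volume hAm
      (fun y hy => (mfderiv_symm_transition x x' hy.1 (hx hy.2) 0).1.hasFDerivWithinAt) hinj]
  refine setLIntegral_congr_fun hAm fun y hy => ?_
  rw [det_gramMatrix_transition g x x' hy.1 (hx hy.2), Real.sqrt_mul (sq_nonneg _),
    Real.sqrt_sq_eq_abs, ENNReal.ofReal_mul (abs_nonneg _)]

/-- The Riemannian volume measure `dV_g`: the smallest measure that dominates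
`√(det g_{ij}) dy` in every chart. As these chart measures agree on overlaps, it is the measure that
agrees with all of them. -/
def riemannianVolume (g : SmoothMetric m M) : Measure M := ⨆ x : M, chartVolume g x

lemma isFiniteMeasure_riemannianVolume [CompactSpace M] (g : SmoothMetric m M) :
    IsFiniteMeasure (riemannianVolume g) := by
  have : LocallyCompactSpace M := ChartedSpace.locallyCompactSpace (EuclideanSpace ℝ (Fin m)) M
  -- around every point, an open set with finite volume in the chart at that point
  have hloc : ∀ x : M, ∃ V : Set M, IsOpen V ∧ x ∈ V ∧ V ⊆ (extChartAt (𝓡 m) x).source ∧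
      chartVolume g x V < ⊤ := by
    intro x
    obtain ⟨K, hK, hKs, hKc⟩ := local_compact_nhds (extChartAt_source_mem_nhds (I := 𝓡 m) x)
    obtain ⟨V, hVK, hV, hxV⟩ := mem_nhds_iff.1 hK
    refine ⟨V, hV, hxV, hVK.trans hKs, ?_⟩
    have hcK : IsCompact (extChartAt (𝓡 m) x '' K) :=
      hKc.image_of_continuousOn ((continuousOn_extChartAt x).mono hKs)
    have hsub : extChartAt (𝓡 m) x '' K ⊆ (extChartAt (𝓡 m) x).target := by
      rintro _ ⟨p, hp, rfl⟩; exact (extChartAt (𝓡 m) x).map_source (hKs hp)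
    obtain ⟨C, hC⟩ := hcK.exists_bound_of_continuousOn
      ((Real.continuous_sqrt.comp_continuousOn (continuous_id.matrix_det.comp_continuousOn
        (continuousOn_gramMatrix g x))).mono hsub)
    rw [chartVolume_apply g x hV.measurableSet]
    calc _ ≤ ∫⁻ y in extChartAt (𝓡 m) x '' K, ENNReal.ofReal √(gramMatrix g x y).det := by
            refine lintegral_mono_set ?_
            rintro y ⟨hy, hyV⟩
            exact ⟨_, hVK hyV, (extChartAt (𝓡 m) x).right_inv hy⟩
      _ ≤ ∫⁻ y in extChartAt (𝓡 m) x '' K, ENNReal.ofReal C := by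
            refine setLIntegral_mono' hcK.measurableSet fun y hy => ?_
            exact ENNReal.ofReal_le_ofReal ((le_abs_self _).trans (hC y hy))
      _ < ⊤ := by
            rw [setLIntegral_const]
            exact ENNReal.mul_lt_top ENNReal.ofReal_lt_top hcK.measure_lt_top
  choose V hV hxV hVs hVfin using hloc
  obtain ⟨t, ht⟩ := isCompact_univ.elim_nhds_subcover V (fun x _ => (hV x).mem_nhds (hxV x))
  set ν : Measure M := ∑ i ∈ t, (chartVolume g i).restrict (V i) with hν
  have hνfin : ν univ < ⊤ := by
    simp only [hν, Measure.coe_finsetSum, Finset.sum_apply, Measure.restrict_apply_univ]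
    exact ENNReal.sum_lt_top.2 fun i _ => hVfin i
  have hle : riemannianVolume g ≤ ν := by
    refine iSup_le fun x => Measure.le_iff.2 fun s hs => ?_
    have hsrc : MeasurableSet (extChartAt (𝓡 m) x).source :=
      (isOpen_extChartAt_source x).measurableSet
    have h1 : chartVolume g x s = chartVolume g x (s ∩ (extChartAt (𝓡 m) x).source) := by
      rw [chartVolume_apply g x hs, chartVolume_apply g x (hs.inter hsrc)]
      congr 2
      ext y
      simp only [mem_inter_iff, mem_preimage]
      exact ⟨fun h => ⟨h.1, h.2, (extChartAt (𝓡 m) x).map_target h.1⟩, fun h => ⟨h.1, h.2.1⟩⟩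
    rw [h1]
    calc _ ≤ chartVolume g x (⋃ i ∈ t, (s ∩ (extChartAt (𝓡 m) x).source) ∩ V i) := by
            refine measure_mono fun p hp => ?_
            obtain ⟨i, hi, hpi⟩ := mem_iUnion₂.1 (ht.2 (mem_univ p))
            exact mem_iUnion₂.2 ⟨i, hi, hp, hpi⟩
      _ ≤ ∑ i ∈ t, chartVolume g x ((s ∩ (extChartAt (𝓡 m) x).source) ∩ V i) :=
            measure_biUnion_finset_le _ _
      _ ≤ ∑ i ∈ t, (chartVolume g i).restrict (V i) s := by
            refine Finset.sum_le_sum fun i _ => ?_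
            rw [Measure.restrict_apply hs, chartVolume_eq_of_subset g x i
              ((hs.inter hsrc).inter (hV i).measurableSet) (fun p hp => hp.1.2)
              (fun p hp => hVs i hp.2)]
            exact measure_mono fun p hp => ⟨hp.1.1, hp.2⟩
      _ = ν s := by simp [hν, Measure.coe_finsetSum]
  exact ⟨(hle univ).trans_lt hνfin⟩

end

/-- The gradient `∇u` of `u` at `p`, i.e. the vector with `g(∇u, w) = du(w)` for all `w`. -/
def gradient (g : SmoothMetric m M) (u : M → ℝ) (p : M) : TangentSpace (𝓡 m) p :=
  (g.inner p).inverse (mvfderiv (𝓡 m) u p)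

lemma isInvertible_of_pos (L : EuclideanSpace ℝ (Fin m) →L[ℝ] EuclideanSpace ℝ (Fin m) →L[ℝ] ℝ)
    (hL : ∀ v, v ≠ 0 → 0 < L v v) : L.IsInvertible := by
  have hinj : Function.Injective L.toLinearMap := by
    rw [← LinearMap.ker_eq_bot, LinearMap.ker_eq_bot']
    intro v hv
    by_contra hne
    have h2 : L v v = 0 := by
      have : L v = 0 := hv
      rw [this]; rfl
    exact (hL v hne).ne' h2
  have hfin : Module.finrank ℝ (EuclideanSpace ℝ (Fin m)) =
      Module.finrank ℝ (EuclideanSpace ℝ (Fin m) →L[ℝ] ℝ) := by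
    rw [← (LinearMap.toContinuousLinearMap (𝕜 := ℝ) (E := EuclideanSpace ℝ (Fin m))
      (F' := ℝ)).finrank_eq, Module.finrank_linearMap_self]
  exact ⟨(LinearEquiv.ofInjectiveOfFinrankEq L.toLinearMap hinj hfin).toContinuousLinearEquiv, rfl⟩

lemma isInvertible_inner (g : SmoothMetric m M) (p : M) : (g.inner p).IsInvertible :=
  isInvertible_of_pos (g.inner p) (g.pos p)

lemma inner_gradient (g : SmoothMetric m M) (u : M → ℝ) (p : M) (w : TangentSpace (𝓡 m) p) :
    g.inner p (gradient g u p) w = mvfderiv (𝓡 m) u p w := by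
  rw [gradient, (isInvertible_inner g p).self_apply_inverse]


lemma continuous_inner_gradient (g : SmoothMetric m M) {u v : M → ℝ}
    (hu : ContMDiff (𝓡 m) 𝓘(ℝ, ℝ) ∞ u) (hv : ContMDiff (𝓡 m) 𝓘(ℝ, ℝ) ∞ v) :
    Continuous fun p => g.inner p (gradient g u p) (gradient g v p) := by
  refine continuous_iff_continuousAt.2 fun x => ?_
  set U := (chartAt (EuclideanSpace ℝ (Fin m)) x).source with hU
  have hUx : U ∈ 𝓝 x := chart_source_mem_nhds _ x
  set e := trivializationAt (EuclideanSpace ℝ (Fin m)) (TangentSpace (𝓡 m)) x with he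
  let S : M → EuclideanSpace ℝ (Fin m) →L[ℝ] EuclideanSpace ℝ (Fin m) := fun p => e.symmL ℝ p
  let L : M → EuclideanSpace ℝ (Fin m) →L[ℝ] EuclideanSpace ℝ (Fin m) →L[ℝ] ℝ := fun p => g.inner p
  let d : (M → ℝ) → M → EuclideanSpace ℝ (Fin m) →L[ℝ] ℝ :=
    fun f p => mfderiv (𝓡 m) 𝓘(ℝ, ℝ) f p
  let G : M → EuclideanSpace ℝ (Fin m) →L[ℝ] EuclideanSpace ℝ (Fin m) →L[ℝ] ℝ :=
    fun p => (L p).bilinearComp (S p) (S p)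
  -- continuity of the coordinate expressions
  have hG : ContinuousOn G U := by
    refine continuousOn_clm_apply.2 fun a => continuousOn_clm_apply.2 fun b => ?_
    refine (contMDiffOn_inner_symm g x a b).continuousOn.congr fun p hp => ?_
    show g.inner p (e.symmL ℝ p a) (e.symmL ℝ p b) = _
    rw [e.symmL_apply hp, e.symmL_apply hp]
  have hd : ∀ f : M → ℝ, ContMDiff (𝓡 m) 𝓘(ℝ, ℝ) ∞ f →
      ContinuousOn (fun p => (d f p).comp (S p)) U := by
    intro f hf
    have hfc : ContDiffOn ℝ ∞ (f ∘ (extChartAt (𝓡 m) x).symm) (extChartAt (𝓡 m) x).target := by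
      rw [← contMDiffOn_iff_contDiffOn]
      exact hf.comp_contMDiffOn (contMDiffOn_extChartAt_symm x)
    have hfd := hfc.continuousOn_fderiv_of_isOpen (isOpen_extChartAt_target x) (by simp)
    have hsrc : (extChartAt (𝓡 m) x).source = U := extChartAt_source _ x
    refine (hfd.comp ((continuousOn_extChartAt (I := 𝓡 m) x).mono hsrc.ge)
      (fun p hp => (extChartAt (𝓡 m) x).map_source (hsrc.ge hp))).congr fun p hp => ?_
    have hp' := hsrc.ge hp
    have hy := (extChartAt (𝓡 m) x).map_source hp'
    have hS : (S p : EuclideanSpace ℝ (Fin m) →L[ℝ] EuclideanSpace ℝ (Fin m)) =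
        mfderiv (𝓡 m) (𝓡 m) (extChartAt (𝓡 m) x).symm (extChartAt (𝓡 m) x p) := by
      have h := TangentBundle.symmL_trivializationAt (I := 𝓡 m) hp
      simp only [modelWithCornersSelf_coe, range_id, mfderivWithin_univ] at h
      exact h
    have hcomp := mfderiv_comp (I := 𝓡 m) (I' := 𝓡 m) (I'' := 𝓘(ℝ, ℝ)) (g := f)
      (extChartAt (𝓡 m) x p) (hf.mdifferentiable (by simp) _)
      (((contMDiffOn_extChartAt_symm (n := ∞) x).contMDiffAt
        (extChartAt_target_mem_nhds' hy)).mdifferentiableAt (by simp))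
    rw [mfderiv_eq_fderiv] at hcomp
    have h3 : d f ((extChartAt (𝓡 m) x).symm (extChartAt (𝓡 m) x p)) = d f p := by
      rw [(extChartAt (𝓡 m) x).left_inv hp']
    show (d f p).comp (S p) = fderiv ℝ (f ∘ (extChartAt (𝓡 m) x).symm) (extChartAt (𝓡 m) x p)
    rw [hS, ← h3]
    exact hcomp.symm
  -- the coordinate formula
  have hinv : ∀ p ∈ U, (G p).IsInvertible ∧ g.inner p (gradient g u p) (gradient g v p) =
      ((d u p).comp (S p)) ((G p).inverse ((d v p).comp (S p))) := by
    intro p hp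
    let A : EuclideanSpace ℝ (Fin m) ≃L[ℝ] EuclideanSpace ℝ (Fin m) :=
      (e.continuousLinearEquivAt ℝ p hp).symm
    have hA : ∀ w, A w = S p w := fun w => by
      show _ = e.symmL ℝ p w
      rw [e.symmL_apply hp]; rfl
    have hGi : (G p).IsInvertible := by
      refine isInvertible_of_pos _ fun a ha => g.pos p (S p a) ?_
      rw [← hA]
      exact fun h => ha (A.map_eq_zero_iff.1 h)
    refine ⟨hGi, ?_⟩
    set c := (G p).inverse ((d v p).comp (S p)) with hc
    have hGc : G p c = (d v p).comp (S p) := hGi.self_apply_inverse _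
    have hSc : S p c = gradient g v p := by
      refine (isInvertible_inner g p).injective ?_
      refine ContinuousLinearMap.ext fun w => ?_
      rw [inner_gradient]
      obtain ⟨b, rfl⟩ := A.surjective w
      rw [hA]
      exact congrArg (fun T : EuclideanSpace ℝ (Fin m) →L[ℝ] ℝ => T b) hGc
    rw [inner_gradient, ← hSc]
    rfl
  have hev : (fun p => g.inner p (gradient g u p) (gradient g v p)) =ᶠ[𝓝 x]
      fun p => ((d u p).comp (S p)) ((G p).inverse ((d v p).comp (S p))) := by
    filter_upwards [hUx] with p hp using (hinv p hp).2
  refine ContinuousAt.congr ?_ hev.symm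
  have hGi : ContinuousAt (fun p => (G p).inverse) x := by
    have h1 : ContinuousAt ContinuousLinearMap.inverse (G x) :=
      ((hinv x (mem_of_mem_nhds hUx)).1.contDiffAt_map_inverse (n := 0)).continuousAt
    exact h1.comp (hG.continuousAt hUx)
  exact ((hd u hu).continuousAt hUx).clm_apply (hGi.clm_apply ((hd v hv).continuousAt hUx))


/-! ### The Sobolev space -/

lemma gradient_add (g : SmoothMetric m M) (u v : C^∞⟮𝓡 m, M; ℝ⟯) (p : M) :
    gradient g (u + v : C^∞⟮𝓡 m, M; ℝ⟯) p = gradient g u p + gradient g v p := by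
  rw [gradient, gradient, gradient, ← map_add]
  congr 1
  exact mfderiv_add (u.contMDiff.mdifferentiable (by simp) p)
    (v.contMDiff.mdifferentiable (by simp) p)

lemma gradient_smul (g : SmoothMetric m M) (c : ℝ) (u : C^∞⟮𝓡 m, M; ℝ⟯) (p : M) :
    gradient g (c • u : C^∞⟮𝓡 m, M; ℝ⟯) p = c • gradient g u p := by
  rw [gradient, gradient, ← map_smul]
  congr 1
  exact const_smul_mfderiv (u.contMDiff.mdifferentiable (by simp) p) c

/-- The integrand `g(∇u, ∇v) + u v`. -/
def sobolevIntegrand (g : SmoothMetric m M) (u v : C^∞⟮𝓡 m, M; ℝ⟯) (p : M) : ℝ :=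
  g.inner p (gradient g u p) (gradient g v p) + u p * v p

lemma sobolevIntegrand_add (g : SmoothMetric m M) (u v w : C^∞⟮𝓡 m, M; ℝ⟯) (p : M) :
    sobolevIntegrand g (u + v) w p = sobolevIntegrand g u w p + sobolevIntegrand g v w p := by
  have h : (u + v : C^∞⟮𝓡 m, M; ℝ⟯) p = u p + v p := rfl
  simp only [sobolevIntegrand, gradient_add, map_add, _root_.add_apply, h]
  ring

lemma sobolevIntegrand_smul (g : SmoothMetric m M) (u v : C^∞⟮𝓡 m, M; ℝ⟯) (c : ℝ) (p : M) :
    sobolevIntegrand g (c • u) v p = c * sobolevIntegrand g u v p := by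
  have h : (c • u : C^∞⟮𝓡 m, M; ℝ⟯) p = c * u p := rfl
  simp only [sobolevIntegrand, gradient_smul, map_smul, _root_.smul_apply, h, smul_eq_mul]
  ring

section Sobolev
variable [MeasurableSpace M] [BorelSpace M] [CompactSpace M]

/-- `C^∞(M)`, regarded as a space with the inner product
`⟨u, v⟩ = ∫ g(∇u, ∇v) + u v dV_g`. -/
def SmoothFunctions (_g : SmoothMetric m M) : Type u := C^∞⟮𝓡 m, M; ℝ⟯

instance (g : SmoothMetric m M) : AddCommGroup (SmoothFunctions g) :=
  inferInstanceAs (AddCommGroup C^∞⟮𝓡 m, M; ℝ⟯)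

instance (g : SmoothMetric m M) : Module ℝ (SmoothFunctions g) :=
  inferInstanceAs (Module ℝ C^∞⟮𝓡 m, M; ℝ⟯)

lemma integrable_sobolevIntegrand (g : SmoothMetric m M) (u v : C^∞⟮𝓡 m, M; ℝ⟯) :
    Integrable (sobolevIntegrand g u v) (riemannianVolume g) := by
  have := isFiniteMeasure_riemannianVolume g
  have hc : Continuous (sobolevIntegrand g u v) :=
    (continuous_inner_gradient g u.contMDiff v.contMDiff).add
      (u.contMDiff.continuous.mul v.contMDiff.continuous)
  exact hc.integrable_of_hasCompactSupport (HasCompactSupport.of_compactSpace _)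

instance sobolevCore (g : SmoothMetric m M) : PreInnerProductSpace.Core ℝ (SmoothFunctions g) where
  inner u v := ∫ p, sobolevIntegrand g u v p ∂(riemannianVolume g)
  conj_inner_symm u v := by
    simp only [conj_trivial]
    refine integral_congr_ae (ae_of_all _ fun p => ?_)
    simp only [sobolevIntegrand]
    rw [g.symm, mul_comm]
  re_inner_nonneg u := by
    refine integral_nonneg fun p => add_nonneg ?_ (mul_self_nonneg _)
    rcases eq_or_ne (gradient g (show C^∞⟮𝓡 m, M; ℝ⟯ from u) p) 0 with h | h
    · exact (by rw [h]; simp :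
        0 ≤ g.inner p (gradient g (show C^∞⟮𝓡 m, M; ℝ⟯ from u) p)
          (gradient g (show C^∞⟮𝓡 m, M; ℝ⟯ from u) p))
    · exact (g.pos p _ h).le
  add_left u v w := by
    rw [← integral_add (integrable_sobolevIntegrand g u w) (integrable_sobolevIntegrand g v w)]
    refine integral_congr_ae (ae_of_all _ fun p => ?_)
    exact sobolevIntegrand_add g u v w p
  smul_left u v c := by
    rw [conj_trivial, ← integral_const_mul]
    refine integral_congr_ae (ae_of_all _ fun p => ?_)
    exact sobolevIntegrand_smul g u v c p

instance (g : SmoothMetric m M) : SeminormedAddCommGroup (SmoothFunctions g) :=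
  InnerProductSpace.Core.toSeminormedAddCommGroup (𝕜 := ℝ)

instance (g : SmoothMetric m M) : InnerProductSpace ℝ (SmoothFunctions g) :=
  InnerProductSpace.ofCore (sobolevCore g)

/-- The Sobolev space `H¹_g(M)`: the completion of `C^∞(M)` in the norm of
the inner product `∫ g(∇u, ∇v) + u v dV_g`. -/
abbrev SobolevSpace (g : SmoothMetric m M) : Type u := UniformSpace.Completion (SmoothFunctions g)

/-- The inclusion `C^∞(M) → H¹_g(M)`. -/
def smoothToSobolev (g : SmoothMetric m M) : C^∞⟮𝓡 m, M; ℝ⟯ →ₗ[ℝ] SobolevSpace g :=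
  (UniformSpace.Completion.toComplₗᵢ (𝕜 := ℝ) (E := SmoothFunctions g)).toLinearMap

/-- `H¹_g(M)^F`: the closure in `H¹_g(M)` of the smooth functions that are constant on each leaf. -/
def SingularRiemannianFoliation.sobolevSubspace {g : SmoothMetric m M}
    (F : SingularRiemannianFoliation g) : Submodule ℝ (SobolevSpace g) :=
  (F.invariantFunctions.map (smoothToSobolev g)).topologicalClosure

end Sobolev
end
end FoliatedGeometry

open FoliatedGeometry

/-! Fix any leaf `L`. It is closed, hence compact, and it is not all of `M`. Near `L` let `f` be the
squared length of the short geodesic that joins a point to `L` orthogonally. In Fermi coordinates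
`f` is smooth, and by the Gauss lemma its differential at `p` is twice the pairing with the final
velocity of that geodesic. The geodesic leaves `L` orthogonally, so by transnormality it is
orthogonal to the leaf through `p` as well: `df` vanishes on the tangent spaces of the leaves. A
bump function of `f` supported in a compact part of `(0, ε)`, extended by zero, is therefore smooth
with differential zero along every leaf, and as leaves are connected it is constant on them. Since
`M` is connected and `L ≠ M`, all values in `(0, ε)` are attained, so disjoint intervals of values
give nonzero functions with disjoint supports (`exists_proper_tube`, `exists_invariantFunction`,
`exists_disjoint_invariantFunctions`).

Three points need work. The first is smooth dependence of flows on the initial value. It comes from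
the inverse function theorem in a space of curves, at a stationary point whose linearization squares
to zero; this covers the geodesic field on the zero section and families of fields at parameter zero
(`exists_smooth_flow`, `exists_fermiChart`).

The second is that a closed leaf is embedded, so that near a point of `L` only one plaque of `L` is
seen. Baire's theorem gives one point where the leaf topology is the induced one, and flows of
tangent vector fields spread this property over the connected leaf (`isInducing_incl`).

The third is that the locally built functions `f` agree near `L`. Each satisfies `|df|² ≤ 4 f`, and
integrating this along the joining geodesic of another one shows that each is at most the other
(`le_of_deriv_sq_le`, `exists_tube`).

Functions with disjoint supports are linearly independent. They remain so in the Sobolev space,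
because the Riemannian volume is positive on nonempty open sets and so a smooth function of norm
zero vanishes. -/

namespace FoliatedGeometry

/-! ### Smooth inverse function theorem -/

section InverseFunction

variable {X Y : Type*} [NormedAddCommGroup X] [NormedSpace ℝ X] [CompleteSpace X]
  [NormedAddCommGroup Y] [NormedSpace ℝ Y]

/-- Invertibility of the derivative is an open condition, so the source can be shrunk to points
where it holds; the inverse is then smooth on the whole target and not only at the image of `a`. The
spaces may be infinite dimensional, since the theorem is applied to spaces of curves. -/
theorem exists_smooth_localInverse {f : X → Y} {U : Set X} (hU : IsOpen U)
    (hf : ContDiffOn ℝ ∞ f U) {a : X} (ha : a ∈ U) (f' : X ≃L[ℝ] Y)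
    (hf' : HasFDerivAt f (f' : X →L[ℝ] Y) a) :
    ∃ e : OpenPartialHomeomorph X Y, a ∈ e.source ∧ e.source ⊆ U ∧ (∀ x, e x = f x) ∧
      ContDiffOn ℝ ∞ e.symm e.target := by
  have hfa : ContDiffAt ℝ ∞ f a := hf.contDiffAt (hU.mem_nhds ha)
  let e₀ := hfa.toOpenPartialHomeomorph f hf' (by simp)
  have he₀ : ∀ x, e₀ x = f x := fun x => rfl
  have hcont : ContinuousOn (fderiv ℝ f) U := hf.continuousOn_fderiv_of_isOpen hU (by simp)
  let W : Set X := U ∩ fderiv ℝ f ⁻¹' range ((↑) : (X ≃L[ℝ] Y) → X →L[ℝ] Y)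
  have hW : IsOpen W := hcont.isOpen_inter_preimage hU ContinuousLinearEquiv.isOpen
  have haW : a ∈ W := ⟨ha, f', hf'.fderiv.symm⟩
  let e := e₀.restrOpen W hW
  have hes : e.source = e₀.source ∩ W := e₀.restrOpen_source W hW
  refine ⟨e, ?_, ?_, fun x => rfl, ?_⟩
  · rw [hes]
    exact ⟨hfa.mem_toOpenPartialHomeomorph_source hf' (by simp), haW⟩
  · rw [hes]
    exact fun x hx => hx.2.1
  · intro y hy
    have hx : e.symm y ∈ W := by
      have := e.map_target hy
      rw [hes] at this
      exact this.2
    obtain ⟨hxU, L, hL⟩ := hx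
    have hd := hf.contDiffAt (hU.mem_nhds hxU)
    refine (e.contDiffAt_symm hy (f₀' := L) ?_ hd).contDiffWithinAt
    rw [hL]
    exact (hd.differentiableAt (by simp)).hasFDerivAt

end InverseFunction

/-! ### Superposition operators -/

section Superposition

universe v
variable {I : Type*} [TopologicalSpace I] [CompactSpace I]
  {B F H : Type v} [NormedAddCommGroup B] [NormedSpace ℝ B] [NormedAddCommGroup F]
  [NormedSpace ℝ F] [NormedAddCommGroup H] [NormedSpace ℝ H]

/-- A bounded bilinear map applied pointwise to curves. -/
noncomputable def pointwiseBilin (I : Type*) [TopologicalSpace I] [CompactSpace I]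
    (b : H →L[ℝ] B →L[ℝ] F) : C(I, H) →L[ℝ] C(I, B) →L[ℝ] C(I, F) :=
  LinearMap.mkContinuous₂
    (LinearMap.mk₂ ℝ (fun (L : C(I, H)) (η : C(I, B)) =>
        (⟨fun t => b (L t) (η t), by fun_prop⟩ : C(I, F)))
      (fun _ _ _ => by ext; simp) (fun _ _ _ => by ext; simp) (fun _ _ _ => by ext; simp)
      (fun _ _ _ => by ext; simp)) ‖b‖ (by
    intro L η
    rw [ContinuousMap.norm_le _ (by positivity)]
    intro t
    refine (b.le_opNorm₂ (L t) (η t)).trans ?_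
    gcongr
    · exact L.norm_coe_le_norm t
    · exact η.norm_coe_le_norm t)

lemma pointwiseBilin_apply (b : H →L[ℝ] B →L[ℝ] F) (L : C(I, H)) (η : C(I, B)) (t : I) :
    pointwiseBilin I b L η t = b (L t) (η t) := rfl

/-- Postcomposition with `V'` is continuous for the uniform norm, which yields one radius `δ` for
all times; the mean value inequality on the ball of radius `δ` around each `γ t` then bounds the
remainder uniformly. -/
theorem hasFDerivAt_superposition (b : H →L[ℝ] B →L[ℝ] F) (V : C(B, F)) (V' : C(B, H))
    (hV : ∀ x, HasFDerivAt V (b (V' x)) x) (γ : C(I, B)) :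
    HasFDerivAt (fun γ : C(I, B) => V.comp γ) (pointwiseBilin I b (V'.comp γ)) γ := by
  rw [hasFDerivAt_iff_isLittleO, Asymptotics.isLittleO_iff]
  intro ε hε
  have hc : ContinuousAt (fun γ : C(I, B) => V'.comp γ) γ :=
    (ContinuousMap.continuous_postcomp V').continuousAt
  obtain ⟨δ, hδ, h⟩ := Metric.continuousAt_iff.1 hc (ε / (‖b‖ + 1)) (by positivity)
  filter_upwards [Metric.ball_mem_nhds γ hδ] with η hη
  rw [ContinuousMap.norm_le _ (by positivity)]
  intro t
  have hpt : ∀ z ∈ Metric.ball (γ t) δ, ‖b (V' z) - b (V' (γ t))‖ ≤ ε := by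
    intro z hz
    -- The translate of `γ` by the constant `z - γ t` passes through `z` at time `t`, so continuity
    -- at the curve `γ` controls `V' z - V' (γ t)` with `δ` independent of `t`.
    have hn : dist (γ + ContinuousMap.const I (z - γ t)) γ < δ := by
      rw [dist_eq_norm, add_sub_cancel_left]
      rw [Metric.mem_ball, dist_eq_norm] at hz
      exact ((ContinuousMap.norm_le _ (norm_nonneg _)).2 fun s => le_rfl).trans_lt hz
    have := (ContinuousMap.dist_apply_le_dist t).trans_lt (h hn)
    rw [dist_eq_norm] at this
    rw [← map_sub]
    refine (b.le_opNorm _).trans ?_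
    have h2 : ‖V' z - V' (γ t)‖ ≤ ε / (‖b‖ + 1) := by simpa using this.le
    calc ‖b‖ * ‖V' z - V' (γ t)‖ ≤ (‖b‖ + 1) * (ε / (‖b‖ + 1)) := by gcongr; linarith
      _ = ε := by field_simp
  have hηt : η t ∈ Metric.ball (γ t) δ :=
    Metric.mem_ball.2 ((ContinuousMap.dist_apply_le_dist t).trans_lt (Metric.mem_ball.1 hη))
  have := (convex_ball (γ t) δ).norm_image_sub_le_of_norm_hasFDerivWithin_le'
    (fun z _ => (hV z).hasFDerivWithinAt) hpt (Metric.mem_ball_self hδ) hηt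
  refine (le_trans (le_of_eq ?_) this).trans ?_
  · simp [pointwiseBilin_apply]
  · gcongr
    exact (η - γ).norm_coe_le_norm t

/-- The derivative of the superposition operator is pointwise multiplication by the superposition
with `fderiv ℝ V`. The induction thus passes from target `F` to target `B →L[ℝ] F`, which is why `F`
is quantified after `n` and shares its universe with `B`. -/
theorem contDiff_superposition_nat (n : ℕ) :
    ∀ {F : Type v} [NormedAddCommGroup F] [NormedSpace ℝ F] (V : C(B, F)), ContDiff ℝ n V →
      ContDiff ℝ n (fun γ : C(I, B) => V.comp γ) := by
  induction n with
  | zero =>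
    intro F _ _ V _
    exact contDiff_zero.2 (ContinuousMap.continuous_postcomp V)
  | succ n ih =>
    intro F _ _ V hV
    rw [Nat.cast_add, Nat.cast_one, contDiff_succ_iff_fderiv] at hV ⊢
    obtain ⟨hd, -, hV'⟩ := hV
    have h := fun γ : C(I, B) => hasFDerivAt_superposition (ContinuousLinearMap.id ℝ (B →L[ℝ] F)) V
      ⟨fderiv ℝ V, hV'.continuous⟩ (fun x => (hd x).hasFDerivAt) γ
    refine ⟨fun γ => (h γ).differentiableAt, by simp, ?_⟩
    rw [funext fun γ => (h γ).fderiv]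
    exact (pointwiseBilin I (ContinuousLinearMap.id ℝ (B →L[ℝ] F))).contDiff.comp (ih _ hV')

theorem contDiff_superposition (V : C(B, F)) (hV : ContDiff ℝ ∞ V) :
    ContDiff ℝ ∞ (fun γ : C(I, B) => V.comp γ) :=
  contDiff_infty.2 fun n => contDiff_superposition_nat n V (contDiff_infty.1 hV n)

/-- The derivative of a superposition operator, as a pointwise multiplication. -/
noncomputable def superpositionDeriv (V : C(B, F)) (hV : ContDiff ℝ ∞ V) (γ : C(I, B)) :
    C(I, B) →L[ℝ] C(I, F) :=
  pointwiseBilin I (ContinuousLinearMap.id ℝ (B →L[ℝ] F))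
    (ContinuousMap.comp ⟨fderiv ℝ V, hV.continuous_fderiv (by simp)⟩ γ)

lemma hasFDerivAt_superpositionDeriv (V : C(B, F)) (hV : ContDiff ℝ ∞ V) (γ : C(I, B)) :
    HasFDerivAt (fun γ : C(I, B) => V.comp γ) (superpositionDeriv V hV γ) γ :=
  hasFDerivAt_superposition _ V _ (fun x => (hV.differentiable (by simp) x).hasFDerivAt) γ

end Superposition

/-! ### Integral equations on a fixed interval around `[0, 1]` -/

/-- The time interval on which curves are considered. -/
abbrev TimeInterval : Set ℝ := Icc (-1 : ℝ) 2

lemma timeInterval_le : (-1 : ℝ) ≤ 2 := by norm_num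

/-- Projection of the line onto the time interval. -/
noncomputable abbrev clampTime : ℝ → TimeInterval := projIcc (-1 : ℝ) 2 timeInterval_le

lemma coe_clampTime {t : ℝ} (ht : t ∈ TimeInterval) : (clampTime t : ℝ) = t := by
  rw [clampTime, projIcc_of_mem _ ht]

section Volterra

variable {B : Type*} [NormedAddCommGroup B]

lemma continuous_clamp (γ : C(TimeInterval, B)) : Continuous fun τ => γ (clampTime τ) :=
  γ.continuous.comp continuous_projIcc

lemma abs_le_two_of_mem {t : ℝ} (ht : t ∈ TimeInterval) : |t| ≤ 2 :=
  abs_le.2 ⟨by linarith [ht.1], ht.2⟩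

variable [NormedSpace ℝ B] [CompleteSpace B]

/-- Integration of curves from time `0`. -/
noncomputable def volterra (B : Type*) [NormedAddCommGroup B] [NormedSpace ℝ B] [CompleteSpace B] :
    C(TimeInterval, B) →L[ℝ] C(TimeInterval, B) :=
  LinearMap.mkContinuous
    { toFun := fun γ => ⟨fun t => ∫ τ in (0 : ℝ)..t, γ (clampTime τ),
        (intervalIntegral.continuous_primitive
          (fun _ _ => (continuous_clamp γ).intervalIntegrable _ _) 0).comp continuous_subtype_val⟩
      map_add' := fun γ η => by
        ext t
        exact intervalIntegral.integral_add ((continuous_clamp γ).intervalIntegrable _ _)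
          ((continuous_clamp η).intervalIntegrable _ _)
      map_smul' := fun c γ => by
        ext t
        exact intervalIntegral.integral_smul c _ } 2 (by
    intro γ
    rw [ContinuousMap.norm_le _ (by positivity)]
    intro t
    refine (intervalIntegral.norm_integral_le_of_norm_le_const
      (fun τ _ => γ.norm_coe_le_norm (clampTime τ))).trans ?_
    rw [sub_zero, mul_comm]
    gcongr
    exact abs_le_two_of_mem t.2)

lemma volterra_apply (γ : C(TimeInterval, B)) (t : TimeInterval) :
    volterra B γ t = ∫ τ in (0 : ℝ)..t, γ (clampTime τ) := rfl

lemma hasDerivAt_of_eq_add_volterra {α β : C(TimeInterval, B)} {x : B}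
    (h : ∀ t, α t = x + volterra B β t) {t : ℝ} (ht : t ∈ Ioo (-1 : ℝ) 2) :
    HasDerivAt (fun t => α (clampTime t)) (β (clampTime t)) t := by
  have h1 : HasDerivAt (fun t => x + ∫ τ in (0 : ℝ)..t, β (clampTime τ)) (β (clampTime t)) t :=
    ((continuous_clamp β).integral_hasStrictDerivAt 0 t).hasDerivAt.const_add x
  refine h1.congr_of_eventuallyEq ?_
  filter_upwards [Ioo_mem_nhds ht.1 ht.2] with s hs
  rw [h, volterra_apply, coe_clampTime (Ioo_subset_Icc_self hs)]

lemma eq_at_zero_of_eq_add_volterra {α β : C(TimeInterval, B)} {x : B}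
    (h : ∀ t, α t = x + volterra B β t) : α (clampTime 0) = x := by
  rw [h, volterra_apply, coe_clampTime (by constructor <;> norm_num)]
  simp

lemma eq_add_volterra_of_hasDerivAt {α β : C(TimeInterval, B)}
    (h : ∀ t ∈ Ioo (-1 : ℝ) 2, HasDerivAt (fun t => α (clampTime t)) (β (clampTime t)) t)
    (t : TimeInterval) : α t = α (clampTime 0) + volterra B β t := by
  have hsub : uIcc (0 : ℝ) t ⊆ Icc (-1 : ℝ) 2 :=
    uIcc_subset_Icc (by constructor <;> norm_num) t.2
  have hsub' : Ioo (min (0 : ℝ) t) (max (0 : ℝ) t) ⊆ Ioo (-1 : ℝ) 2 := by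
    refine Ioo_subset_Ioo (le_min (by norm_num) t.2.1) (max_le (by norm_num) t.2.2)
  have := intervalIntegral.integral_eq_sub_of_hasDeriv_right
    (f := fun t => α (clampTime t)) (f' := fun t => β (clampTime t)) (a := 0) (b := (t : ℝ))
    (continuous_clamp α).continuousOn (fun s hs => (h s (hsub' hs)).hasDerivWithinAt)
    ((continuous_clamp β).intervalIntegrable _ _)
  rw [volterra_apply, this]
  simp [clampTime]

lemma volterra_comp_clm {F : Type*} [NormedAddCommGroup F] [NormedSpace ℝ F] [CompleteSpace F]
    (A : B →L[ℝ] F) (γ : C(TimeInterval, B)) (t : TimeInterval) :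
    A (volterra B γ t) = ∫ τ in (0 : ℝ)..t, A (γ (clampTime τ)) :=
  (A.intervalIntegral_comp_comm ((continuous_clamp γ).intervalIntegrable _ _)).symm

end Volterra

/-! ### Smooth dependence on the initial value near a stationary point -/

section Flow

variable {B : Type*} [NormedAddCommGroup B] [NormedSpace ℝ B] [CompleteSpace B]

/-- `γ` is the integral curve of `V` on the time interval that starts at `x`. -/
def IsFlowLine (V : C(B, B)) (x : B) (γ : C(TimeInterval, B)) : Prop :=
  ∀ t, γ t = x + volterra B (V.comp γ) t

lemma IsFlowLine.zero {V : C(B, B)} {x : B} {γ : C(TimeInterval, B)} (h : IsFlowLine V x γ) :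
    γ (clampTime 0) = x := eq_at_zero_of_eq_add_volterra h

lemma IsFlowLine.hasDerivAt {V : C(B, B)} {x : B} {γ : C(TimeInterval, B)}
    (h : IsFlowLine V x γ) {t : ℝ} (ht : t ∈ Ioo (-1 : ℝ) 2) :
    HasDerivAt (fun t => γ (clampTime t)) (V (γ (clampTime t))) t :=
  hasDerivAt_of_eq_add_volterra h ht

lemma isFlowLine_of_hasDerivAt {V : C(B, B)} {γ : C(TimeInterval, B)}
    (h : ∀ t ∈ Ioo (-1 : ℝ) 2,
      HasDerivAt (fun t => γ (clampTime t)) (V (γ (clampTime t))) t) :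
    IsFlowLine V (γ (clampTime 0)) γ :=
  eq_add_volterra_of_hasDerivAt (β := V.comp γ) h

/-- The flow of a smooth vector field near a stationary point at which the linearization has
square zero: it exists for all times in the time interval, depends smoothly on the initial value,
and its linearization solves the variational equation. -/
theorem exists_smooth_flow (V : C(B, B)) (hV : ContDiff ℝ ∞ V) (x₀ : B) (h₀ : V x₀ = 0)
    (hA : (fderiv ℝ V x₀).comp (fderiv ℝ V x₀) = 0) :
    ∃ (𝒰 : Set C(TimeInterval, B)) (N : Set B) (Γ : B → C(TimeInterval, B)),
      IsOpen 𝒰 ∧ ContinuousMap.const _ x₀ ∈ 𝒰 ∧ IsOpen N ∧ x₀ ∈ N ∧ ContDiffOn ℝ ∞ Γ N ∧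
      Γ x₀ = ContinuousMap.const _ x₀ ∧ (∀ x ∈ N, Γ x ∈ 𝒰 ∧ IsFlowLine V x (Γ x)) ∧
      (∀ γ ∈ 𝒰, ∀ x, IsFlowLine V x γ → x ∈ N ∧ γ = Γ x) ∧
      (∀ ξ t, fderiv ℝ Γ x₀ ξ t = ξ + (t : ℝ) • fderiv ℝ V x₀ ξ) ∧
      (∀ x ∈ N, ∀ ξ, fderiv ℝ Γ x ξ (clampTime 0) = ξ ∧ ∀ t ∈ Ioo (-1 : ℝ) 2,
        HasDerivAt (fun t => fderiv ℝ Γ x ξ (clampTime t))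
          (fderiv ℝ V (Γ x (clampTime t)) (fderiv ℝ Γ x ξ (clampTime t))) t) := by
  -- Flow lines starting at `x` are the solutions of `Ψ γ = c x`, so a smooth local inverse of `Ψ`,
  -- restricted to constant curves, is the flow.
  let Ψ : C(TimeInterval, B) → C(TimeInterval, B) := fun γ => γ - volterra B (V.comp γ)
  have hΨ : ContDiff ℝ ∞ Ψ :=
    contDiff_id.sub ((volterra B).contDiff.comp (contDiff_superposition V hV))
  let K : C(TimeInterval, B) → C(TimeInterval, B) →L[ℝ] C(TimeInterval, B) := fun γ =>
    (volterra B).comp (superpositionDeriv V hV γ)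
  have hΨ' : ∀ γ, HasFDerivAt Ψ (ContinuousLinearMap.id ℝ _ - K γ) γ := fun γ =>
    (hasFDerivAt_id γ).sub
      ((volterra B).hasFDerivAt.comp γ (hasFDerivAt_superpositionDeriv V hV γ))
  let c : B →L[ℝ] C(TimeInterval, B) := ContinuousLinearMap.const ℝ TimeInterval
  have hc : ∀ x t, c x t = x := fun x t => rfl
  let A := fderiv ℝ V x₀
  have hKA : ∀ η t, K (c x₀) η t = ∫ τ in (0 : ℝ)..t, A (η (clampTime τ)) := fun η t => rfl
  -- At the constant curve, `K` integrates `A` applied to the curve. Moving `A` inside the integral,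
  -- `K ∘ K` contains `A ∘ A = 0`; hence `id + K` inverts `id - K` with no smallness of the time
  -- interval.
  have hKK : (K (c x₀)).comp (K (c x₀)) = 0 := by
    ext η t
    have : ∀ τ : ℝ, A (K (c x₀) η (clampTime τ)) = 0 := by
      intro τ
      have h1 : K (c x₀) η (clampTime τ) =
        volterra B (superpositionDeriv V hV (c x₀) η) (clampTime τ) := rfl
      have h2 : ∀ v, A (A v) = 0 := fun v => congrArg (fun L : B →L[ℝ] B => L v) hA
      rw [h1, volterra_comp_clm]
      have h3 : ∀ s, A (superpositionDeriv V hV (c x₀) η (clampTime s)) = 0 :=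
        fun s => h2 _
      simp [h3]
    rw [ContinuousLinearMap.comp_apply, hKA]
    simp [this]
  have hinv : ∀ η, K (c x₀) (K (c x₀) η) = 0 := fun η =>
    congrArg (fun L : C(TimeInterval, B) →L[ℝ] C(TimeInterval, B) => L η) hKK
  let D : C(TimeInterval, B) ≃L[ℝ] C(TimeInterval, B) :=
    ContinuousLinearEquiv.equivOfInverse (ContinuousLinearMap.id ℝ _ - K (c x₀))
      (ContinuousLinearMap.id ℝ _ + K (c x₀)) (fun η => by simp [hinv]) (fun η => by simp [hinv])
  obtain ⟨e, he, -, hee, hes⟩ := exists_smooth_localInverse isOpen_univ hΨ.contDiffOn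
    (mem_univ (c x₀)) D (hΨ' (c x₀))
  have hΨx : ∀ γ x, Ψ γ = c x ↔ IsFlowLine V x γ := by
    intro γ x
    rw [IsFlowLine]
    show γ - volterra B (V.comp γ) = c x ↔ _
    rw [sub_eq_iff_eq_add, ContinuousMap.ext_iff]
    rfl
  have hΨ₀ : Ψ (c x₀) = c x₀ := by
    rw [hΨx]
    intro t
    have : ∀ τ, (V.comp (c x₀)) (clampTime τ) = 0 := fun τ => h₀
    rw [volterra_apply]
    simp [this, hc]
  let N : Set B := c ⁻¹' e.target
  have hN : IsOpen N := e.open_target.preimage c.continuous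
  have hx₀ : x₀ ∈ N := by
    show c x₀ ∈ e.target
    rw [← hΨ₀, ← hee]
    exact e.map_source he
  let Γ : B → C(TimeInterval, B) := fun x => e.symm (c x)
  have hΓ : ContDiffOn ℝ ∞ Γ N := hes.comp c.contDiff.contDiffOn fun x hx => hx
  have hΨΓ : ∀ x ∈ N, Ψ (Γ x) = c x := fun x hx => by
    rw [← hee]; exact e.right_inv hx
  have hΓ₀ : Γ x₀ = c x₀ := by
    show e.symm (c x₀) = c x₀
    conv_lhs => rw [← hΨ₀, ← hee]
    exact e.left_inv he
  -- The integrated variational equation, obtained by differentiating `Ψ (Γ x) = c x`.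
  have hvar : ∀ x ∈ N, ∀ ξ, fderiv ℝ Γ x ξ - K (Γ x) (fderiv ℝ Γ x ξ) = c ξ := by
    intro x hx ξ
    have h1 : HasFDerivAt (Ψ ∘ Γ) _ x := (hΨ' (Γ x)).comp x
      ((hΓ.contDiffAt (hN.mem_nhds hx)).differentiableAt (by simp)).hasFDerivAt
    have h2 : HasFDerivAt (Ψ ∘ Γ) c x := c.hasFDerivAt.congr_of_eventuallyEq
      (by filter_upwards [hN.mem_nhds hx] with y hy using hΨΓ y hy)
    exact congrArg (fun L : B →L[ℝ] C(TimeInterval, B) => L ξ) (h1.unique h2)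
  refine ⟨e.source, N, Γ, e.open_source, he, hN, hx₀, hΓ, hΓ₀, ?_, ?_, ?_, ?_⟩
  · exact fun x hx => ⟨e.map_target hx, (hΨx _ _).1 (hΨΓ x hx)⟩
  · intro γ hγ x hx
    have hx' := (hΨx γ x).2 hx
    refine ⟨?_, ?_⟩
    · show c x ∈ e.target
      rw [← hx', ← hee]
      exact e.map_source hγ
    · show γ = e.symm (c x)
      rw [← hx', ← hee]
      exact (e.left_inv hγ).symm
  · intro ξ t
    have h1 := hvar x₀ hx₀ ξ
    rw [hΓ₀] at h1
    -- Applying `K` once more and using `K ∘ K = 0` solves the variational equation explicitly: the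
    -- solution is `c ξ + K (c ξ)`.
    have h2 := congrArg (fun η => K (c x₀) η) h1
    simp only [map_sub, hinv, sub_zero] at h2
    rw [sub_eq_iff_eq_add.1 h1, h2]
    show ξ + K (c x₀) (c ξ) t = _
    rw [hKA]
    simp [hc, A]
  · intro x hx ξ
    have h1 : ∀ t, fderiv ℝ Γ x ξ t = ξ + volterra B
        (superpositionDeriv V hV (Γ x) (fderiv ℝ Γ x ξ)) t := by
      intro t
      have := congrArg (fun η : C(TimeInterval, B) => η t) (sub_eq_iff_eq_add.1 (hvar x hx ξ))
      exact this
    exact ⟨eq_at_zero_of_eq_add_volterra h1, fun t ht => hasDerivAt_of_eq_add_volterra h1 ht⟩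

/-- A smooth map near a point agrees there with a globally smooth map. -/
lemma exists_contDiff_eventuallyEq {E F : Type*} [NormedAddCommGroup E] [NormedSpace ℝ E]
    [FiniteDimensional ℝ E] [NormedAddCommGroup F] [NormedSpace ℝ F] {f : E → F} {U : Set E}
    (hU : IsOpen U) (hf : ContDiffOn ℝ ∞ f U) {x : E} (hx : x ∈ U) :
    ∃ f' : E → F, ContDiff ℝ ∞ f' ∧ f' =ᶠ[𝓝 x] f := by
  obtain ⟨r, hr, hrU⟩ := Metric.isOpen_iff.1 hU x hx
  let χ : ContDiffBump x := ⟨r / 4, r / 2, by positivity, by linarith⟩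
  refine ⟨fun y => χ y • f y, ?_, ?_⟩
  · rw [contDiff_iff_contDiffAt]
    intro y
    by_cases hy : y ∈ U
    · exact χ.contDiff.contDiffAt.smul (hf.contDiffAt (hU.mem_nhds hy))
    · have hy' : y ∉ tsupport χ := by
        rw [χ.tsupport_eq]
        intro h
        exact hy (hrU (Metric.closedBall_subset_ball (by show r / 2 < r; linarith) h))
      refine contDiffAt_const (c := (0 : F)) |>.congr_of_eventuallyEq ?_
      filter_upwards [(isClosed_tsupport χ).isOpen_compl.mem_nhds hy'] with z hz
      rw [image_eq_zero_of_notMem_tsupport hz, zero_smul]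
  · filter_upwards [χ.eventuallyEq_one] with y hy
    simp [hy]

end Flow

/-! ### Geodesics of a metric on an open subset of a vector space -/

section GeodesicField

set_option maxSynthPendingDepth 3

variable {E : Type*} [NormedAddCommGroup E] [NormedSpace ℝ E]

/-- A smooth Riemannian metric on an open subset of a vector space. -/
structure IsSmoothMetricOn (G : E → E →L[ℝ] E →L[ℝ] ℝ) (T : Set E) : Prop where
  isOpen : IsOpen T
  contDiffOn : ContDiffOn ℝ ∞ G T
  symm : ∀ y ∈ T, ∀ v w, G y v w = G y w v
  pos : ∀ y ∈ T, ∀ v, v ≠ 0 → 0 < G y v v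

/-- The quadratic form in the geodesic equation, as a bilinear form depending on the velocity. -/
noncomputable def geodesicForm (G : E → E →L[ℝ] E →L[ℝ] ℝ) (y v : E) : E →L[ℝ] E →L[ℝ] ℝ :=
  (1 / 2 : ℝ) • ((fderiv ℝ G y).flip v).flip - fderiv ℝ G y v

lemma geodesicForm_apply (G : E → E →L[ℝ] E →L[ℝ] ℝ) (y v u w : E) :
    geodesicForm G y v u w = 1 / 2 * fderiv ℝ G y w v u - fderiv ℝ G y v u w := by
  simp [geodesicForm]

/-- The acceleration of the geodesic through `y` with velocity `v`. -/
noncomputable def geodesicAcc (G : E → E →L[ℝ] E →L[ℝ] ℝ) (y v : E) : E :=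
  (G y).inverse (geodesicForm G y v v)

/-- The geodesic vector field. -/
noncomputable def geodesicField (G : E → E →L[ℝ] E →L[ℝ] ℝ) (z : E × E) : E × E :=
  (z.2, geodesicAcc G z.1 z.2)

lemma geodesicField_zero (G : E → E →L[ℝ] E →L[ℝ] ℝ) (y : E) : geodesicField G (y, 0) = 0 := by
  simp [geodesicField, geodesicAcc]

variable [FiniteDimensional ℝ E] {G : E → E →L[ℝ] E →L[ℝ] ℝ} {T : Set E}

lemma isInvertible_of_posDef (L : E →L[ℝ] E →L[ℝ] ℝ) (hL : ∀ v, v ≠ 0 → 0 < L v v) :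
    L.IsInvertible := by
  have hinj : Function.Injective L.toLinearMap := by
    rw [← LinearMap.ker_eq_bot, LinearMap.ker_eq_bot']
    intro v hv
    by_contra hne
    have h2 : L v v = 0 := by
      have : L v = 0 := hv
      rw [this]; rfl
    exact (hL v hne).ne' h2
  have hfin : Module.finrank ℝ E = Module.finrank ℝ (E →L[ℝ] ℝ) := by
    rw [← (LinearMap.toContinuousLinearMap (𝕜 := ℝ) (E := E) (F' := ℝ)).finrank_eq,
      Module.finrank_linearMap_self]
  exact ⟨(LinearEquiv.ofInjectiveOfFinrankEq L.toLinearMap hinj hfin).toContinuousLinearEquiv, rfl⟩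

namespace IsSmoothMetricOn
variable (hG : IsSmoothMetricOn G T)
include hG

lemma isInvertible {y : E} (hy : y ∈ T) : (G y).IsInvertible :=
  isInvertible_of_posDef _ (hG.pos y hy)

lemma hasFDerivAt {y : E} (hy : y ∈ T) : HasFDerivAt G (fderiv ℝ G y) y :=
  ((hG.contDiffOn.contDiffAt (hG.isOpen.mem_nhds hy)).differentiableAt (by simp)).hasFDerivAt

lemma acc_eq {y : E} (hy : y ∈ T) (v w : E) :
    G y (geodesicAcc G y v) w = 1 / 2 * fderiv ℝ G y w v v - fderiv ℝ G y v v w := by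
  rw [geodesicAcc, (hG.isInvertible hy).self_apply_inverse, geodesicForm_apply]

lemma contDiffOn_inverse : ContDiffOn ℝ ∞ (fun y => (G y).inverse) T := fun y hy =>
  ((hG.isInvertible hy).contDiffAt_map_inverse.comp y
    (hG.contDiffOn.contDiffAt (hG.isOpen.mem_nhds hy))).contDiffWithinAt

lemma contDiffOn_geodesicForm :
    ContDiffOn ℝ ∞ (fun z : E × E => geodesicForm G z.1 z.2) (T ×ˢ univ) := by
  have h1 : ContDiffOn ℝ ∞ (fun z : E × E => fderiv ℝ G z.1) (T ×ˢ univ) :=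
    (hG.contDiffOn.fderiv_of_isOpen hG.isOpen (m := ∞) (by simp)).comp contDiffOn_fst
      (fun z hz => hz.1)
  let fl : (E →L[ℝ] E →L[ℝ] E →L[ℝ] ℝ) →L[ℝ] (E →L[ℝ] E →L[ℝ] E →L[ℝ] ℝ) :=
    (ContinuousLinearMap.flipₗᵢ ℝ E E (E →L[ℝ] ℝ)).toContinuousLinearEquiv
  let fl' : (E →L[ℝ] E →L[ℝ] ℝ) →L[ℝ] (E →L[ℝ] E →L[ℝ] ℝ) :=
    (ContinuousLinearMap.flipₗᵢ ℝ E E ℝ).toContinuousLinearEquiv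
  have h2 := fl'.contDiff.comp_contDiffOn ((fl.contDiff.comp_contDiffOn h1).clm_apply contDiffOn_snd)
  exact (h2.const_smul (1 / 2 : ℝ)).sub (h1.clm_apply contDiffOn_snd)

lemma contDiffOn_geodesicField : ContDiffOn ℝ ∞ (geodesicField G) (T ×ˢ univ) := by
  have h1 : ContDiffOn ℝ ∞ (fun z : E × E => (G z.1).inverse) (T ×ˢ univ) :=
    hG.contDiffOn_inverse.comp contDiffOn_fst (fun z hz => hz.1)
  exact contDiffOn_snd.prodMk
    (h1.clm_apply (hG.contDiffOn_geodesicForm.clm_apply contDiffOn_snd))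

/-- The acceleration is quadratic in the velocity: it is an operator, itself zero at velocity zero,
applied to the velocity, so it has no first-order part there. The linearization `(ξ, η) ↦ (η, 0)`
squares to zero, as `exists_smooth_flow` requires. -/
lemma hasFDerivAt_geodesicField_zero {y : E} (hy : y ∈ T) :
    HasFDerivAt (geodesicField G)
      ((ContinuousLinearMap.snd ℝ E E).prod (0 : E × E →L[ℝ] E)) (y, 0) := by
  have hmem : T ×ˢ (univ : Set E) ∈ 𝓝 (y, (0 : E)) :=
    (hG.isOpen.prod isOpen_univ).mem_nhds ⟨hy, mem_univ _⟩
  have hN := (((hG.contDiffOn_inverse.comp contDiffOn_fst (fun z (hz : z ∈ T ×ˢ (univ : Set E)) =>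
    hz.1)).clm_comp hG.contDiffOn_geodesicForm).contDiffAt hmem).differentiableAt (by simp)
  have := hN.hasFDerivAt.clm_apply (hasFDerivAt_snd (𝕜 := ℝ) (p := (y, (0 : E))))
  refine hasFDerivAt_snd.prodMk (this.congr_fderiv ?_)
  ext <;> simp [geodesicForm]

lemma continuousOn_acc : ContinuousOn (fun z : E × E => geodesicAcc G z.1 z.2) (T ×ˢ univ) :=
  continuous_snd.comp_continuousOn hG.contDiffOn_geodesicField.continuousOn

/-- The derivative of the squared norm on phase space. -/
lemma hasFDerivAt_energy {z : E × E} (hz : z.1 ∈ T) :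
    ∃ L : E × E →L[ℝ] ℝ, HasFDerivAt (fun z : E × E => G z.1 z.2 z.2) L z ∧
      ∀ ζ, L ζ = fderiv ℝ G z.1 ζ.1 z.2 z.2 + 2 * G z.1 z.2 ζ.2 := by
  have h := (((hG.hasFDerivAt hz).comp z hasFDerivAt_fst).clm_apply
    (hasFDerivAt_snd (𝕜 := ℝ) (p := z))).clm_apply (hasFDerivAt_snd (𝕜 := ℝ) (p := z))
  refine ⟨_, h, fun ζ => ?_⟩
  simp [hG.symm _ hz ζ.2 z.2]
  ring

/-- The geodesic equation turns the derivative into half the derivative of the energy in the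
direction `(j, j')`. For a variation through geodesics this is half the variation of the squared
speed, which is the first variation formula behind the Gauss lemma. -/
lemma hasDerivAt_inner_vel {c v j j' : ℝ → E} {t : ℝ} (hct : c t ∈ T)
    (hc : HasDerivAt c (v t) t) (hv : HasDerivAt v (geodesicAcc G (c t) (v t)) t)
    (hj : HasDerivAt j (j' t) t) :
    HasDerivAt (fun t => G (c t) (v t) (j t))
      ((fderiv ℝ G (c t) (j t) (v t) (v t) + 2 * G (c t) (v t) (j' t)) / 2) t := by
  have h := (((hG.hasFDerivAt hct).comp_hasDerivAt t hc).clm_apply hv).clm_apply hj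
  refine h.congr_deriv ?_
  simp only [Function.comp_apply, _root_.add_apply]
  rw [hG.acc_eq hct]
  ring

lemma hasDerivAt_speed {c v : ℝ → E} {t : ℝ} (hct : c t ∈ T)
    (hc : HasDerivAt c (v t) t) (hv : HasDerivAt v (geodesicAcc G (c t) (v t)) t) :
    HasDerivAt (fun t => G (c t) (v t) (v t)) 0 t := by
  have h := hG.hasDerivAt_inner_vel (j' := fun t => geodesicAcc G (c t) (v t)) hct hc hv hv
  refine h.congr_deriv ?_
  rw [hG.symm _ hct, hG.acc_eq hct]
  ring

lemma speed_eq {c v : ℝ → E} (hcT : ∀ t ∈ Ioo (-1 : ℝ) 2, c t ∈ T)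
    (hc : ∀ t ∈ Ioo (-1 : ℝ) 2, HasDerivAt c (v t) t)
    (hv : ∀ t ∈ Ioo (-1 : ℝ) 2, HasDerivAt v (geodesicAcc G (c t) (v t)) t)
    {t : ℝ} (ht : t ∈ Ioo (-1 : ℝ) 2) :
    G (c t) (v t) (v t) = G (c 0) (v 0) (v 0) := by
  have h := fun t ht => hG.hasDerivAt_speed (hcT t ht) (hc t ht) (hv t ht)
  exact isOpen_Ioo.is_const_of_deriv_eq_zero isPreconnected_Ioo
    (fun t ht => (h t ht).differentiableAt.differentiableWithinAt)
    (fun t ht => (h t ht).deriv) ht ⟨by norm_num, by norm_num⟩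

end IsSmoothMetricOn

end GeodesicField

/-! ### Fermi coordinates around an immersed submanifold of a vector space -/

section Fermi

set_option maxSynthPendingDepth 3

universe v

variable {E : Type v} [NormedAddCommGroup E] [NormedSpace ℝ E]
  {D : Type v} [NormedAddCommGroup D] [NormedSpace ℝ D]

/-- Fermi coordinates around the point `σ s₀` of an immersed submanifold: every point `y` of `W` is
joined to a foot point on the submanifold by a geodesic that is orthogonal to the submanifold, and
the squared length `sq y` of this geodesic satisfies the Gauss lemma. -/
structure FermiChart (G : E → E →L[ℝ] E →L[ℝ] ℝ) (T : Set E) (σ : D → E) (U : Set D) (s₀ : D) where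
  W : Set E
  isOpen : IsOpen W
  mem : σ s₀ ∈ W
  sq : E → ℝ
  contDiffOn_sq : ContDiffOn ℝ ∞ sq W
  foot : E → D
  foot_mem : ∀ y ∈ W, foot y ∈ U
  curve : E → ℝ → E
  vel : E → ℝ → E
  continuousOn_curve : ContinuousOn (fun z : E × ℝ => curve z.1 z.2) (W ×ˢ univ)
  curve_mem : ∀ y ∈ W, ∀ t ∈ Ioo (-1 : ℝ) 2, curve y t ∈ T
  hasDerivAt_curve : ∀ y ∈ W, ∀ t ∈ Ioo (-1 : ℝ) 2, HasDerivAt (curve y) (vel y t) t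
  hasDerivAt_vel : ∀ y ∈ W, ∀ t ∈ Ioo (-1 : ℝ) 2,
    HasDerivAt (vel y) (geodesicAcc G (curve y t) (vel y t)) t
  curve_zero : ∀ y ∈ W, curve y 0 = σ (foot y)
  curve_one : ∀ y ∈ W, curve y 1 = y
  normal : ∀ y ∈ W, ∀ a, G (curve y 0) (vel y 0) (fderiv ℝ σ (foot y) a) = 0
  speed : ∀ y ∈ W, ∀ t ∈ Ioo (-1 : ℝ) 2, G (curve y t) (vel y t) (vel y t) = sq y
  gauss : ∀ y ∈ W, ∀ w, fderiv ℝ sq y w = 2 * G y (vel y 1) w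
  eventually_foot : ∀ᶠ s in 𝓝 s₀, σ s ∈ W ∧ foot (σ s) = s ∧ sq (σ s) = 0 ∧
    ∀ t, curve (σ s) t = σ s

/-- Both ends `0` and `1` of the joining geodesics are interior to the time interval, so two-sided
derivatives are available there. -/
lemma zero_mem_Ioo : (0 : ℝ) ∈ Ioo (-1 : ℝ) 2 := ⟨by norm_num, by norm_num⟩

lemma one_mem_Ioo : (1 : ℝ) ∈ Ioo (-1 : ℝ) 2 := ⟨by norm_num, by norm_num⟩

variable [FiniteDimensional ℝ E] {G : E → E →L[ℝ] E →L[ℝ] ℝ} {T : Set E}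

/-- The geodesic flow near a point of the zero section. -/
theorem IsSmoothMetricOn.exists_geodesicFlow (hG : IsSmoothMetricOn G T) {y₀ : E} (hy₀ : y₀ ∈ T) :
    ∃ (N : Set (E × E)) (Γ : E × E → C(TimeInterval, E × E)), IsOpen N ∧ (y₀, 0) ∈ N ∧
      ContDiffOn ℝ ∞ Γ N ∧
      (∀ x ∈ N, Γ x (clampTime 0) = x) ∧
      (∀ x ∈ N, ∀ t, (Γ x t).1 ∈ T) ∧
      (∀ x ∈ N, ∀ t ∈ Ioo (-1 : ℝ) 2,
        HasDerivAt (fun t => Γ x (clampTime t)) (geodesicField G (Γ x (clampTime t))) t) ∧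
      (∀ y, (y, 0) ∈ N → ∀ t, Γ (y, 0) t = (y, 0)) ∧
      (∀ ξ t, fderiv ℝ Γ (y₀, 0) ξ t = (ξ.1 + (t : ℝ) • ξ.2, ξ.2)) ∧
      (∀ x ∈ N, ∀ ξ, fderiv ℝ Γ x ξ (clampTime 0) = ξ ∧ ∀ t ∈ Ioo (-1 : ℝ) 2,
        HasDerivAt (fun t => (fderiv ℝ Γ x ξ (clampTime t)).1)
          (fderiv ℝ Γ x ξ (clampTime t)).2 t) := by
  have hTo : IsOpen (T ×ˢ (univ : Set E)) := hG.isOpen.prod isOpen_univ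
  -- The flow theorem needs a globally defined field, so the geodesic field is cut off; below, `R`
  -- is a neighbourhood on which nothing has changed, and initial values are restricted so that flow
  -- lines stay in it.
  obtain ⟨V₀, hV₀, hVeq⟩ := exists_contDiff_eventuallyEq hTo hG.contDiffOn_geodesicField
    (x := (y₀, (0 : E))) ⟨hy₀, mem_univ _⟩
  let V : C(E × E, E × E) := ⟨V₀, hV₀.continuous⟩
  obtain ⟨R, hRsub, hR, hyR⟩ := mem_nhds_iff.1
    (Filter.inter_mem hVeq (hTo.mem_nhds ⟨hy₀, mem_univ _⟩))
  have hVR : ∀ z ∈ R, V z = geodesicField G z := fun z hz => (hRsub hz).1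
  have hVR' : ∀ z ∈ R, V =ᶠ[𝓝 z] geodesicField G := fun z hz => by
    filter_upwards [hR.mem_nhds hz] with w hw using hVR w hw
  have hVzero : V (y₀, 0) = 0 := by rw [hVR _ hyR, geodesicField_zero]
  have hV' : fderiv ℝ V (y₀, 0) = (ContinuousLinearMap.snd ℝ E E).prod (0 : E × E →L[ℝ] E) := by
    rw [(hVR' _ hyR).fderiv_eq, (hG.hasFDerivAt_geodesicField_zero hy₀).fderiv]
  obtain ⟨𝒰, N, Γ, h𝒰, hc𝒰, hN, hyN, hΓ, hΓ₀, hflow, huniq, hder, hvar⟩ :=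
    exists_smooth_flow V hV₀ (y₀, 0) hVzero (by rw [hV']; ext <;> simp)
  let 𝒱 : Set C(TimeInterval, E × E) := {γ | MapsTo γ univ R}
  have h𝒱 : IsOpen 𝒱 := ContinuousMap.isOpen_setOfPred_mapsTo isCompact_univ hR
  let c : E →L[ℝ] C(TimeInterval, E × E) :=
    (ContinuousLinearMap.const ℝ TimeInterval).comp (ContinuousLinearMap.inl ℝ E E)
  -- The last two conditions make the constant curve at `(x.1, 0)` a flow line belonging to `𝒰`, so
  -- that uniqueness identifies it with `Γ (x.1, 0)`.
  let N' : Set (E × E) := (N ∩ Γ ⁻¹' 𝒱) ∩ {x | c x.1 ∈ 𝒰 ∧ (x.1, (0 : E)) ∈ R}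
  have hN' : IsOpen N' := by
    refine (hΓ.continuousOn.isOpen_inter_preimage hN h𝒱).inter (IsOpen.and ?_ ?_)
    · exact h𝒰.preimage (c.continuous.comp continuous_fst)
    · exact hR.preimage (by fun_prop : Continuous fun x : E × E => (x.1, (0 : E)))
  have hmem : ∀ x ∈ N', ∀ t, Γ x t ∈ R := fun x hx t => hx.1.2 (mem_univ t)
  refine ⟨N', Γ, hN', ⟨⟨hyN, ?_⟩, hc𝒰, hyR⟩, hΓ.mono fun x hx => hx.1.1, ?_, ?_, ?_, ?_, ?_, ?_⟩
  · show Γ (y₀, 0) ∈ 𝒱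
    rw [hΓ₀]
    exact fun t _ => hyR
  · exact fun x hx => (hflow x hx.1.1).2.zero
  · exact fun x hx t => (hRsub (hmem x hx t)).2.1
  · intro x hx t ht
    rw [← hVR _ (hmem x hx _)]
    exact (hflow x hx.1.1).2.hasDerivAt ht
  · intro y hy t
    have h1 : IsFlowLine V (y, 0) (c y) := by
      refine isFlowLine_of_hasDerivAt (γ := c y) fun t _ => ?_
      have : V (c y (clampTime t)) = 0 := by
        show V (y, 0) = 0
        rw [hVR _ hy.2.2, geodesicField_zero]
      rw [this]
      exact hasDerivAt_const t ((y, 0) : E × E)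
    rw [← (huniq _ hy.2.1 _ h1).2]
    rfl
  · intro ξ t
    rw [hder, hV']
    ext <;> simp
  · intro x hx ξ
    obtain ⟨h1, h2⟩ := hvar x hx.1.1 ξ
    refine ⟨h1, fun t ht => ?_⟩
    have h3 : HasDerivAt (fun t => (fderiv ℝ Γ x ξ (clampTime t)).1)
        (fderiv ℝ V (Γ x (clampTime t)) (fderiv ℝ Γ x ξ (clampTime t))).1 t :=
      ((ContinuousLinearMap.fst ℝ E E).hasFDerivAt.comp_hasDerivAt t (h2 t ht))
    refine h3.congr_deriv ?_
    -- The first component of the geodesic field is the velocity itself, so the first component of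
    -- its linearization picks out the velocity part of the variation.
    have hz := hmem x hx (clampTime t)
    have hd : HasFDerivAt (geodesicField G) (fderiv ℝ V (Γ x (clampTime t))) (Γ x (clampTime t)) :=
      ((hV₀.differentiable (by simp) _).hasFDerivAt (f := V)).congr_of_eventuallyEq
        (hVR' _ hz).symm
    have h4 : HasFDerivAt (fun z : E × E => z.2) _ (Γ x (clampTime t)) := hd.fst
    exact congrArg (fun l : E × E →L[ℝ] E => l (fderiv ℝ Γ x ξ (clampTime t)))
      (h4.unique hasFDerivAt_snd)

/-- This inverts the normal exponential map without parametrizing the normal bundle: all initial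
velocities are allowed, and the failure to be normal is recorded as a second component. The Gauss
lemma follows by pairing the velocity of the geodesic with the variation field that belongs to
moving its end point. -/
theorem IsSmoothMetricOn.exists_fermiChart [FiniteDimensional ℝ D] (hG : IsSmoothMetricOn G T)
    {σ : D → E} {U : Set D} (hU : IsOpen U) (hσ : ContDiffOn ℝ ∞ σ U) {s₀ : D} (hs₀ : s₀ ∈ U)
    (hT : σ s₀ ∈ T) (hinj : Function.Injective (fderiv ℝ σ s₀)) :
    Nonempty (FermiChart G T σ U s₀) := by
  obtain ⟨N, Γ, hN, hyN, hΓ, hΓ0, hΓT, hΓd, hΓc, hΓder, hΓvar⟩ := hG.exists_geodesicFlow hT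
  let O : Set (D × E) := (U ×ˢ univ) ∩ (fun z : D × E => (σ z.1, z.2)) ⁻¹' N
  have hσ1 : ContDiffOn ℝ ∞ (fun z : D × E => (σ z.1, z.2)) (U ×ˢ univ) :=
    (hσ.comp contDiffOn_fst (fun z hz => hz.1)).prodMk contDiffOn_snd
  have hO : IsOpen O := hσ1.continuousOn.isOpen_inter_preimage (hU.prod isOpen_univ) hN
  have hOs : (s₀, (0 : E)) ∈ O := ⟨⟨hs₀, mem_univ _⟩, hyN⟩
  have hOT : ∀ z ∈ O, σ z.1 ∈ T := fun z hz => by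
    have := hΓT _ hz.2 (clampTime 0)
    rwa [hΓ0 _ hz.2] at this
  have hx : ContDiffOn ℝ ∞ (fun z : D × E => (σ z.1, z.2)) O := hσ1.mono inter_subset_left
  let ev : C(TimeInterval, E × E) →L[ℝ] E × E := ContinuousMap.evalCLM ℝ (clampTime 1)
  have hev : ContDiffOn ℝ ∞ (fun z : D × E => ev (Γ (σ z.1, z.2))) O :=
    ev.contDiff.comp_contDiffOn (hΓ.comp hx fun z hz => hz.2)
  have hσ' : ContDiffOn ℝ ∞ (fderiv ℝ σ) U := hσ.fderiv_of_isOpen hU (by simp)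
  have hG1 : ContDiffOn ℝ ∞ (fun z : D × E => G (σ z.1)) O :=
    hG.contDiffOn.comp ((hσ.comp contDiffOn_fst (fun z (hz : z ∈ O) => hz.1.1))) hOT
  have hn : ContDiffOn ℝ ∞ (fun z : D × E => (G (σ z.1) z.2).comp (fderiv ℝ σ z.1)) O :=
    (hG1.clm_apply contDiffOn_snd).clm_comp (hσ'.comp contDiffOn_fst (fun z hz => hz.1.1))
  -- End point of the geodesic from `σ s` with velocity `v`, together with the pairing of `v` with
  -- the tangent space of the submanifold; the second component is zero exactly for normal `v`.
  let Θ : D × E → E × (D →L[ℝ] ℝ) := fun z =>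
    ((ev (Γ (σ z.1, z.2))).1, (G (σ z.1) z.2).comp (fderiv ℝ σ z.1))
  have hΘ : ContDiffOn ℝ ∞ Θ O := hev.fst.prodMk hn
  -- the derivative of `Θ` at the base point
  set L := fderiv ℝ Θ (s₀, 0) with hL
  have hΘd : HasFDerivAt Θ L (s₀, 0) :=
    ((hΘ.contDiffAt (hO.mem_nhds hOs)).differentiableAt (by simp)).hasFDerivAt
  have hσd : HasFDerivAt σ (fderiv ℝ σ s₀) s₀ :=
    ((hσ.contDiffAt (hU.mem_nhds hs₀)).differentiableAt (by simp)).hasFDerivAt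
  have hLapp : ∀ a v, L (a, v) = (fderiv ℝ σ s₀ a + v, (G (σ s₀) v).comp (fderiv ℝ σ s₀)) := by
    intro a v
    have h1 : HasFDerivAt (fun z : D × E => (σ z.1, z.2)) _ (s₀, (0 : E)) :=
      (HasFDerivAt.comp (s₀, (0 : E)) hσd hasFDerivAt_fst).prodMk hasFDerivAt_snd
    have h2 : HasFDerivAt (fun z : D × E => ev (Γ (σ z.1, z.2))) _ (s₀, (0 : E)) :=
      ev.hasFDerivAt.comp (s₀, (0 : E)) (HasFDerivAt.comp (s₀, (0 : E))
      ((hΓ.contDiffAt (hN.mem_nhds hyN)).differentiableAt (by simp)).hasFDerivAt h1)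
    have h3 := ((hG1.contDiffAt (hO.mem_nhds hOs)).differentiableAt (by simp)).hasFDerivAt.clm_apply
      (hasFDerivAt_snd (𝕜 := ℝ) (p := (s₀, (0 : E))))
    have h4 := h3.clm_comp (((hσ'.comp contDiffOn_fst (fun z (hz : z ∈ O) => hz.1.1)).contDiffAt
      (hO.mem_nhds hOs)).differentiableAt (by simp)).hasFDerivAt
    rw [hΘd.unique (h2.fst.prodMk h4)]
    refine Prod.ext ?_ ?_
    · simp only [ContinuousLinearMap.prod_apply, ContinuousLinearMap.comp_apply]
      show (fderiv ℝ Γ (σ s₀, 0) (fderiv ℝ σ s₀ a, v) (clampTime 1)).1 = _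
      rw [hΓder, coe_clampTime (Ioo_subset_Icc_self one_mem_Ioo), one_smul]
    · ext b
      simp
  have hLinj : Function.Injective L := by
    rw [injective_iff_map_eq_zero]
    rintro ⟨a, v⟩ h
    rw [hLapp, Prod.mk_eq_zero] at h
    -- A kernel vector has `v` both tangent and orthogonal to the submanifold, so `v = 0`, and then
    -- `a = 0` as `σ` is an immersion at `s₀`.
    have hv : v = fderiv ℝ σ s₀ (-a) := by
      rw [map_neg]
      exact eq_neg_of_add_eq_zero_right h.1
    have h0 : v = 0 := by
      by_contra hne
      have h1 := hG.pos _ hT v hne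
      have h2 := congrArg (fun l : D →L[ℝ] ℝ => l (-a)) h.2
      simp only [ContinuousLinearMap.comp_apply, _root_.zero_apply] at h2
      rw [← hv] at h2
      exact h1.ne' h2
    have ha : a = 0 := by
      have h1 := h.1
      rw [h0, add_zero] at h1
      exact (injective_iff_map_eq_zero _).1 hinj a h1
    rw [ha, h0]; rfl
  have hfin : Module.finrank ℝ (D × E) = Module.finrank ℝ (E × (D →L[ℝ] ℝ)) := by
    rw [Module.finrank_prod, Module.finrank_prod, ← (LinearMap.toContinuousLinearMap (𝕜 := ℝ)
      (E := D) (F' := ℝ)).finrank_eq, Module.finrank_linearMap_self, add_comm]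
  obtain ⟨e, he, heO, hee, hes⟩ := exists_smooth_localInverse hO hΘ hOs
    (LinearEquiv.ofInjectiveOfFinrankEq L.toLinearMap hLinj hfin).toContinuousLinearEquiv hΘd
  -- the inverse on the points with normal initial velocity
  let ι : E →L[ℝ] E × (D →L[ℝ] ℝ) := ContinuousLinearMap.inl ℝ E (D →L[ℝ] ℝ)
  let W : Set E := ι ⁻¹' e.target
  have hW : IsOpen W := e.open_target.preimage ι.continuous
  let q : E → D × E := fun y => e.symm (ι y)
  have hq : ContDiffOn ℝ ∞ q W := hes.comp ι.contDiff.contDiffOn fun y hy => hy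
  have hqO : ∀ y ∈ W, q y ∈ O := fun y hy => heO (e.map_target hy)
  have hΘq : ∀ y ∈ W, Θ (q y) = ι y := fun y hy => by rw [← hee]; exact e.right_inv hy
  let x : E → E × E := fun y => (σ (q y).1, (q y).2)
  have hxN : ∀ y ∈ W, x y ∈ N := fun y hy => (hqO y hy).2
  have hxd : ContDiffOn ℝ ∞ x W := hx.comp hq hqO
  have hΓx : ContDiffOn ℝ ∞ (fun y => Γ (x y)) W := hΓ.comp hxd hxN
  have hone : ∀ y ∈ W, (Γ (x y) (clampTime 1)).1 = y := fun y hy => congrArg Prod.fst (hΘq y hy)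
  have hzero : ∀ y ∈ W, Γ (x y) (clampTime 0) = x y := fun y hy => hΓ0 _ (hxN y hy)
  have hnormal : ∀ y ∈ W, ∀ a, G (σ (q y).1) (q y).2 (fderiv ℝ σ (q y).1 a) = 0 := fun y hy a =>
    congrArg (fun l : D →L[ℝ] ℝ => l a) (congrArg Prod.snd (hΘq y hy))
  have hcd : ∀ z ∈ N, ∀ t ∈ Ioo (-1 : ℝ) 2, HasDerivAt (fun t => (Γ z (clampTime t)).1)
      (Γ z (clampTime t)).2 t := fun z hz t ht => (hΓd z hz t ht).fst
  have hvd : ∀ z ∈ N, ∀ t ∈ Ioo (-1 : ℝ) 2, HasDerivAt (fun t => (Γ z (clampTime t)).2)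
      (geodesicAcc G (Γ z (clampTime t)).1 (Γ z (clampTime t)).2) t :=
    fun z hz t ht => (hΓd z hz t ht).snd
  let H : E × E → ℝ := fun z => G z.1 z.2 z.2
  have hspeed : ∀ z ∈ N, ∀ t ∈ Ioo (-1 : ℝ) 2, H (Γ z (clampTime t)) = H z := by
    intro z hz t ht
    have := hG.speed_eq (fun t _ => hΓT z hz (clampTime t)) (hcd z hz) (hvd z hz) ht
    simp only [hΓ0 z hz] at this
    exact this
  have hxT : ∀ y ∈ W, (x y).1 ∈ T := fun y hy => hOT _ (hqO y hy)
  have hsq : ContDiffOn ℝ ∞ (fun y => H (x y)) W :=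
    ((hG.contDiffOn.comp hxd.fst hxT).clm_apply hxd.snd).clm_apply hxd.snd
  refine ⟨⟨W, hW, ?_, fun y => H (x y), hsq, fun y => (q y).1, fun y hy => (hqO y hy).1.1,
    fun y t => (Γ (x y) (clampTime t)).1, fun y t => (Γ (x y) (clampTime t)).2, ?_,
    fun y hy t _ => hΓT _ (hxN y hy) _, fun y hy => hcd _ (hxN y hy), fun y hy => hvd _ (hxN y hy),
    ?_, hone, ?_, fun y hy => hspeed _ (hxN y hy), ?_, ?_⟩⟩
  · have : ι (σ s₀) = e (s₀, 0) := by
      rw [hee]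
      refine Prod.ext ?_ ?_
      · show σ s₀ = (Γ (σ s₀, 0) (clampTime 1)).1
        rw [hΓc _ hyN]
      · ext; simp [ι, Θ]
    show ι (σ s₀) ∈ e.target
    rw [this]
    exact e.map_source he
  · have h1 : ContinuousOn (fun z : E × ℝ => (Γ (x z.1), clampTime z.2)) (W ×ˢ univ) :=
      (hΓx.continuousOn.comp continuousOn_fst fun z hz => hz.1).prodMk
        (continuous_projIcc.comp continuous_snd).continuousOn
    have h2 : Continuous fun p : C(TimeInterval, E × E) × TimeInterval => (p.1 p.2).1 := by fun_prop
    exact h2.comp_continuousOn h1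
  · intro y hy
    rw [hzero y hy]
  · intro y hy a
    rw [hzero y hy]
    exact hnormal y hy a
  · intro y hy w
    have hxy := ((hxd.contDiffAt (hW.mem_nhds hy)).differentiableAt (by simp)).hasFDerivAt
    have hΓy := ((hΓ.contDiffAt (hN.mem_nhds (hxN y hy))).differentiableAt (by simp)).hasFDerivAt
    set ξ := fderiv ℝ x y w with hξ
    let J : ℝ → E × E := fun t => fderiv ℝ Γ (x y) ξ (clampTime t)
    obtain ⟨hJ0, hJd⟩ := hΓvar (x y) (hxN y hy) ξ
    obtain ⟨L₀, hL₀, -⟩ := hG.hasFDerivAt_energy (z := x y) (hxT y hy)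
    have hsqd : fderiv ℝ (fun y => H (x y)) y w = L₀ ξ := by
      have h1 : HasFDerivAt (fun y => H (x y)) (L₀.comp (fderiv ℝ x y)) y := hL₀.comp y hxy
      rw [h1.fderiv]; rfl
    -- The squared speed is conserved by the flow, so its variation at time `t` equals the variation
    -- `L₀ ξ` at time `0`: the pairing of velocity and variation field grows linearly in `t`.
    have hB : ∀ t ∈ Ioo (-1 : ℝ) 2, HasDerivAt (fun t => G (Γ (x y) (clampTime t)).1
        (Γ (x y) (clampTime t)).2 (J t).1) (L₀ ξ / 2) t := by
      intro t ht
      have h1 := hG.hasDerivAt_inner_vel (c := fun t => (Γ (x y) (clampTime t)).1)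
        (j := fun t => (J t).1) (j' := fun t => (J t).2)
        (hΓT _ (hxN y hy) (clampTime t))
        (hcd _ (hxN y hy) t ht) (hvd _ (hxN y hy) t ht) (hJd t ht)
      refine h1.congr_deriv ?_
      obtain ⟨L₁, hL₁, hL₁'⟩ := hG.hasFDerivAt_energy (z := Γ (x y) (clampTime t))
        (hΓT _ (hxN y hy) _)
      let evt : C(TimeInterval, E × E) →L[ℝ] E × E := ContinuousMap.evalCLM ℝ (clampTime t)
      have h2 : HasFDerivAt (fun z => H (Γ z (clampTime t))) _ (x y) :=
        HasFDerivAt.comp (x y) (g := H) hL₁ (evt.hasFDerivAt.comp (x y) hΓy)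
      have h3 : HasFDerivAt (fun z => H (Γ z (clampTime t))) L₀ (x y) :=
        hL₀.congr_of_eventuallyEq (by
          filter_upwards [hN.mem_nhds (hxN y hy)] with z hz using hspeed z hz t ht)
      rw [← hL₁', ← h2.unique h3]
      rfl
    have hB' : ∀ t ∈ Ioo (-1 : ℝ) 2, HasDerivAt (fun t => G (Γ (x y) (clampTime t)).1
        (Γ (x y) (clampTime t)).2 (J t).1 - t * (L₀ ξ / 2)) 0 t := fun t ht =>
      ((hB t ht).sub ((hasDerivAt_id t).mul_const (L₀ ξ / 2))).congr_deriv (by simp)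
    have hconst := isOpen_Ioo.is_const_of_deriv_eq_zero (𝕜 := ℝ) isPreconnected_Ioo
      (f := fun t => G (Γ (x y) (clampTime t)).1 (Γ (x y) (clampTime t)).2 (J t).1 - t * (L₀ ξ / 2))
      (s := Ioo (-1 : ℝ) 2)
      (fun t ht => (hB' t ht).differentiableAt.differentiableWithinAt)
      (fun t ht => (hB' t ht).deriv)
      one_mem_Ioo zero_mem_Ioo
    have hq1 : HasFDerivAt (fun y => (q y).1) (fderiv ℝ (fun y => (q y).1) y) y :=
      ((hq.fst.contDiffAt (hW.mem_nhds hy)).differentiableAt (by simp)).hasFDerivAt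
    have hσq : HasFDerivAt σ (fderiv ℝ σ (q y).1) (q y).1 :=
      ((hσ.contDiffAt (hU.mem_nhds (hqO y hy).1.1)).differentiableAt (by simp)).hasFDerivAt
    -- The variation field starts tangent to the submanifold, hence orthogonal to the initial
    -- velocity, and it ends at `w`. Comparing times `0` and `1` gives the Gauss lemma.
    have hξ1 : ξ.1 = fderiv ℝ σ (q y).1 (fderiv ℝ (fun y => (q y).1) y w) := by
      have h1 : HasFDerivAt (fun y => (x y).1) _ y := hxy.fst
      have h2 : HasFDerivAt (fun y => σ (q y).1) _ y := hσq.comp y hq1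
      exact congrArg (fun l : E →L[ℝ] E => l w) (h1.unique h2)
    have hJ1 : (J 1).1 = w := by
      have h1 : HasFDerivAt (fun y => (Γ (x y) (clampTime 1)).1) _ y :=
        HasFDerivAt.comp y (g := fun γ : C(TimeInterval, E × E) => (γ (clampTime 1)).1)
          ((ContinuousLinearMap.fst ℝ E E).comp ev).hasFDerivAt (hΓy.comp y hxy)
      have h2 : HasFDerivAt (fun y => (Γ (x y) (clampTime 1)).1) (ContinuousLinearMap.id ℝ E) y :=
        (hasFDerivAt_id y).congr_of_eventuallyEq (by
          filter_upwards [hW.mem_nhds hy] with z hz using hone z hz)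
      exact congrArg (fun l : E →L[ℝ] E => l w) (h1.unique h2)
    have hJ0' : (J 0).1 = ξ.1 := congrArg Prod.fst hJ0
    have hB0 : G (Γ (x y) (clampTime 0)).1 (Γ (x y) (clampTime 0)).2 (J 0).1 = 0 := by
      rw [hzero y hy, hJ0', hξ1]
      exact hnormal y hy _
    rw [hsqd]
    simp only [hB0, hJ1, hone y hy] at hconst
    linarith
  · have h1 : ∀ᶠ s in 𝓝 s₀, (s, (0 : E)) ∈ e.source :=
      (by fun_prop : Continuous fun s : D => (s, (0 : E))).continuousAt.preimage_mem_nhds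
        (e.open_source.mem_nhds he)
    filter_upwards [h1] with s hs
    have hsN : (σ s, (0 : E)) ∈ N := (heO hs).2
    have h2 : ι (σ s) = e (s, 0) := by
      rw [hee]
      refine Prod.ext ?_ ?_
      · show σ s = (Γ (σ s, 0) (clampTime 1)).1
        rw [hΓc _ hsN]
      · ext; simp [ι, Θ]
    have h3 : q (σ s) = (s, 0) := by
      show e.symm (ι (σ s)) = _
      rw [h2]
      exact e.left_inv hs
    have h4 : x (σ s) = (σ s, 0) := by
      show (σ (q (σ s)).1, (q (σ s)).2) = _
      rw [h3]
    refine ⟨?_, ?_, ?_, fun t => ?_⟩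
    · show ι (σ s) ∈ e.target
      rw [h2]
      exact e.map_source hs
    · rw [h3]
    · show H (x (σ s)) = 0
      rw [h4]
      simp [H]
    · rw [h4, hΓc _ hsN]

end Fermi

set_option linter.unusedSectionVars false

universe u

variable {m : ℕ} {M : Type u} [TopologicalSpace M]
  [ChartedSpace (EuclideanSpace ℝ (Fin m)) M] [IsManifold (𝓡 m) ∞ M]

/-! ### Leaves in charts -/

lemma extChartAt_symm_mem_source {x : M} {y : EuclideanSpace ℝ (Fin m)}
    (hy : y ∈ (extChartAt (𝓡 m) x).target) :
    (extChartAt (𝓡 m) x).symm y ∈ (extChartAt (𝓡 m) x).source :=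
  (extChartAt (𝓡 m) x).map_target hy

lemma mdifferentiableAt_extChartAt_symm {x : M} {y : EuclideanSpace ℝ (Fin m)}
    (hy : y ∈ (extChartAt (𝓡 m) x).target) :
    MDifferentiableAt (𝓡 m) (𝓡 m) (extChartAt (𝓡 m) x).symm y :=
  ((contMDiffOn_extChartAt_symm (n := ∞) x).contMDiffAt
    (extChartAt_target_mem_nhds' hy)).mdifferentiableAt (by simp)

/-- The chart frame is bijective. -/
lemma chartFrame_bijective {x : M} {y : EuclideanSpace ℝ (Fin m)}
    (hy : y ∈ (extChartAt (𝓡 m) x).target) : Function.Bijective (chartFrame x y) := by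
  have hs := extChartAt_symm_mem_source hy
  have h1 := isInvertible_mfderivWithin_extChartAt_symm (I := 𝓡 m) hy
  simp only [modelWithCornersSelf_coe, range_id, mfderivWithin_univ] at h1
  exact h1.bijective

namespace LeafDecomposition

variable (F : LeafDecomposition m M)

lemma exists_incl_eq (p : M) : ∃ i, ∃ l : F.Leaf i, F.incl i l = p := by
  obtain ⟨⟨i, l⟩, h⟩ := F.bijective.2 p
  exact ⟨i, l, h⟩

lemma incl_injective (i : F.Index) : Function.Injective (F.incl i) := by
  intro l l' h
  have := F.bijective.1 (a₁ := ⟨i, l⟩) (a₂ := ⟨i, l'⟩) h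
  exact eq_of_heq (Sigma.mk.inj_iff.1 this).2

lemma index_eq {i j : F.Index} {l : F.Leaf i} {l' : F.Leaf j} (h : F.incl i l = F.incl j l') :
    i = j := (Sigma.mk.inj_iff.1 (F.bijective.1 (a₁ := ⟨i, l⟩) (a₂ := ⟨j, l'⟩) h)).1

lemma contMDiff_incl (i : F.Index) : ContMDiff (𝓡 (F.dim i)) (𝓡 m) ∞ (F.incl i) :=
  (F.isImmersion i).contMDiff

/-- The inclusion of a leaf in the charts around `l₀` and its image. -/
noncomputable def plaqueMap {i : F.Index} (l₀ : F.Leaf i) (s : EuclideanSpace ℝ (Fin (F.dim i))) :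
    EuclideanSpace ℝ (Fin m) :=
  extChartAt (𝓡 m) (F.incl i l₀) (F.incl i ((extChartAt (𝓡 (F.dim i)) l₀).symm s))

/-- A coordinate domain of a leaf on which its inclusion has a smooth left inverse. -/
structure IsPlaqueDomain {i : F.Index} (l₀ : F.Leaf i)
    (U : Set (EuclideanSpace ℝ (Fin (F.dim i)))) (O : Set (EuclideanSpace ℝ (Fin m)))
    (r : EuclideanSpace ℝ (Fin m) → EuclideanSpace ℝ (Fin (F.dim i))) : Prop where
  isOpen : IsOpen U
  isOpen_ambient : IsOpen O
  mem : extChartAt (𝓡 (F.dim i)) l₀ l₀ ∈ U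
  subset : U ⊆ (extChartAt (𝓡 (F.dim i)) l₀).target
  subset_ambient : O ⊆ (extChartAt (𝓡 m) (F.incl i l₀)).target
  mem_source : ∀ s ∈ U, F.incl i ((extChartAt (𝓡 (F.dim i)) l₀).symm s) ∈
    (extChartAt (𝓡 m) (F.incl i l₀)).source
  contDiffOn : ContDiffOn ℝ ∞ (F.plaqueMap l₀) U
  mapsTo : MapsTo (F.plaqueMap l₀) U O
  contDiffOn_retraction : ContDiffOn ℝ ∞ r O
  leftInv : ∀ s ∈ U, r (F.plaqueMap l₀ s) = s

/-- In the charts of the immersion normal form the inclusion is `u ↦ (u, 0)` up to a linear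
equivalence, so projection to the first factor is a smooth left inverse. The sets `U` and `O` are
cut down until each map in this composition is defined. -/
theorem exists_isPlaqueDomain {i : F.Index} (l₀ : F.Leaf i) : ∃ U O r, F.IsPlaqueDomain l₀ U O r := by
  set φ := extChartAt (𝓡 m) (F.incl i l₀) with hφ
  set ψ := extChartAt (𝓡 (F.dim i)) l₀ with hψ
  have h := (F.isImmersion i).isImmersionAt l₀
  have hinc := F.contMDiff_incl i
  let U : Set (EuclideanSpace ℝ (Fin (F.dim i))) :=
    ψ.target ∩ ψ.symm ⁻¹' (h.domChart.source ∩ F.incl i ⁻¹' φ.source)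
  have hU : IsOpen U := (continuousOn_extChartAt_symm l₀).isOpen_inter_preimage
    (isOpen_extChartAt_target l₀) (h.domChart.open_source.inter
      ((isOpen_extChartAt_source _).preimage hinc.continuous))
  let O₁ : Set (EuclideanSpace ℝ (Fin m)) := φ.target ∩ φ.symm ⁻¹' h.codChart.source
  have hO₁ : IsOpen O₁ := (continuousOn_extChartAt_symm _).isOpen_inter_preimage
    (isOpen_extChartAt_target _) h.codChart.open_source
  let f₁ : EuclideanSpace ℝ (Fin m) → EuclideanSpace ℝ (Fin (F.dim i)) :=
    fun y => (h.equiv.symm (h.codChart (φ.symm y))).1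
  have hf₁ : ContMDiffOn (𝓡 m) (𝓡 (F.dim i)) ∞ f₁ O₁ := by
    have h1 : ContMDiffOn (𝓡 m) (𝓡 m) ∞ (fun y => h.codChart (φ.symm y)) O₁ :=
      (contMDiffOn_of_mem_maximalAtlas h.codChart_mem_maximalAtlas).comp
        ((contMDiffOn_extChartAt_symm _).mono inter_subset_left) fun y hy => hy.2
    have h2 : ContDiff ℝ ∞ (fun y => (h.equiv.symm y).1) :=
      contDiff_fst.comp h.equiv.symm.contDiff
    exact h2.contMDiff.comp_contMDiffOn h1
  let O₂ : Set (EuclideanSpace ℝ (Fin m)) := O₁ ∩ f₁ ⁻¹' h.domChart.target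
  have hO₂ : IsOpen O₂ := hf₁.continuousOn.isOpen_inter_preimage hO₁ h.domChart.open_target
  let f₂ : EuclideanSpace ℝ (Fin m) → F.Leaf i := fun y => h.domChart.symm (f₁ y)
  have hf₂ : ContMDiffOn (𝓡 m) (𝓡 (F.dim i)) ∞ f₂ O₂ :=
    (contMDiffOn_symm_of_mem_maximalAtlas h.domChart_mem_maximalAtlas).comp
      (hf₁.mono inter_subset_left) fun y hy => hy.2
  let O : Set (EuclideanSpace ℝ (Fin m)) := O₂ ∩ f₂ ⁻¹' ψ.source
  have hO : IsOpen O := hf₂.continuousOn.isOpen_inter_preimage hO₂ (isOpen_extChartAt_source _)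
  have hr : ContMDiffOn (𝓡 m) (𝓡 (F.dim i)) ∞ (fun y => ψ (f₂ y)) O :=
    (contMDiffOn_extChartAt (x := l₀)).comp (hf₂.mono inter_subset_left) fun y hy => by
      have := hy.2
      rwa [mem_preimage, hψ, extChartAt_source] at this
  have hf₁U : ∀ s ∈ U, f₁ (F.plaqueMap l₀ s) = h.domChart (ψ.symm s) := by
    intro s hs
    have h1 : φ.symm (F.plaqueMap l₀ s) = F.incl i (ψ.symm s) := φ.left_inv hs.2.2
    have h0 : h.domChart (ψ.symm s) ∈ (h.domChart.extend (𝓡 (F.dim i))).target := by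
      simpa using h.domChart.map_source hs.2.1
    have h2 := h.writtenInCharts h0
    simp only [OpenPartialHomeomorph.extend, modelWithCornersSelf_partialEquiv,
      PartialEquiv.trans_refl, Function.comp_apply, OpenPartialHomeomorph.toFun_eq_coe,
      OpenPartialHomeomorph.coe_toPartialEquiv_symm] at h2
    rw [h.domChart.left_inv hs.2.1] at h2
    show (h.equiv.symm (h.codChart (φ.symm (F.plaqueMap l₀ s)))).1 = _
    rw [h1]
    have h3 : h.codChart (F.incl i (ψ.symm s)) = h.equiv (h.domChart (ψ.symm s), 0) := h2
    rw [h3, ContinuousLinearEquiv.symm_apply_apply]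
  have hf₂U : ∀ s ∈ U, f₂ (F.plaqueMap l₀ s) = ψ.symm s := by
    intro s hs
    show h.domChart.symm (f₁ (F.plaqueMap l₀ s)) = _
    rw [hf₁U s hs, h.domChart.left_inv hs.2.1]
  refine ⟨U, O, fun y => ψ (f₂ y), hU, hO, ⟨mem_extChartAt_target l₀, ?_⟩, inter_subset_left,
    fun y hy => hy.1.1.1, fun s hs => hs.2.2, ?_, ?_, contMDiffOn_iff_contDiffOn.1 hr, ?_⟩
  · rw [mem_preimage, hψ, extChartAt_to_inv]
    exact ⟨h.mem_domChart_source, mem_extChartAt_source _⟩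
  · rw [← contMDiffOn_iff_contDiffOn]
    refine (contMDiffOn_extChartAt (x := F.incl i l₀)).comp
      (hinc.comp_contMDiffOn ((contMDiffOn_extChartAt_symm l₀).mono inter_subset_left)) ?_
    intro s hs
    have := hs.2.2
    rwa [mem_preimage, hφ, extChartAt_source] at this
  · intro s hs
    have h1 : φ.symm (F.plaqueMap l₀ s) = F.incl i (ψ.symm s) := φ.left_inv hs.2.2
    refine ⟨⟨⟨φ.map_source hs.2.2, ?_⟩, ?_⟩, ?_⟩
    · rw [mem_preimage, h1]
      exact h.source_subset_preimage_source hs.2.1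
    · rw [mem_preimage, hf₁U s hs]
      exact h.domChart.map_source hs.2.1
    · rw [mem_preimage, hf₂U s hs]
      exact ψ.map_target hs.1
  · intro s hs
    show ψ (f₂ (F.plaqueMap l₀ s)) = s
    rw [hf₂U s hs]
    exact ψ.right_inv hs.1

variable {F}

namespace IsPlaqueDomain

variable {i : F.Index} {l₀ : F.Leaf i} {U : Set (EuclideanSpace ℝ (Fin (F.dim i)))}
  {O : Set (EuclideanSpace ℝ (Fin m))}
  {r : EuclideanSpace ℝ (Fin m) → EuclideanSpace ℝ (Fin (F.dim i))}
  (hP : F.IsPlaqueDomain l₀ U O r)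
include hP

lemma symm_plaqueMap {s : EuclideanSpace ℝ (Fin (F.dim i))} (hs : s ∈ U) :
    (extChartAt (𝓡 m) (F.incl i l₀)).symm (F.plaqueMap l₀ s) =
      F.incl i ((extChartAt (𝓡 (F.dim i)) l₀).symm s) :=
  (extChartAt (𝓡 m) (F.incl i l₀)).left_inv (hP.mem_source s hs)

lemma hasFDerivAt {s : EuclideanSpace ℝ (Fin (F.dim i))} (hs : s ∈ U) :
    HasFDerivAt (F.plaqueMap l₀) (fderiv ℝ (F.plaqueMap l₀) s) s :=
  ((hP.contDiffOn.contDiffAt (hP.isOpen.mem_nhds hs)).differentiableAt (by simp)).hasFDerivAt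

lemma retraction_fderiv {s : EuclideanSpace ℝ (Fin (F.dim i))} (hs : s ∈ U)
    (a : EuclideanSpace ℝ (Fin (F.dim i))) :
    fderiv ℝ r (F.plaqueMap l₀ s) (fderiv ℝ (F.plaqueMap l₀) s a) = a := by
  have h1 : HasFDerivAt r (fderiv ℝ r (F.plaqueMap l₀ s)) (F.plaqueMap l₀ s) :=
    ((hP.contDiffOn_retraction.contDiffAt (hP.isOpen_ambient.mem_nhds
      (hP.mapsTo hs))).differentiableAt (by simp)).hasFDerivAt
  have h2 := (h1.comp s (hP.hasFDerivAt hs))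
  have h3 : HasFDerivAt (r ∘ F.plaqueMap l₀) (ContinuousLinearMap.id ℝ _) s :=
    (hasFDerivAt_id s).congr_of_eventuallyEq (by
      filter_upwards [hP.isOpen.mem_nhds hs] with z hz using hP.leftInv z hz)
  exact congrArg (fun l : EuclideanSpace ℝ (Fin (F.dim i)) →L[ℝ] _ => l a) (h2.unique h3)

lemma fderiv_injective {s : EuclideanSpace ℝ (Fin (F.dim i))} (hs : s ∈ U) :
    Function.Injective (fderiv ℝ (F.plaqueMap l₀) s) :=
  Function.LeftInverse.injective (hP.retraction_fderiv hs)

/-- The tangent space of a leaf in a chart. -/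
lemma chartFrame_mem_leafTangent_iff {s : EuclideanSpace ℝ (Fin (F.dim i))} (hs : s ∈ U)
    (w : EuclideanSpace ℝ (Fin m)) :
    chartFrame (F.incl i l₀) (F.plaqueMap l₀ s) w ∈
        F.leafTangent ((extChartAt (𝓡 m) (F.incl i l₀)).symm (F.plaqueMap l₀ s)) ↔
      ∃ a, fderiv ℝ (F.plaqueMap l₀) s a = w := by
  set φ := extChartAt (𝓡 m) (F.incl i l₀) with hφ
  set ψ := extChartAt (𝓡 (F.dim i)) l₀ with hψ
  have hyT : F.plaqueMap l₀ s ∈ φ.target := hP.subset_ambient (hP.mapsTo hs)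
  have hψd := mdifferentiableAt_extChartAt_symm (hP.subset hs)
  have hev : φ.symm ∘ F.plaqueMap l₀ =ᶠ[𝓝 s] F.incl i ∘ ψ.symm := by
    filter_upwards [hP.isOpen.mem_nhds hs] with z hz using hP.symm_plaqueMap hz
  have hσd : MDifferentiableAt (𝓡 (F.dim i)) (𝓡 m) (F.plaqueMap l₀) s :=
    (hP.hasFDerivAt hs).differentiableAt.mdifferentiableAt
  have key : ∀ a : EuclideanSpace ℝ (Fin (F.dim i)),
      tangentMap (𝓡 (F.dim i)) (𝓡 m) (F.incl i) (tangentMap (𝓡 (F.dim i)) (𝓡 (F.dim i)) ψ.symm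
        (⟨s, a⟩ : TangentBundle (𝓡 (F.dim i)) (EuclideanSpace ℝ (Fin (F.dim i))))) =
      ⟨φ.symm (F.plaqueMap l₀ s), chartFrame (F.incl i l₀) (F.plaqueMap l₀ s)
        (fderiv ℝ (F.plaqueMap l₀) s a)⟩ := by
    intro a
    have h1 := tangentMap_comp_at (I := 𝓡 (F.dim i)) (I' := 𝓡 (F.dim i)) (I'' := 𝓡 m)
      (f := ψ.symm) (g := F.incl i)
      (⟨s, a⟩ : TangentBundle (𝓡 (F.dim i)) (EuclideanSpace ℝ (Fin (F.dim i))))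
      ((F.contMDiff_incl i).mdifferentiable (by simp) _) hψd
    have h2 := tangentMap_comp_at (I := 𝓡 (F.dim i)) (I' := 𝓡 m) (I'' := 𝓡 m)
      (f := F.plaqueMap l₀) (g := φ.symm)
      (⟨s, a⟩ : TangentBundle (𝓡 (F.dim i)) (EuclideanSpace ℝ (Fin (F.dim i))))
      (mdifferentiableAt_extChartAt_symm hyT) hσd
    rw [← h1]
    have h3 : tangentMap (𝓡 (F.dim i)) (𝓡 m) (F.incl i ∘ ψ.symm)
        (⟨s, a⟩ : TangentBundle (𝓡 (F.dim i)) (EuclideanSpace ℝ (Fin (F.dim i)))) =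
        tangentMap (𝓡 (F.dim i)) (𝓡 m) (φ.symm ∘ F.plaqueMap l₀) ⟨s, a⟩ := by
      refine Bundle.TotalSpace.ext hev.symm.eq_of_nhds ?_
      have h4 := congrArg (fun L : EuclideanSpace ℝ (Fin (F.dim i)) →L[ℝ]
        EuclideanSpace ℝ (Fin m) => L a)
        (hev.symm.mfderiv_eq (I := 𝓡 (F.dim i)) (I' := 𝓡 m))
      exact heq_of_eq h4
    rw [h3, h2]
    simp only [tangentMap, mfderiv_eq_fderiv]
    rfl
  constructor
  · rintro ⟨j, ⟨l, ξ⟩, hξ⟩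
    -- The tangent vector could come from any leaf; since each point of `M` is hit exactly once, it
    -- comes from the leaf `i` at the point with coordinate `s`.
    have hp : F.incl j l = F.incl i (ψ.symm s) := by
      rw [← hP.symm_plaqueMap hs]
      exact congrArg Bundle.TotalSpace.proj hξ
    obtain rfl := F.index_eq hp
    obtain rfl := F.incl_injective j hp
    obtain ⟨a, rfl⟩ := (chartFrame_bijective (hP.subset hs)).2 ξ
    refine ⟨a, ?_⟩
    have h5 := (key a).symm.trans hξ
    exact (chartFrame_bijective hyT).1 (eq_of_heq (Bundle.TotalSpace.ext_iff.1 h5).2)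
  · rintro ⟨a, rfl⟩
    exact ⟨i, _, key a⟩

end IsPlaqueDomain

end LeafDecomposition

/-! ### Flows of locally defined vector fields -/

section LocalFlow

variable {B : Type*} [NormedAddCommGroup B] [NormedSpace ℝ B] [FiniteDimensional ℝ B]

/-- The field is replaced by a global one that agrees with it near `x₀`, and initial values are
restricted to those whose flow lines remain, during the compact time interval, where the two agree.
-/
theorem exists_localFlow {V : B → B} {T : Set B} (hT : IsOpen T) (hV : ContDiffOn ℝ ∞ V T) {x₀ : B}
    (hx₀ : x₀ ∈ T) (h₀ : V x₀ = 0) {A : B →L[ℝ] B} (hA : HasFDerivAt V A x₀)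
    (hAA : A.comp A = 0) :
    ∃ (R N : Set B) (Γ : B → C(TimeInterval, B)), IsOpen R ∧ x₀ ∈ R ∧ R ⊆ T ∧ IsOpen N ∧ x₀ ∈ N ∧
      ContDiffOn ℝ ∞ Γ N ∧ Γ x₀ = ContinuousMap.const _ x₀ ∧
      (∀ x ∈ N, Γ x (clampTime 0) = x ∧ (∀ t, Γ x t ∈ R) ∧ ∀ t ∈ Ioo (-1 : ℝ) 2,
        HasDerivAt (fun t => Γ x (clampTime t)) (V (Γ x (clampTime t))) t) ∧
      (∀ ξ t, fderiv ℝ Γ x₀ ξ t = ξ + (t : ℝ) • A ξ) := by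
  have : CompleteSpace B := FiniteDimensional.complete ℝ B
  obtain ⟨V₀, hV₀, hVeq⟩ := exists_contDiff_eventuallyEq hT hV hx₀
  let V' : C(B, B) := ⟨V₀, hV₀.continuous⟩
  have hV0 : V' x₀ = 0 := hVeq.eq_of_nhds.trans h₀
  have hV' : fderiv ℝ V' x₀ = A := (hA.congr_of_eventuallyEq hVeq).fderiv
  obtain ⟨_, N, Γ, -, -, hN, hxN, hΓ, hΓ₀, hflow, -, hder, -⟩ :=
    exists_smooth_flow V' hV₀ x₀ hV0 (by rw [hV', hAA])
  obtain ⟨R, hRsub, hR, hxR⟩ := mem_nhds_iff.1 (Filter.inter_mem hVeq (hT.mem_nhds hx₀))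
  have hVR : ∀ z ∈ R, V' z = V z := fun z hz => (hRsub hz).1
  let N' := N ∩ Γ ⁻¹' {γ | MapsTo γ univ R}
  refine ⟨R, N', Γ, hR, hxR, fun z hz => (hRsub hz).2,
    hΓ.continuousOn.isOpen_inter_preimage hN (ContinuousMap.isOpen_setOfPred_mapsTo isCompact_univ hR),
    ⟨hxN, ?_⟩, hΓ.mono inter_subset_left, hΓ₀, ?_, ?_⟩
  · show MapsTo (Γ x₀) univ R
    rw [hΓ₀]
    exact fun t _ => hxR
  · intro x hx
    refine ⟨(hflow x hx.1).2.zero, fun t => hx.2 (mem_univ t), fun t ht => ?_⟩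
    rw [← hVR _ (hx.2 (mem_univ _))]
    exact (hflow x hx.1).2.hasDerivAt ht
  · intro ξ t
    rw [hder, hV']

/-- The flows of a finite-dimensional family of vector fields, for small parameters. -/
theorem exists_parametricFlow {D : Type*} [NormedAddCommGroup D] [NormedSpace ℝ D]
    [FiniteDimensional ℝ D] {Ξ : B → D →L[ℝ] B} {T : Set B} (hT : IsOpen T)
    (hΞ : ContDiffOn ℝ ∞ Ξ T) {x₀ : B} (hx₀ : x₀ ∈ T) :
    ∃ (R N : Set (B × D)) (Γ : B × D → C(TimeInterval, B × D)), IsOpen R ∧ (x₀, 0) ∈ R ∧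
      R ⊆ T ×ˢ univ ∧ IsOpen N ∧ (x₀, 0) ∈ N ∧
      ContDiffOn ℝ ∞ Γ N ∧ Γ (x₀, 0) = ContinuousMap.const _ (x₀, 0) ∧
      (∀ x ∈ N, Γ x (clampTime 0) = x ∧ (∀ t, Γ x t ∈ R) ∧ ∀ t ∈ Ioo (-1 : ℝ) 2,
        (Γ x (clampTime t)).2 = x.2 ∧ HasDerivAt (fun t => (Γ x (clampTime t)).1)
          (Ξ (Γ x (clampTime t)).1 x.2) t) ∧
      (∀ a t, (fderiv ℝ Γ (x₀, 0) (0, a) t).1 = (t : ℝ) • Ξ x₀ a) := by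
  have hT' : IsOpen (T ×ˢ (univ : Set D)) := hT.prod isOpen_univ
  have hΞ1 : ContDiffOn ℝ ∞ (fun z : B × D => Ξ z.1) (T ×ˢ univ) :=
    hΞ.comp contDiffOn_fst fun z hz => hz.1
  have hV : ContDiffOn ℝ ∞ (fun z : B × D => (Ξ z.1 z.2, (0 : D))) (T ×ˢ univ) :=
    (hΞ1.clm_apply contDiffOn_snd).prodMk contDiffOn_const
  have hx : (x₀, (0 : D)) ∈ T ×ˢ (univ : Set D) := ⟨hx₀, mem_univ _⟩
  have hd := ((hΞ1.contDiffAt (hT'.mem_nhds hx)).differentiableAt (by simp)).hasFDerivAt.clm_apply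
    (hasFDerivAt_snd (𝕜 := ℝ) (p := (x₀, (0 : D))))
  -- The parameter is treated as a frozen state variable. At parameter zero every point is
  -- stationary, and the linearization `(ξ, a) ↦ (Ξ x₀ a, 0)` squares to zero.
  have hA : HasFDerivAt (fun z : B × D => (Ξ z.1 z.2, (0 : D)))
      (((Ξ x₀).comp (ContinuousLinearMap.snd ℝ B D)).prod (0 : B × D →L[ℝ] D)) (x₀, (0 : D)) := by
    refine (hd.prodMk (hasFDerivAt_const (0 : D) _)).congr_fderiv ?_
    ext <;> simp
  obtain ⟨R, N, Γ, hR, hxR, hRT, hN, hxN, hΓ, hΓ₀, hflow, hder⟩ :=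
    exists_localFlow hT' hV hx (by simp) hA (by ext <;> simp)
  refine ⟨R, N, Γ, hR, hxR, hRT, hN, hxN, hΓ, hΓ₀, ?_, ?_⟩
  · intro x hx
    obtain ⟨h0, hmem, hder⟩ := hflow x hx
    have hsnd : ∀ t ∈ Ioo (-1 : ℝ) 2, HasDerivAt (fun t => (Γ x (clampTime t)).2) 0 t :=
      fun t ht => (ContinuousLinearMap.snd ℝ B D).hasFDerivAt.comp_hasDerivAt t (hder t ht)
    have hfst : ∀ t ∈ Ioo (-1 : ℝ) 2, HasDerivAt (fun t => (Γ x (clampTime t)).1)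
        (Ξ (Γ x (clampTime t)).1 (Γ x (clampTime t)).2) t :=
      fun t ht => (ContinuousLinearMap.fst ℝ B D).hasFDerivAt.comp_hasDerivAt t (hder t ht)
    have h2 : ∀ t ∈ Ioo (-1 : ℝ) 2, (Γ x (clampTime t)).2 = x.2 := by
      intro t ht
      have h3 := isOpen_Ioo.is_const_of_deriv_eq_zero (𝕜 := ℝ) isPreconnected_Ioo
        (f := fun t => (Γ x (clampTime t)).2) (s := Ioo (-1 : ℝ) 2)
        (fun t ht => (hsnd t ht).differentiableAt.differentiableWithinAt)
        (fun t ht => (hsnd t ht).deriv) ht zero_mem_Ioo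
      rw [h3, h0]
    refine ⟨h0, hmem, fun t ht => ⟨h2 t ht, ?_⟩⟩
    rw [← h2 t ht]
    exact hfst t ht
  · intro a t
    rw [hder]
    simp

end LocalFlow

/-! ### Vector fields in charts -/

lemma hasMFDerivAt_extChartAt_symm_comp {x : M} {c : ℝ → EuclideanSpace ℝ (Fin m)}
    {v : EuclideanSpace ℝ (Fin m)} {t : ℝ} (ht : c t ∈ (extChartAt (𝓡 m) x).target)
    (hc : HasDerivAt c v t) :
    HasMFDerivAt 𝓘(ℝ, ℝ) (𝓡 m) (fun t => (extChartAt (𝓡 m) x).symm (c t)) t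
      ((1 : ℝ →L[ℝ] ℝ).smulRight (chartFrame x (c t) v)) := by
  have h1 := (mdifferentiableAt_extChartAt_symm ht).hasMFDerivAt
  have h2 : HasMFDerivAt 𝓘(ℝ, ℝ) (𝓡 m) c t _ := hc.hasFDerivAt.hasMFDerivAt
  have h3 := h1.comp t h2
  refine h3.congr_mfderiv ?_
  refine ContinuousLinearMap.ext fun (z : ℝ) => ?_
  exact map_smul (chartFrame x (c t)) z v

lemma velocity_extChartAt_symm_comp {x : M} {c : ℝ → EuclideanSpace ℝ (Fin m)}
    {v : EuclideanSpace ℝ (Fin m)} {t : ℝ} (ht : c t ∈ (extChartAt (𝓡 m) x).target)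
    (hc : HasDerivAt c v t) :
    velocity (fun t => (extChartAt (𝓡 m) x).symm (c t)) t = chartFrame x (c t) v := by
  rw [velocity, (hasMFDerivAt_extChartAt_symm_comp ht hc).mfderiv]
  exact one_smul ℝ (chartFrame x (c t) v)

/-- The representation of a vector field in the chart around `x`. -/
noncomputable def chartField (x : M) (X : ∀ p : M, TangentSpace (𝓡 m) p)
    (y : EuclideanSpace ℝ (Fin m)) : EuclideanSpace ℝ (Fin m) :=
  (trivializationAt (EuclideanSpace ℝ (Fin m)) (TangentSpace (𝓡 m)) x
    ⟨(extChartAt (𝓡 m) x).symm y, X ((extChartAt (𝓡 m) x).symm y)⟩).2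

lemma chartFrame_chartField {x : M} (X : ∀ p : M, TangentSpace (𝓡 m) p)
    {y : EuclideanSpace ℝ (Fin m)} (hy : y ∈ (extChartAt (𝓡 m) x).target) :
    chartFrame x y (chartField x X y) = X ((extChartAt (𝓡 m) x).symm y) := by
  have h1 := symm_eq_mfderiv x hy (chartField x X y)
  have hp : (extChartAt (𝓡 m) x).symm y ∈ (trivializationAt (EuclideanSpace ℝ (Fin m))
      (TangentSpace (𝓡 m)) x).baseSet := by
    simpa using extChartAt_symm_mem_source hy
  refine h1.symm.trans ?_
  exact Trivialization.symm_apply_apply_mk _ hp (X ((extChartAt (𝓡 m) x).symm y))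

lemma contDiffOn_chartField {x : M} {X : ∀ p : M, TangentSpace (𝓡 m) p}
    (hX : ContMDiff (𝓡 m) (𝓡 m).tangent ∞ (fun p => (⟨p, X p⟩ : TangentBundle (𝓡 m) M))) :
    ContDiffOn ℝ ∞ (chartField x X) (extChartAt (𝓡 m) x).target := by
  rw [← contMDiffOn_iff_contDiffOn]
  have h1 := ((trivializationAt (EuclideanSpace ℝ (Fin m)) (TangentSpace (𝓡 m))
    x).contMDiffOn_section_baseSet_iff (IB := 𝓡 m) (n := ∞) (s := X)).1 hX.contMDiffOn
  refine h1.comp (contMDiffOn_extChartAt_symm x) fun y hy => ?_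
  simpa using extChartAt_symm_mem_source hy

lemma isMIntegralCurveAt_extChartAt_symm_comp {x : M} {X : ∀ p : M, TangentSpace (𝓡 m) p}
    {c : ℝ → EuclideanSpace ℝ (Fin m)} {t : ℝ}
    (h : ∀ᶠ t in 𝓝 t, c t ∈ (extChartAt (𝓡 m) x).target ∧ HasDerivAt c (chartField x X (c t)) t) :
    IsMIntegralCurveAt (fun t => (extChartAt (𝓡 m) x).symm (c t)) X t := by
  filter_upwards [h] with s hs
  have := hasMFDerivAt_extChartAt_symm_comp hs.1 hs.2
  rwa [chartFrame_chartField X hs.1] at this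

/-! ### Integral curves of tangent fields stay in leaves -/

namespace LeafDecomposition

variable {F : LeafDecomposition m M}

lemma IsPlaqueDomain.fderiv_retraction_chartField {i : F.Index} {l₀ : F.Leaf i}
    {U : Set (EuclideanSpace ℝ (Fin (F.dim i)))} {O : Set (EuclideanSpace ℝ (Fin m))}
    {r : EuclideanSpace ℝ (Fin m) → EuclideanSpace ℝ (Fin (F.dim i))}
    (hP : F.IsPlaqueDomain l₀ U O r) {w : EuclideanSpace ℝ (Fin m)}
    {s : EuclideanSpace ℝ (Fin (F.dim i))} (hs : s ∈ U)
    (hX : chartFrame (F.incl i l₀) (F.plaqueMap l₀ s) w ∈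
        F.leafTangent ((extChartAt (𝓡 m) (F.incl i l₀)).symm (F.plaqueMap l₀ s))) :
    fderiv ℝ (F.plaqueMap l₀) s (fderiv ℝ r (F.plaqueMap l₀ s) w) = w := by
  obtain ⟨a, rfl⟩ := (hP.chartFrame_mem_leafTangent_iff hs _).1 hX
  rw [hP.retraction_fderiv hs]

/-- Integral curves of vector fields that are tangent to the leaves stay in a leaf. -/
theorem mem_leafSet_of_isMIntegralCurveAt {X : ∀ p : M, TangentSpace (𝓡 m) p}
    (hX : X ∈ F.tangentFields) {γ : ℝ → M} {J : Set ℝ} (hJ : IsPreconnected J)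
    (hγ : ∀ t ∈ J, IsMIntegralCurveAt γ X t) {t t' : ℝ} (ht : t ∈ J) (ht' : t' ∈ J)
    {i : F.Index} (hi : γ t ∈ F.leafSet i) : γ t' ∈ F.leafSet i := by
  have hloc : ∀ t ∈ J, ∀ i, γ t ∈ F.leafSet i → ∀ᶠ τ in 𝓝 t, γ τ ∈ F.leafSet i := by
    rintro t ht i ⟨l₀, hl₀⟩
    obtain ⟨U, O, r, hP⟩ := F.exists_isPlaqueDomain l₀
    -- `X` is tangent to the plaque, so it restricts to a field `Y` in plaque coordinates. An
    -- integral curve of `Y` maps to one of `X` inside the leaf, and by uniqueness `γ` coincides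
    -- with it near `t`.
    let Y : EuclideanSpace ℝ (Fin (F.dim i)) → EuclideanSpace ℝ (Fin (F.dim i)) := fun s =>
      fderiv ℝ r (F.plaqueMap l₀ s) (chartField (F.incl i l₀) X (F.plaqueMap l₀ s))
    have hY : ContDiffOn ℝ ∞ Y U :=
      ((hP.contDiffOn_retraction.fderiv_of_isOpen hP.isOpen_ambient (m := ∞) (by simp)).comp
        hP.contDiffOn hP.mapsTo).clm_apply
        ((contDiffOn_chartField hX.1).comp hP.contDiffOn fun s hs =>
          hP.subset_ambient (hP.mapsTo hs))
    have hY1 : ContDiffAt ℝ 1 Y (extChartAt (𝓡 (F.dim i)) l₀ l₀) :=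
      (hY.contDiffAt (hP.isOpen.mem_nhds hP.mem)).of_le (by simp)
    obtain ⟨α, hα₀, ε, hε, hα⟩ :=
      hY1.exists_forall_mem_closedBall_exists_eq_forall_mem_Ioo_hasDerivAt₀ t
    have hαt := hα t ⟨by linarith, by linarith⟩
    have hαU : ∀ᶠ τ in 𝓝 t, α τ ∈ U :=
      hαt.continuousAt.preimage_mem_nhds (hP.isOpen.mem_nhds (by rw [hα₀]; exact hP.mem))
    have hβ : IsMIntegralCurveAt (fun τ => (extChartAt (𝓡 m) (F.incl i l₀)).symm
        (F.plaqueMap l₀ (α τ))) X t := by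
      refine isMIntegralCurveAt_extChartAt_symm_comp (c := fun τ => F.plaqueMap l₀ (α τ)) ?_
      filter_upwards [hαU, Ioo_mem_nhds (show t - ε < t by linarith) (show t < t + ε by linarith)]
        with τ hτ hτ'
      have hT := hP.subset_ambient (hP.mapsTo hτ)
      refine ⟨hT, ?_⟩
      have h1 := (hP.hasFDerivAt hτ).comp_hasDerivAt τ (hα τ hτ')
      refine h1.congr_deriv (hP.fderiv_retraction_chartField hτ ?_)
      rw [chartFrame_chartField X hT]
      exact hX.2 _
    have h0 : γ t = (extChartAt (𝓡 m) (F.incl i l₀)).symm (F.plaqueMap l₀ (α t)) := by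
      rw [hP.symm_plaqueMap hαU.self_of_nhds, hα₀, extChartAt_to_inv, hl₀]
    have heq := isMIntegralCurveAt_eventuallyEq_of_contMDiffAt_boundaryless (I := 𝓡 m)
      ((hX.1 (γ t)).of_le (by simp)) (hγ t ht) hβ h0
    filter_upwards [heq, hαU] with τ h1 h2
    rw [h1, hP.symm_plaqueMap h2]
    exact mem_range_self _
  -- Every time has a neighbourhood during which `γ` keeps to one leaf. The times spent in leaf `i`
  -- and those spent outside it thus form disjoint open sets covering the connected set `J`.
  by_contra hcon
  have hsub := hJ.subset_left_of_subset_union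
    (isOpen_setOfPred_eventually_nhds (p := fun τ => γ τ ∈ F.leafSet i))
    (isOpen_setOfPred_eventually_nhds (p := fun τ => γ τ ∉ F.leafSet i))
    (Set.disjoint_left.2 fun τ h1 h2 => h2.self_of_nhds h1.self_of_nhds) ?_ ⟨t, ht, hloc t ht i hi⟩
  · exact hcon (hsub ht').self_of_nhds
  · intro τ hτ
    by_cases h : γ τ ∈ F.leafSet i
    · exact Or.inl (hloc τ hτ i h)
    · obtain ⟨j, l, hl⟩ := F.exists_incl_eq (γ τ)
      refine Or.inr ?_
      filter_upwards [hloc τ hτ j ⟨l, hl⟩] with s hs hs'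
      obtain ⟨l₁, h₁⟩ := hs
      obtain ⟨l₂, h₂⟩ := hs'
      obtain rfl := F.index_eq (h₁.trans h₂.symm)
      exact h ⟨l, hl⟩

end LeafDecomposition

lemma chartField_sum_smul {ι : Type*} [Fintype ι] {x : M} (X : ι → ∀ p : M, TangentSpace (𝓡 m) p)
    (c : ι → ℝ) {y : EuclideanSpace ℝ (Fin m)} (hy : y ∈ (extChartAt (𝓡 m) x).target) :
    chartField x (∑ j, c j • X j) y = ∑ j, c j • chartField x (X j) y := by
  refine (chartFrame_bijective hy).1 ?_
  rw [chartFrame_chartField _ hy, map_sum, Finset.sum_apply]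
  refine Finset.sum_congr rfl fun j _ => ?_
  rw [map_smul, chartFrame_chartField _ hy]
  rfl

/-! ### Leaf-preserving flows of tangent vector fields -/

namespace SingularRiemannianFoliation

variable {g : SmoothMetric m M} (F : SingularRiemannianFoliation g)

/-- The module of the smooth vector fields tangent to the leaves. -/
def tangentModule : Submodule ℝ (∀ p : M, TangentSpace (𝓡 m) p) where
  carrier := F.tangentFields
  add_mem' {X Y} hX hY := by
    refine ⟨ContMDiff.add_section hX.1 hY.1, fun p => ?_⟩
    have h1 := hX.2 p
    have h2 := hY.2 p
    rw [F.smooth] at h1 h2 ⊢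
    exact Submodule.add_mem _ h1 h2
  zero_mem' := by
    refine ⟨Bundle.contMDiff_zeroSection ℝ _, fun p => ?_⟩
    rw [F.smooth]
    exact Submodule.zero_mem _
  smul_mem' c X hX := by
    refine ⟨ContMDiff.const_smul_section hX.1, fun p => ?_⟩
    have h1 := hX.2 p
    rw [F.smooth] at h1 ⊢
    exact Submodule.smul_mem _ c h1

/-- Every vector tangent to a leaf extends to a vector field tangent to the leaves. -/
lemma exists_tangentField {p : M} {v : TangentSpace (𝓡 m) p} (hv : v ∈ F.leafTangent p) :
    ∃ X ∈ F.tangentModule, X p = v := by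
  rw [F.smooth] at hv
  have h : Submodule.span ℝ {v | ∃ X ∈ F.tangentFields, X p = v} ≤
      F.tangentModule.map (LinearMap.proj p) := by
    refine Submodule.span_le.2 ?_
    rintro _ ⟨X, hX, rfl⟩
    exact ⟨X, hX, rfl⟩
  obtain ⟨X, hX, rfl⟩ := h hv
  exact ⟨X, hX, rfl⟩

set_option maxHeartbeats 2000000 in
/-- Near every point of a leaf, the points of the leaf are exchanged by flows that preserve the
leaves. -/
theorem eventually_exists_leafFlow [T2Space M] {i : F.Index} (l₀ : F.Leaf i) :
    ∀ᶠ l' in 𝓝 l₀, ∃ (h : M → M) (k : F.Leaf i → F.Leaf i), h (F.incl i l₀) = F.incl i l' ∧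
      ContinuousAt h (F.incl i l₀) ∧
      (∀ᶠ x in 𝓝 (F.incl i l₀), x ∈ F.leafSet i → h x ∈ F.leafSet i) ∧
      k l' = l₀ ∧ ContinuousAt k l' ∧
      ∀ᶠ z in 𝓝 (F.incl i l₀) ×ˢ 𝓝 l', h z.1 = F.incl i z.2 → z.1 = F.incl i (k z.2) := by
  obtain ⟨U, O, r, hP⟩ := F.exists_isPlaqueDomain l₀
  set φ := extChartAt (𝓡 m) (F.incl i l₀) with hφ
  set ψ := extChartAt (𝓡 (F.dim i)) l₀ with hψ
  set σ := F.plaqueMap l₀ with hσ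
  set s₀ := ψ l₀ with hs₀
  have hφs : φ.symm (σ s₀) = F.incl i l₀ := by
    rw [hP.symm_plaqueMap hP.mem]
    exact congrArg _ (extChartAt_to_inv l₀)
  have hφ0 : φ (F.incl i l₀) = σ s₀ := by
    exact congrArg (fun l => φ (F.incl i l)) (extChartAt_to_inv l₀).symm
  -- tangent vector fields that span the tangent space of the leaf
  let b := EuclideanSpace.basisFun (Fin (F.dim i)) ℝ
  have hX : ∀ j, ∃ X ∈ F.tangentModule, X (φ.symm (σ s₀)) =
      chartFrame (F.incl i l₀) (σ s₀) (fderiv ℝ σ s₀ (b j)) := fun j =>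
    F.exists_tangentField ((hP.chartFrame_mem_leafTangent_iff hP.mem _).2 ⟨b j, rfl⟩)
  choose X hXm hXs using hX
  have hXa : ∀ a : EuclideanSpace ℝ (Fin (F.dim i)), (∑ j, a j • X j) ∈ F.tangentModule :=
    fun a => Submodule.sum_mem _ fun j _ => Submodule.smul_mem _ _ (hXm j)
  let Ξ : EuclideanSpace ℝ (Fin m) → EuclideanSpace ℝ (Fin (F.dim i)) →L[ℝ]
      EuclideanSpace ℝ (Fin m) := fun y =>
    ∑ j, (EuclideanSpace.proj j : EuclideanSpace ℝ (Fin (F.dim i)) →L[ℝ] ℝ).smulRight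
      (chartField (F.incl i l₀) (X j) y)
  have hΞa : ∀ y ∈ φ.target, ∀ a, Ξ y a = chartField (F.incl i l₀) (∑ j, a j • X j) y := by
    intro y hy a
    rw [chartField_sum_smul X (fun j => a j) hy]
    simp [Ξ]
  have hΞO : ContDiffOn ℝ ∞ Ξ O := by
    refine ContDiffOn.sum fun j _ => ?_
    exact (contDiffOn_const (c := (ContinuousLinearMap.smulRightL ℝ _ _
      (EuclideanSpace.proj j : EuclideanSpace ℝ (Fin (F.dim i)) →L[ℝ] ℝ)))).clm_apply
        ((contDiffOn_chartField (hXm j).1).mono hP.subset_ambient)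
  -- The same family of fields in plaque coordinates: `dσ` carries `Y` to `Ξ`, and the choice of the
  -- `X j` makes `Y s₀` the identity.
  let Y : EuclideanSpace ℝ (Fin (F.dim i)) → EuclideanSpace ℝ (Fin (F.dim i)) →L[ℝ]
      EuclideanSpace ℝ (Fin (F.dim i)) := fun s => (fderiv ℝ r (σ s)).comp (Ξ (σ s))
  have hYU : ContDiffOn ℝ ∞ Y U :=
    ((hP.contDiffOn_retraction.fderiv_of_isOpen hP.isOpen_ambient (m := ∞) (by simp)).comp
      hP.contDiffOn hP.mapsTo).clm_comp (hΞO.comp hP.contDiffOn hP.mapsTo)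
  have hσY : ∀ s ∈ U, ∀ a, fderiv ℝ σ s (Y s a) = Ξ (σ s) a := by
    intro s hs a
    have hT := hP.subset_ambient (hP.mapsTo hs)
    refine hP.fderiv_retraction_chartField (w := Ξ (σ s) a) hs ?_
    rw [show Ξ (F.plaqueMap l₀ s) a = _ from hΞa _ hT a, chartFrame_chartField _ hT]
    exact (hXa a).2 _
  have hY₀ : ∀ a, Y s₀ a = a := by
    intro a
    have hT := hP.subset_ambient (hP.mapsTo hP.mem)
    have h1 : Ξ (σ s₀) a = fderiv ℝ σ s₀ a := by
      refine (chartFrame_bijective hT).1 ?_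
      rw [hΞa _ hT, chartFrame_chartField _ hT, Finset.sum_apply]
      conv_rhs => rw [← b.sum_repr a]
      rw [map_sum, map_sum]
      refine Finset.sum_congr rfl fun j _ => ?_
      rw [map_smul, map_smul, ← hXs]
      rfl
    show fderiv ℝ r (σ s₀) (Ξ (σ s₀) a) = a
    rw [h1]
    exact hP.retraction_fderiv hP.mem a
  obtain ⟨R, N, Γ, -, -, hRT, hN, hxN, hΓ, -, hflow, -⟩ :=
    exists_parametricFlow hP.isOpen_ambient hΞO (hP.mapsTo hP.mem)
  obtain ⟨R', N', Γ', -, -, hRT', hN', hxN', hΓ', hΓ₀', hflow', hder'⟩ :=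
    exists_parametricFlow hP.isOpen hYU hP.mem
  -- integral curves of the vector fields
  have hcurve : ∀ z ∈ N, ∀ t ∈ Ioo (-1 : ℝ) 2, IsMIntegralCurveAt
      (fun t => φ.symm (Γ z (clampTime t)).1) (∑ j, z.2 j • X j) t := by
    intro z hz t ht
    refine isMIntegralCurveAt_extChartAt_symm_comp (c := fun t => (Γ z (clampTime t)).1) ?_
    filter_upwards [Ioo_mem_nhds ht.1 ht.2] with τ hτ
    have hT := hP.subset_ambient (hRT ((hflow z hz).2.1 (clampTime τ))).1
    exact ⟨hT, ((hflow z hz).2.2 τ hτ).2.congr_deriv (hΞa _ hT _)⟩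
  -- Running a flow line backwards from time `1` gives an integral curve for the parameter `-a`.
  have hcurve_rev : ∀ z ∈ N, ∀ t ∈ Ioo (-1 : ℝ) 2, IsMIntegralCurveAt
      (fun t => φ.symm (Γ z (clampTime (1 - t))).1) (∑ j, (-z.2) j • X j) t := by
    intro z hz t ht
    refine isMIntegralCurveAt_extChartAt_symm_comp (c := fun t => (Γ z (clampTime (1 - t))).1) ?_
    filter_upwards [Ioo_mem_nhds ht.1 ht.2] with τ hτ
    have hτ' : 1 - τ ∈ Ioo (-1 : ℝ) 2 := ⟨by linarith [hτ.2], by linarith [hτ.1]⟩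
    have hT := hP.subset_ambient (hRT ((hflow z hz).2.1 (clampTime (1 - τ)))).1
    have h1 := ((hflow z hz).2.2 _ hτ').2.scomp τ ((hasDerivAt_id τ).const_sub 1)
    refine ⟨hT, h1.congr_deriv ?_⟩
    rw [← hΞa _ hT, map_neg, neg_one_smul]
  have hcurve' : ∀ z ∈ N', ∀ t ∈ Ioo (-1 : ℝ) 2, IsMIntegralCurveAt
      (fun t => φ.symm (σ (Γ' z (clampTime t)).1)) (∑ j, z.2 j • X j) t := by
    intro z hz t ht
    refine isMIntegralCurveAt_extChartAt_symm_comp (c := fun t => σ (Γ' z (clampTime t)).1) ?_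
    filter_upwards [Ioo_mem_nhds ht.1 ht.2] with τ hτ
    have hU := (hRT' ((hflow' z hz).2.1 (clampTime τ))).1
    have hT := hP.subset_ambient (hP.mapsTo hU)
    have h1 : HasDerivAt (fun t => σ (Γ' z (clampTime t)).1) _ τ :=
      HasFDerivAt.comp_hasDerivAt (l := σ) τ (hP.hasFDerivAt hU) ((hflow' z hz).2.2 τ hτ).2
    exact ⟨hT, h1.congr_deriv ((hσY _ hU _).trans (hΞa _ hT _))⟩
  have huniq : ∀ (a : EuclideanSpace ℝ (Fin (F.dim i))) (c c' : ℝ → M),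
      (∀ t ∈ Ioo (-1 : ℝ) 2, IsMIntegralCurveAt c (∑ j, a j • X j) t) →
      (∀ t ∈ Ioo (-1 : ℝ) 2, IsMIntegralCurveAt c' (∑ j, a j • X j) t) → c 0 = c' 0 →
      c 1 = c' 1 := fun a c c' hc hc' h0 =>
    isMIntegralCurveOn_Ioo_eqOn_of_contMDiff_boundaryless (I := 𝓡 m) zero_mem_Ioo
      ((hXa a).1.of_le (by simp)) (IsMIntegralCurveAt.isMIntegralCurveOn hc)
      (IsMIntegralCurveAt.isMIntegralCurveOn hc') h0 one_mem_Ioo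
  have heval : ∀ {B : Type} [NormedAddCommGroup B] [NormedSpace ℝ B], Continuous
      (fun γ : C(TimeInterval, B) => γ (clampTime 1)) := fun {B} _ _ =>
    continuous_eval_const (F := C(TimeInterval, B)) (clampTime 1)
  -- the end points of the flow lines in the leaf
  let θ : EuclideanSpace ℝ (Fin (F.dim i)) → EuclideanSpace ℝ (Fin (F.dim i)) :=
    fun a => (Γ' (s₀, a) (clampTime 1)).1
  -- The time-one flow has parameter derivative `Y s₀ = id` at `a = 0`, so `θ` maps neighbourhoods
  -- of `0` onto neighbourhoods of `s₀`: every nearby point of the plaque is an end point.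
  have hθd : HasStrictFDerivAt θ (ContinuousLinearMap.id ℝ _) 0 := by
    have h1 : HasStrictFDerivAt Γ' (fderiv ℝ Γ' (s₀, 0)) (s₀, 0) :=
      (hΓ'.contDiffAt (hN'.mem_nhds hxN')).hasStrictFDerivAt (by simp)
    have h2 : HasStrictFDerivAt (fun a : EuclideanSpace ℝ (Fin (F.dim i)) => (s₀, a))
        (ContinuousLinearMap.inr ℝ _ _) 0 :=
      (hasStrictFDerivAt_const s₀ 0).prodMk (hasStrictFDerivAt_id 0)
    have h3 := (h1.comp (0 : EuclideanSpace ℝ (Fin (F.dim i))) h2)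
    have h4 := ((ContinuousLinearMap.fst ℝ _ _).comp (ContinuousMap.evalCLM ℝ
      (clampTime 1))).hasStrictFDerivAt.comp (0 : EuclideanSpace ℝ (Fin (F.dim i))) h3
    refine h4.congr_fderiv ?_
    refine ContinuousLinearMap.ext fun a => ?_
    refine (hder' a (clampTime 1)).trans ?_
    rw [coe_clampTime ⟨by norm_num, by norm_num⟩, one_smul, hY₀]
    rfl
  have hθ0 : θ 0 = s₀ := by
    show (Γ' (s₀, 0) (clampTime 1)).1 = s₀
    rw [hΓ₀']
    rfl
  have hθmap : Filter.map θ (𝓝 0) = 𝓝 s₀ := by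
    have := hθd.map_nhds_eq_of_surj (by simp)
    rwa [hθ0] at this
  have hgood : ∀ᶠ a in 𝓝 (0 : EuclideanSpace ℝ (Fin (F.dim i))),
      (σ s₀, a) ∈ N ∧ (s₀, a) ∈ N' ∧ (θ a, -a) ∈ N' := by
    have h1 : ContinuousAt (fun a : EuclideanSpace ℝ (Fin (F.dim i)) => (θ a, -a)) 0 :=
      hθd.continuousAt.prodMk continuousAt_neg
    refine Filter.Eventually.and ?_ (Filter.Eventually.and ?_ ?_)
    · exact (Continuous.prodMk_right (σ s₀)).continuousAt.preimage_mem_nhds (hN.mem_nhds hxN)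
    · exact (Continuous.prodMk_right s₀).continuousAt.preimage_mem_nhds (hN'.mem_nhds hxN')
    · exact h1.preimage_mem_nhds (hN'.mem_nhds (by rwa [hθ0, neg_zero]))
  have hev : ∀ᶠ s in 𝓝 s₀, ∃ a, ((σ s₀, a) ∈ N ∧ (s₀, a) ∈ N' ∧ (θ a, -a) ∈ N') ∧ θ a = s := by
    rw [← hθmap, Filter.eventually_map]
    filter_upwards [hgood] with a ha using ⟨a, ha, rfl⟩
  have hψc : Filter.Tendsto ψ (𝓝 l₀) (𝓝 s₀) := continuousAt_extChartAt l₀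
  filter_upwards [hψc.eventually hev, extChartAt_source_mem_nhds (I := 𝓡 (F.dim i)) l₀]
    with l' ⟨a, ⟨h1, h2, h3⟩, ha⟩ hl'
  have hl's : ψ.symm (θ a) = l' := by rw [ha]; exact ψ.left_inv hl'
  have hψ' : ContinuousAt ψ l' := continuousAt_extChartAt' (by simpa [hψ] using hl')
  have hmemU : ∀ z ∈ N', (Γ' z (clampTime 1)).1 ∈ U := fun z hz => (hRT' ((hflow' z hz).2.1 _)).1
  have hφc : ContinuousAt (fun x => (φ x, a)) (F.incl i l₀) :=
    (continuousAt_extChartAt _).prodMk continuousAt_const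
  have hφN : ∀ᶠ x in 𝓝 (F.incl i l₀), (φ x, a) ∈ N :=
    hφc.preimage_mem_nhds (hN.mem_nhds (by rwa [hφ0]))
  -- If the ambient flow for `a` takes `x` to a point of the plaque, then the flow for `-a` inside
  -- the plaque leads back to `x`, by uniqueness of integral curves in `M`. Nearness in the leaf
  -- topology is thereby recovered.
  have hrev : ∀ x ∈ φ.source, (φ x, a) ∈ N → ∀ k' ∈ ψ.source, (ψ k', -a) ∈ N' →
      φ.symm (Γ (φ x, a) (clampTime 1)).1 = F.incl i k' →
      x = F.incl i (ψ.symm (Γ' (ψ k', -a) (clampTime 1)).1) := by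
    intro x hx hxa k' hk' hka hh
    have h0' : (Γ' (ψ k', -a) (clampTime 0)).1 = ψ k' := by rw [(hflow' _ hka).1]
    have hU0 : ψ k' ∈ U := by
      have := (hRT' ((hflow' _ hka).2.1 (clampTime 0))).1
      rwa [h0'] at this
    have h5 := huniq (-a) (fun t => φ.symm (Γ (φ x, a) (clampTime (1 - t))).1)
      (fun t => φ.symm (σ (Γ' (ψ k', -a) (clampTime t)).1)) (hcurve_rev _ hxa) (hcurve' _ hka) (by
        simp only [sub_zero]
        rw [hh, h0', hP.symm_plaqueMap hU0, ← hψ, ψ.left_inv hk'])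
    simp only [sub_self] at h5
    rw [(hflow _ hxa).1, hP.symm_plaqueMap (hmemU _ hka)] at h5
    exact (φ.left_inv hx).symm.trans h5
  have hh0 : φ.symm (Γ (φ (F.incl i l₀), a) (clampTime 1)).1 = F.incl i l' := by
    rw [hφ0]
    have h5 : φ.symm (Γ (σ s₀, a) (clampTime 1)).1 = φ.symm (σ (Γ' (s₀, a) (clampTime 1)).1) :=
      huniq a (fun t => φ.symm (Γ (σ s₀, a) (clampTime t)).1)
        (fun t => φ.symm (σ (Γ' (s₀, a) (clampTime t)).1)) (hcurve _ h1) (hcurve' _ h2) (by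
          rw [(hflow _ h1).1, (hflow' _ h2).1])
    rw [h5, hP.symm_plaqueMap (hmemU _ h2), ← hψ, ← hl's]
  refine ⟨fun x => φ.symm (Γ (φ x, a) (clampTime 1)).1,
    fun k' => ψ.symm (Γ' (ψ k', -a) (clampTime 1)).1, hh0, ?_, ?_, ?_, ?_, ?_⟩
  · have hc1 : ContinuousAt Γ (φ (F.incl i l₀), a) :=
      hΓ.continuousOn.continuousAt (hN.mem_nhds (by rwa [hφ0]))
    have hc2 : ContinuousAt (fun x => Γ (φ x, a)) (F.incl i l₀) :=
      ContinuousAt.comp (f := fun x => (φ x, a)) hc1 hφc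
    have hc3 : ContinuousAt (fun x => (Γ (φ x, a) (clampTime 1)).1) (F.incl i l₀) :=
      continuous_fst.continuousAt.comp (heval.continuousAt.comp hc2)
    have hT := hP.subset_ambient (hRT ((hflow _ h1).2.1 (clampTime 1))).1
    rw [← hφ0] at hT
    exact ContinuousAt.comp (f := fun x => (Γ (φ x, a) (clampTime 1)).1)
      (continuousAt_extChartAt_symm'' hT) hc3
  · filter_upwards [hφN, extChartAt_source_mem_nhds (I := 𝓡 m) (F.incl i l₀)] with x hx hxs hxL
    have hstart : φ.symm (Γ (φ x, a) (clampTime 0)).1 ∈ F.leafSet i := by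
      rw [(hflow _ hx).1]
      show φ.symm (φ x) ∈ _
      rwa [φ.left_inv hxs]
    exact LeafDecomposition.mem_leafSet_of_isMIntegralCurveAt (F := F.toLeafDecomposition)
      (γ := fun t => φ.symm (Γ (φ x, a) (clampTime t)).1) (hXa a) isPreconnected_Ioo
      (hcurve _ hx) zero_mem_Ioo one_mem_Ioo hstart
  · refine F.incl_injective i (hrev _ (mem_extChartAt_source _) (by rwa [hφ0]) l' hl' ?_ hh0).symm
    rwa [← ha]
  · have hc1 : ContinuousAt Γ' (ψ l', -a) :=
      hΓ'.continuousOn.continuousAt (hN'.mem_nhds (by rwa [← ha]))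
    have hc2 : ContinuousAt (fun x => Γ' (ψ x, -a)) l' :=
      ContinuousAt.comp (f := fun x => (ψ x, -a)) hc1 (hψ'.prodMk continuousAt_const)
    have hc3 : ContinuousAt (fun x => (Γ' (ψ x, -a) (clampTime 1)).1) l' :=
      continuous_fst.continuousAt.comp (heval.continuousAt.comp hc2)
    exact ContinuousAt.comp (f := fun x => (Γ' (ψ x, -a) (clampTime 1)).1)
      (continuousAt_extChartAt_symm'' (hP.subset (hmemU _ (by rwa [← ha])))) hc3
  · have e1 : ∀ᶠ k' in 𝓝 l', k' ∈ ψ.source ∧ (ψ k', -a) ∈ N' :=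
      Filter.Eventually.and ((isOpen_extChartAt_source _).mem_nhds hl')
        ((hψ'.prodMk continuousAt_const).preimage_mem_nhds (hN'.mem_nhds (by rwa [← ha])))
    have e2 := hφN.and (extChartAt_source_mem_nhds (I := 𝓡 m) (F.incl i l₀))
    filter_upwards [e2.prod_mk e1] with z hz
    exact hrev z.1 hz.1.2 hz.1.1 z.2 hz.2.1 hz.2.2

end SingularRiemannianFoliation

/-- A cluster point in `B` of the pulled-back filter maps to a cluster point of the neighbourhoods
of `f x`, hence to `f x` itself, so by injectivity it is `x`. This is the criterion for the leaf
topology to agree with the induced one at a point. -/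
lemma comap_nhds_le_of_isCompact {X Y : Type*} [TopologicalSpace X] [TopologicalSpace Y] [T2Space Y]
    {f : X → Y} (hf : Continuous f) (hinj : Function.Injective f) {x : X} {W : Set Y}
    (hW : W ∈ 𝓝 (f x)) {B : Set X} (hB : IsCompact B) (hWB : f ⁻¹' W ⊆ B) :
    Filter.comap f (𝓝 (f x)) ≤ 𝓝 x := by
  refine hB.le_nhds_of_unique_clusterPt (Filter.mem_comap.2 ⟨W, hW, hWB⟩) fun z _ hz => ?_
  have h1 : ClusterPt (f z) (𝓝 (f x)) := hz.map hf.continuousAt Filter.tendsto_comap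
  exact hinj (eq_of_nhds_neBot h1)

/-! ### Embeddedness of closed leaves -/

namespace SingularRiemannianFoliation

variable {g : SmoothMetric m M} (F : SingularRiemannianFoliation g)

/-- The ambient flow `h` moves leaf points that are close to `l₀` in `M` to leaf points close to
`l'` in `M`. There closeness in `M` is closeness in the leaf, and `k` carries it back to `l₀`. -/
lemma comap_incl_nhds_le_of_frequently [T2Space M] {i : F.Index} {l₀ : F.Leaf i}
    (h₀ : ∃ᶠ l' in 𝓝 l₀, Filter.comap (F.incl i) (𝓝 (F.incl i l')) ≤ 𝓝 l') :
    Filter.comap (F.incl i) (𝓝 (F.incl i l₀)) ≤ 𝓝 l₀ := by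
  obtain ⟨l', hl', h, k, hh0, hhc, hL, hk0, hkc, hz⟩ :=
    (h₀.and_eventually (F.eventually_exists_leafFlow l₀)).exists
  set 𝓕 := Filter.comap (F.incl i) (𝓝 (F.incl i l₀))
  have hincl : Filter.Tendsto (F.incl i) 𝓕 (𝓝 (F.incl i l₀)) := Filter.tendsto_comap
  let κ : F.Leaf i → F.Leaf i := fun l => Function.invFun (F.incl i) (h (F.incl i l))
  have hκ : ∀ᶠ l in 𝓕, F.incl i (κ l) = h (F.incl i l) := by
    filter_upwards [hincl.eventually hL] with l hl
    exact Function.invFun_eq (hl ⟨l, rfl⟩)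
  have h1 : Filter.Tendsto (fun l => F.incl i (κ l)) 𝓕 (𝓝 (F.incl i l')) := by
    rw [← hh0]
    exact (Filter.tendsto_congr' hκ).2 (hhc.tendsto.comp hincl)
  have h2 : Filter.Tendsto κ 𝓕 (𝓝 l') := (Filter.tendsto_comap_iff.2 h1).mono_right hl'
  have h3 : ∀ᶠ l in 𝓕, l = k (κ l) := by
    filter_upwards [(hincl.prodMk h2).eventually hz, hκ] with l hl hl2
    exact F.incl_injective i (hl hl2.symm)
  have h4 : Filter.Tendsto (fun l => k (κ l)) 𝓕 (𝓝 l₀) := by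
    rw [← hk0]
    exact hkc.tendsto.comp h2
  exact (Filter.tendsto_congr' h3).2 h4

/-- Closed leaves are embedded. -/
theorem isInducing_incl [T2Space M] [CompactSpace M] (hF : F.HasClosedLeaves) (i : F.Index) :
    Topology.IsInducing (F.incl i) := by
  have hcont := (F.contMDiff_incl i).continuous
  have : LocallyCompactSpace (F.Leaf i) :=
    ChartedSpace.locallyCompactSpace (EuclideanSpace ℝ (Fin (F.dim i))) (F.Leaf i)
  -- The points where the induced topology is as fine as the leaf topology. This set is shown to be
  -- open, closed and nonempty in the connected leaf.
  let S : Set (F.Leaf i) := {l | Filter.comap (F.incl i) (𝓝 (F.incl i l)) ≤ 𝓝 l}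
  have hSo : IsOpen S := by
    refine isOpen_iff_mem_nhds.2 fun l hl => ?_
    obtain ⟨B, hB, hlB⟩ := exists_compact_mem_nhds l
    obtain ⟨W, hW, hWB⟩ := Filter.mem_comap.1 (hl hlB)
    filter_upwards [hcont.continuousAt.preimage_mem_nhds (interior_mem_nhds.2 hW)] with l' hl'
    exact comap_nhds_le_of_isCompact hcont (F.incl_injective i)
      (mem_interior_iff_mem_nhds.1 hl') hB hWB
  have hSc : IsClosed S := isClosed_of_closure_subset fun l hl =>
    F.comap_incl_nhds_le_of_frequently (mem_closure_iff_frequently.1 hl)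
  -- The closed leaf is compact Hausdorff in the induced topology, hence a Baire space, and it is a
  -- countable union of images of leaf-compact sets. One of these images has interior, and the
  -- compactness criterion applies at an interior point.
  have hSn : S.Nonempty := by
    have : CompactSpace (F.leafSet i) := isCompact_iff_compactSpace.1 (hF i).isCompact
    have : Nonempty (F.leafSet i) := (range_nonempty _).to_subtype
    obtain ⟨n, p, hp⟩ := nonempty_interior_of_iUnion_of_closed
      (f := fun n => (Subtype.val ⁻¹' (F.incl i '' compactCovering (F.Leaf i) n) :
        Set (F.leafSet i)))
      (fun n => (((isCompact_compactCovering (F.Leaf i) n).image hcont).isClosed).preimage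
        continuous_subtype_val) (by
        refine eq_univ_of_forall fun ⟨_, l, rfl⟩ => ?_
        obtain ⟨n, hn⟩ := exists_mem_compactCovering l
        exact mem_iUnion.2 ⟨n, l, hn, rfl⟩)
    obtain ⟨_, l, rfl⟩ := p
    obtain ⟨V, hV, hVn⟩ := (mem_nhds_subtype _ _ _).1 (mem_interior_iff_mem_nhds.1 hp)
    refine ⟨l, comap_nhds_le_of_isCompact hcont (F.incl_injective i) hV
      (isCompact_compactCovering (F.Leaf i) n) fun l' hl' => ?_⟩
    obtain ⟨l'', h1, h2⟩ := hVn (show (⟨F.incl i l', l', rfl⟩ : F.leafSet i) ∈ _ from hl')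
    rwa [← F.incl_injective i h2]
  have hS : S = univ := IsClopen.eq_univ ⟨hSc, hSo⟩ hSn
  refine (Topology.isInducing_iff_nhds).2 fun l => le_antisymm ?_ ?_
  · exact hcont.continuousAt.tendsto.le_comap
  · exact hS.ge (mem_univ l)

/-- Near a point of a closed leaf, the leaf consists of the plaque through the point. -/
theorem eventually_mem_plaque [T2Space M] [CompactSpace M] (hF : F.HasClosedLeaves) {i : F.Index}
    (l₀ : F.Leaf i) {V : Set (EuclideanSpace ℝ (Fin (F.dim i)))}
    (hV : V ∈ 𝓝 (extChartAt (𝓡 (F.dim i)) l₀ l₀)) :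
    ∀ᶠ p in 𝓝 (F.incl i l₀), p ∈ F.leafSet i →
      ∃ s ∈ V, extChartAt (𝓡 m) (F.incl i l₀) p = F.plaqueMap l₀ s := by
  have h1 : extChartAt (𝓡 (F.dim i)) l₀ ⁻¹' V ∩ (extChartAt (𝓡 (F.dim i)) l₀).source ∈ 𝓝 l₀ :=
    Filter.inter_mem ((continuousAt_extChartAt l₀).preimage_mem_nhds hV)
      (extChartAt_source_mem_nhds l₀)
  rw [(F.isInducing_incl hF i).nhds_eq_comap] at h1
  obtain ⟨W, hW, hWV⟩ := Filter.mem_comap.1 h1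
  filter_upwards [hW] with p hp
  rintro ⟨l, rfl⟩
  obtain ⟨h2, h3⟩ := hWV hp
  exact ⟨_, h2, by rw [LeafDecomposition.plaqueMap, (extChartAt (𝓡 (F.dim i)) l₀).left_inv h3]⟩

end SingularRiemannianFoliation

/-! ### The metric in a chart -/

section ChartForm

set_option maxSynthPendingDepth 3

/-- The metric in the chart around `x`, as a continuous bilinear form. -/
noncomputable def chartForm (g : SmoothMetric m M) (x : M) (y : EuclideanSpace ℝ (Fin m)) :
    EuclideanSpace ℝ (Fin m) →L[ℝ] EuclideanSpace ℝ (Fin m) →L[ℝ] ℝ :=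
  ContinuousLinearMap.bilinearComp
    (show EuclideanSpace ℝ (Fin m) →L[ℝ] EuclideanSpace ℝ (Fin m) →L[ℝ] ℝ from
      g.inner ((extChartAt (𝓡 m) x).symm y))
    (show EuclideanSpace ℝ (Fin m) →L[ℝ] EuclideanSpace ℝ (Fin m) from chartFrame x y)
    (show EuclideanSpace ℝ (Fin m) →L[ℝ] EuclideanSpace ℝ (Fin m) from chartFrame x y)

lemma chartForm_apply (g : SmoothMetric m M) (x : M) (y v w : EuclideanSpace ℝ (Fin m)) :
    chartForm g x y v w = chartMetric g x y v w := rfl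

lemma isSmoothMetricOn_chartForm (g : SmoothMetric m M) (x : M) :
    IsSmoothMetricOn (chartForm g x) (extChartAt (𝓡 m) x).target where
  isOpen := isOpen_extChartAt_target x
  contDiffOn := contDiffOn_clm_apply.2 fun v => contDiffOn_clm_apply.2 fun w =>
    contDiffOn_chartMetric g x v w
  symm _ _ _ _ := g.symm _ _ _
  pos y hy v hv := g.pos _ (chartFrame x y v) fun h =>
    hv ((chartFrame_bijective hy).1 (h.trans (map_zero (chartFrame x y)).symm))

lemma fderiv_chartMetric (g : SmoothMetric m M) (x : M) {y : EuclideanSpace ℝ (Fin m)}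
    (hy : y ∈ (extChartAt (𝓡 m) x).target) (a v w : EuclideanSpace ℝ (Fin m)) :
    fderiv ℝ (fun z => chartMetric g x z v w) y a = fderiv ℝ (chartForm g x) y a v w := by
  have h := (((isSmoothMetricOn_chartForm g x).hasFDerivAt hy).clm_apply
    (hasFDerivAt_const v y)).clm_apply (hasFDerivAt_const w y)
  have h2 : HasFDerivAt (fun z => chartMetric g x z v w) _ y := h
  rw [h2.fderiv]
  simp

lemma mvfderiv_chartFrame {x : M} {f : M → ℝ} {y : EuclideanSpace ℝ (Fin m)}
    (hy : y ∈ (extChartAt (𝓡 m) x).target)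
    (hf : MDifferentiableAt (𝓡 m) 𝓘(ℝ, ℝ) f ((extChartAt (𝓡 m) x).symm y))
    (w : EuclideanSpace ℝ (Fin m)) :
    mvfderiv (𝓡 m) f ((extChartAt (𝓡 m) x).symm y) (chartFrame x y w) =
      fderiv ℝ (f ∘ (extChartAt (𝓡 m) x).symm) y w := by
  have h := mfderiv_comp (I := 𝓡 m) (I' := 𝓡 m) (I'' := 𝓘(ℝ, ℝ)) (g := f) y hf
    (mdifferentiableAt_extChartAt_symm hy)
  rw [mfderiv_eq_fderiv] at h
  exact (congrArg (fun L : EuclideanSpace ℝ (Fin m) →L[ℝ] ℝ => L w) h).symm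

lemma IsSmoothMetricOn.nonneg {E : Type*} [NormedAddCommGroup E] [NormedSpace ℝ E]
    {G : E → E →L[ℝ] E →L[ℝ] ℝ} {T : Set E} (hG : IsSmoothMetricOn G T) {y : E} (hy : y ∈ T)
    (v : E) : 0 ≤ G y v v := by
  rcases eq_or_ne v 0 with rfl | h
  · simp
  · exact (hG.pos y hy v h).le

/-- Solutions of the geodesic equation in a chart are geodesics. -/
theorem isGeodesicOn_extChartAt_symm_comp (g : SmoothMetric m M) (x : M)
    {c v : ℝ → EuclideanSpace ℝ (Fin m)} {J : Set ℝ} (hJ : IsOpen J) (hJc : J.OrdConnected)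
    (hT : ∀ t ∈ J, c t ∈ (extChartAt (𝓡 m) x).target) (hc : ∀ t ∈ J, HasDerivAt c (v t) t)
    (hv : ∀ t ∈ J, HasDerivAt v (geodesicAcc (chartForm g x) (c t) (v t)) t) :
    IsGeodesicOn g (fun t => (extChartAt (𝓡 m) x).symm (c t)) J := by
  have hG := isSmoothMetricOn_chartForm g x
  have hcc : ContinuousOn c J := fun t ht => (hc t ht).continuousAt.continuousWithinAt
  have hvc : ContinuousOn v J := fun t ht => (hv t ht).continuousAt.continuousWithinAt
  have hv1 : ContDiffOn ℝ 1 v J := by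
    rw [show (1 : WithTop ℕ∞) = 0 + 1 from rfl, contDiffOn_succ_iff_deriv_of_isOpen hJ]
    refine ⟨fun t ht => (hv t ht).differentiableAt.differentiableWithinAt, by simp, ?_⟩
    rw [contDiffOn_zero]
    refine ContinuousOn.congr ?_ fun t ht => (hv t ht).deriv
    have h := ContinuousOn.comp (f := fun t => (c t, v t)) (s := J) hG.continuousOn_acc
      (hcc.prodMk hvc) fun t ht => ⟨hT t ht, mem_univ _⟩
    exact h
  have hc2 : ContDiffOn ℝ 2 c J := by
    rw [show (2 : WithTop ℕ∞) = 1 + 1 from rfl, contDiffOn_succ_iff_deriv_of_isOpen hJ]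
    exact ⟨fun t ht => (hc t ht).differentiableAt.differentiableWithinAt, by simp,
      hv1.congr fun t ht => (hc t ht).deriv⟩
  refine ⟨hJ, hJc, ?_, fun t ht => ⟨x, ?_, ?_⟩⟩
  · exact ((contMDiffOn_extChartAt_symm (n := 2) x)).comp hc2.contMDiffOn hT
  · simpa using extChartAt_symm_mem_source (hT t ht)
  · intro w
    have h0 : ∀ t ∈ J, extChartAt (𝓡 m) x ((extChartAt (𝓡 m) x).symm (c t)) = c t := fun t ht =>
      (extChartAt (𝓡 m) x).right_inv (hT t ht)
    have h1 : ∀ t ∈ J, deriv (fun s => extChartAt (𝓡 m) x ((extChartAt (𝓡 m) x).symm (c s))) t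
        = v t := by
      intro t ht
      refine ((hc t ht).congr_of_eventuallyEq ?_).deriv
      filter_upwards [hJ.mem_nhds ht] with s hs using h0 s hs
    have h2 : deriv (deriv fun s => extChartAt (𝓡 m) x ((extChartAt (𝓡 m) x).symm (c s))) t
        = geodesicAcc (chartForm g x) (c t) (v t) := by
      refine ((hv t ht).congr_of_eventuallyEq ?_).deriv
      filter_upwards [hJ.mem_nhds ht] with s hs using h1 s hs
    rw [h0 t ht, h1 t ht, h2, ← chartForm_apply, hG.acc_eq (hT t ht), christoffel,
      fderiv_chartMetric g x (hT t ht), fderiv_chartMetric g x (hT t ht)]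
    ring

end ChartForm

/-! ### The squared distance to a leaf -/

/-- `f` behaves on `W` like the squared distance to the `i`-th leaf: each point `p` of `W` is joined
to the leaf by a curve of constant squared speed `f p`, and the gradient of `f` is bounded
accordingly and orthogonal to the leaves. -/
structure IsTubeFunction {g : SmoothMetric m M} (F : SingularRiemannianFoliation g) (i : F.Index)
    (W : Set M) (f : M → ℝ) (Φ : M → ℝ → M) : Prop where
  isOpen : IsOpen W
  contMDiffOn : ContMDiffOn (𝓡 m) 𝓘(ℝ, ℝ) ∞ f W
  nonneg : ∀ p ∈ W, 0 ≤ f p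
  eq_zero_iff : ∀ p ∈ W, f p = 0 ↔ p ∈ F.leafSet i
  mfderiv_leafTangent : ∀ p ∈ W, ∀ v ∈ F.leafTangent p, mvfderiv (𝓡 m) f p v = 0
  mfderiv_sq_le : ∀ p ∈ W, ∀ v : TangentSpace (𝓡 m) p,
    mvfderiv (𝓡 m) f p v ^ 2 ≤ 4 * f p * g.inner p v v
  continuousOn_curve : ContinuousOn (fun z : M × ℝ => Φ z.1 z.2) (W ×ˢ Icc 0 1)
  curve_zero : ∀ p ∈ W, Φ p 0 ∈ F.leafSet i
  curve_one : ∀ p ∈ W, Φ p 1 = p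
  curve_const : ∀ p ∈ W, p ∈ F.leafSet i → ∀ t, Φ p t = p
  velocity : ∀ p ∈ W, ∀ t ∈ Icc (0 : ℝ) 1, ∃ v : TangentSpace (𝓡 m) (Φ p t),
    HasMFDerivAt 𝓘(ℝ, ℝ) (𝓡 m) (Φ p) t ((1 : ℝ →L[ℝ] ℝ).smulRight v) ∧
      g.inner (Φ p t) v v = f p

lemma inner_sq_le (g : SmoothMetric m M) (p : M) (v w : TangentSpace (𝓡 m) p) :
    g.inner p v w ^ 2 ≤ g.inner p v v * g.inner p w w := by
  have hnn : ∀ v : TangentSpace (𝓡 m) p, 0 ≤ g.inner p v v := by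
    intro v
    rcases eq_or_ne v 0 with rfl | h
    · simp
    · exact (g.pos p v h).le
  rcases eq_or_ne w 0 with rfl | hw
  · simp
  · have hw' := g.pos p w hw
    have h1 := hnn (g.inner p w w • v - g.inner p v w • w)
    simp only [map_sub, map_smul, _root_.sub_apply, _root_.smul_apply, smul_eq_mul,
      g.symm p w v] at h1
    nlinarith [h1, hw']

namespace SingularRiemannianFoliation

variable {g : SmoothMetric m M} (F : SingularRiemannianFoliation g)

set_option maxSynthPendingDepth 3 in
/-- Geodesics that start orthogonally to a leaf. -/
lemma normal_of_fermiChart {i : F.Index} {l₀ : F.Leaf i}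
    {U : Set (EuclideanSpace ℝ (Fin (F.dim i)))} {O : Set (EuclideanSpace ℝ (Fin m))}
    {r : EuclideanSpace ℝ (Fin m) → EuclideanSpace ℝ (Fin (F.dim i))}
    (hP : F.IsPlaqueDomain l₀ U O r) {s₀ : EuclideanSpace ℝ (Fin (F.dim i))}
    (C : FermiChart (chartForm g (F.incl i l₀)) (extChartAt (𝓡 m) (F.incl i l₀)).target
      (F.plaqueMap l₀) U s₀) {y : EuclideanSpace ℝ (Fin m)} (hy : y ∈ C.W)
    {w : EuclideanSpace ℝ (Fin m)} (hw : chartFrame (F.incl i l₀) y w ∈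
      F.leafTangent ((extChartAt (𝓡 m) (F.incl i l₀)).symm y)) :
    chartForm g (F.incl i l₀) y (C.vel y 1) w = 0 := by
  have hgeo := isGeodesicOn_extChartAt_symm_comp g (F.incl i l₀) isOpen_Ioo ordConnected_Ioo
    (C.curve_mem y hy) (C.hasDerivAt_curve y hy) (C.hasDerivAt_vel y hy)
  have hvel : ∀ t ∈ Ioo (-1 : ℝ) 2, FoliatedGeometry.velocity
      (fun t => (extChartAt (𝓡 m) (F.incl i l₀)).symm (C.curve y t)) t =
      chartFrame (F.incl i l₀) (C.curve y t) (C.vel y t) := fun t ht =>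
    velocity_extChartAt_symm_comp (C.curve_mem y hy t ht) (C.hasDerivAt_curve y hy t ht)
  have h0 : F.IsNormal g ((extChartAt (𝓡 m) (F.incl i l₀)).symm (C.curve y 0))
      (FoliatedGeometry.velocity
        (fun t => (extChartAt (𝓡 m) (F.incl i l₀)).symm (C.curve y t)) 0) := by
    rw [hvel 0 zero_mem_Ioo]
    intro ξ hξ
    obtain ⟨w', rfl⟩ := (chartFrame_bijective (C.curve_mem y hy 0 zero_mem_Ioo)).2 ξ
    have key : ∀ z, z = F.plaqueMap l₀ (C.foot y) → ∀ w', chartFrame (F.incl i l₀) z w' ∈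
        F.leafTangent ((extChartAt (𝓡 m) (F.incl i l₀)).symm z) →
        ∃ a, fderiv ℝ (F.plaqueMap l₀) (C.foot y) a = w' := by
      rintro _ rfl w' h
      exact (hP.chartFrame_mem_leafTangent_iff (C.foot_mem y hy) w').1 h
    obtain ⟨a, rfl⟩ := key _ (C.curve_zero y hy) w' hξ
    exact C.normal y hy a
  -- Transnormality transfers orthogonality from the foot point at time `0` to the end point at time
  -- `1`.
  have h1 := F.transnormal _ _ hgeo 0 zero_mem_Ioo h0 1 one_mem_Ioo
  rw [hvel 1 one_mem_Ioo] at h1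
  have key : ∀ z, z = y → chartForm g (F.incl i l₀) z (C.vel y 1) w = 0 →
      chartForm g (F.incl i l₀) y (C.vel y 1) w = 0 := by
    rintro _ rfl h
    exact h
  have key2 : ∀ z, z = y → chartFrame (F.incl i l₀) z w ∈
      F.leafTangent ((extChartAt (𝓡 m) (F.incl i l₀)).symm z) := by
    rintro _ rfl
    exact hw
  exact key _ (C.curve_one y hy) (h1 _ (key2 _ (C.curve_one y hy)))

-- The function is the squared geodesic length of a Fermi chart. The Gauss lemma turns normality of
-- the final velocity into vanishing of the differential along leaves, and with Cauchy–Schwarz it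
-- gives the gradient bound. Embeddedness of the leaf ensures that nearby leaf points lie on the
-- plaque itself, so the function is zero at all of them.
set_option maxSynthPendingDepth 3 in
theorem exists_isTubeFunction [T2Space M] [CompactSpace M] (hF : F.HasClosedLeaves) {i : F.Index}
    (l₀ : F.Leaf i) : ∃ W f Φ, F.incl i l₀ ∈ W ∧ IsTubeFunction F i W f Φ := by
  obtain ⟨U, O, r, hP⟩ := F.exists_isPlaqueDomain l₀
  have hG := isSmoothMetricOn_chartForm g (F.incl i l₀)
  obtain ⟨C⟩ := hG.exists_fermiChart hP.isOpen hP.contDiffOn hP.mem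
    (hP.subset_ambient (hP.mapsTo hP.mem)) (hP.fderiv_injective hP.mem)
  set φ := extChartAt (𝓡 m) (F.incl i l₀) with hφ
  have hφ0 : φ (F.incl i l₀) = F.plaqueMap l₀ (extChartAt (𝓡 (F.dim i)) l₀ l₀) :=
    congrArg (fun l => φ (F.incl i l)) (extChartAt_to_inv l₀).symm
  obtain ⟨W₁, hW₁, hW₁o, hmW₁⟩ := mem_nhds_iff.1 (F.eventually_mem_plaque hF l₀ C.eventually_foot)
  have hWT : C.W ⊆ φ.target := fun y hy => by
    have := C.curve_mem y hy 1 one_mem_Ioo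
    rwa [C.curve_one y hy] at this
  let W : Set M := (φ.source ∩ φ ⁻¹' C.W) ∩ W₁
  have hWo : IsOpen W := ((continuousOn_extChartAt _).isOpen_inter_preimage
    (isOpen_extChartAt_source _) C.isOpen).inter hW₁o
  have hleaf : ∀ p ∈ W, p ∈ F.leafSet i → C.sq (φ p) = 0 ∧ ∀ t, C.curve (φ p) t = φ p := by
    intro p hp hpL
    obtain ⟨s, hs, hps⟩ := hW₁ hp.2 hpL
    rw [← hφ] at hps
    rw [hps]
    exact hs.2.2
  have hIcc : Icc (0 : ℝ) 1 ⊆ Ioo (-1) 2 := fun t ht =>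
    ⟨by linarith [ht.1], by linarith [ht.2]⟩
  have hsm : ContMDiffOn (𝓡 m) 𝓘(ℝ, ℝ) ∞ (fun p => C.sq (φ p)) W := by
    refine C.contDiffOn_sq.contMDiffOn.comp ((contMDiffOn_extChartAt (x := F.incl i l₀)).mono ?_)
      fun p hp => hp.1.2
    intro p hp
    simpa [hφ] using hp.1.1
  have hchart : ∀ P : M → Prop, (∀ y ∈ C.W, φ.symm y ∈ W → P (φ.symm y)) → ∀ p ∈ W, P p := by
    intro P h p hp
    rw [← φ.left_inv hp.1.1]
    exact h _ hp.1.2 (by rwa [φ.left_inv hp.1.1])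
  have hd : ∀ y ∈ C.W, φ.symm y ∈ W → ∀ w, mvfderiv (𝓡 m) (fun p => C.sq (φ p)) (φ.symm y)
      (chartFrame (F.incl i l₀) y w) = 2 * chartForm g (F.incl i l₀) y (C.vel y 1) w := by
    intro y hy hyW w
    rw [mvfderiv_chartFrame (hWT hy)
      ((hsm.contMDiffAt (hWo.mem_nhds hyW)).mdifferentiableAt (by simp)), ← C.gauss y hy]
    congr 1
    refine Filter.EventuallyEq.fderiv_eq ?_
    filter_upwards [C.isOpen.mem_nhds hy] with z hz
    exact congrArg C.sq (φ.right_inv (hWT hz))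
  have hspeed : ∀ y ∈ C.W, chartForm g (F.incl i l₀) y (C.vel y 1) (C.vel y 1) = C.sq y := by
    intro y hy
    have := C.speed y hy 1 one_mem_Ioo
    rwa [C.curve_one y hy] at this
  refine ⟨W, fun p => C.sq (φ p), fun p t => φ.symm (C.curve (φ p) t), ?_, ?_⟩
  · refine ⟨⟨mem_extChartAt_source _, ?_⟩, hmW₁⟩
    rw [mem_preimage, hφ0]
    exact C.mem
  refine ⟨hWo, hsm, ?_, ?_, ?_, ?_, ?_, ?_, ?_, ?_, ?_⟩
  · intro p hp
    show 0 ≤ C.sq (φ p)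
    rw [← hspeed _ hp.1.2]
    exact hG.nonneg (hWT hp.1.2) _
  · intro p hp
    refine ⟨fun h => ?_, fun h => (hleaf p hp h).1⟩
    -- Squared speed zero makes the geodesic constant, so the point coincides with its foot point on
    -- the leaf.
    have hv : ∀ t ∈ Ioo (-1 : ℝ) 2, HasDerivAt (C.curve (φ p)) 0 t := by
      intro t ht
      have h1 := C.speed _ hp.1.2 t ht
      have h2 : C.vel (φ p) t = 0 := by
        by_contra hne
        exact (hG.pos _ (C.curve_mem _ hp.1.2 t ht) _ hne).ne' (h1.trans h)
      rw [← h2]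
      exact C.hasDerivAt_curve _ hp.1.2 t ht
    have h3 := isOpen_Ioo.is_const_of_deriv_eq_zero (𝕜 := ℝ) isPreconnected_Ioo
        (fun t ht => (hv t ht).differentiableAt.differentiableWithinAt)
        (fun t ht => (hv t ht).deriv) one_mem_Ioo zero_mem_Ioo
    rw [C.curve_one _ hp.1.2, C.curve_zero _ hp.1.2] at h3
    rw [← φ.left_inv hp.1.1, h3, hP.symm_plaqueMap (C.foot_mem _ hp.1.2)]
    exact mem_range_self _
  · refine hchart _ fun y hy hyW v hv => ?_
    obtain ⟨w, rfl⟩ := (chartFrame_bijective (hWT hy)).2 v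
    rw [hd y hy hyW, F.normal_of_fermiChart hP C hy hv, mul_zero]
  · refine hchart _ fun y hy hyW v => ?_
    obtain ⟨w, rfl⟩ := (chartFrame_bijective (hWT hy)).2 v
    rw [hd y hy hyW]
    have h1 := inner_sq_le g (φ.symm y) (chartFrame (F.incl i l₀) y (C.vel y 1))
      (chartFrame (F.incl i l₀) y w)
    have h2 : C.sq (φ (φ.symm y)) = C.sq y := by rw [φ.right_inv (hWT hy)]
    rw [h2, ← hspeed y hy, mul_pow]
    calc _ = 4 * (chartForm g (F.incl i l₀) y (C.vel y 1) w ^ 2) := by ring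
      _ ≤ 4 * _ := mul_le_mul_of_nonneg_left h1 (by norm_num)
      _ = _ := by rw [← mul_assoc]; rfl
  · refine (continuousOn_extChartAt_symm (I := 𝓡 m) (F.incl i l₀)).comp
      (C.continuousOn_curve.comp (((continuousOn_extChartAt (I := 𝓡 m) (F.incl i l₀)).comp
        continuousOn_fst fun z hz => hz.1.1.1).prodMk continuousOn_snd)
        fun z hz => ⟨hz.1.1.2, mem_univ _⟩) fun z hz => ?_
    exact C.curve_mem _ hz.1.1.2 _ (hIcc hz.2)
  · intro p hp
    show φ.symm (C.curve (φ p) 0) ∈ _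
    rw [C.curve_zero _ hp.1.2, hP.symm_plaqueMap (C.foot_mem _ hp.1.2)]
    exact mem_range_self _
  · intro p hp
    show φ.symm (C.curve (φ p) 1) = p
    rw [C.curve_one _ hp.1.2]
    exact φ.left_inv hp.1.1
  · intro p hp hpL t
    show φ.symm (C.curve (φ p) t) = p
    rw [(hleaf p hp hpL).2 t]
    exact φ.left_inv hp.1.1
  · intro p hp t ht
    exact ⟨_, hasMFDerivAt_extChartAt_symm_comp (C.curve_mem _ hp.1.2 t (hIcc ht))
      (C.hasDerivAt_curve _ hp.1.2 t (hIcc ht)), C.speed _ hp.1.2 t (hIcc ht)⟩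

end SingularRiemannianFoliation

/-- A comparison estimate: if `h` starts at `0` and `h'² ≤ 4 ρ h`, then `√h` has slope at most
`√ρ`. -/
lemma le_of_deriv_sq_le {h h' : ℝ → ℝ} {ρ : ℝ} (hρ : 0 ≤ ρ)
    (hd : ∀ t ∈ Icc (0 : ℝ) 1, HasDerivAt h (h' t) t) (hnn : ∀ t ∈ Icc (0 : ℝ) 1, 0 ≤ h t)
    (h0 : h 0 = 0) (hle : ∀ t ∈ Icc (0 : ℝ) 1, h' t ^ 2 ≤ 4 * h t * ρ) : h 1 ≤ ρ := by
  -- The shift by `ε ^ 2` keeps the square root differentiable where `h` vanishes, in particular at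
  -- time `0`.
  have key : ∀ ε > 0, h 1 ≤ ρ + 2 * ε * √ρ := by
    intro ε hε
    have hpos : ∀ t ∈ Icc (0 : ℝ) 1, 0 < h t + ε ^ 2 := fun t ht =>
      add_pos_of_nonneg_of_pos (hnn t ht) (by positivity)
    have h1 : ∀ t ∈ Icc (0 : ℝ) 1, HasDerivWithinAt (fun t => √(h t + ε ^ 2))
        (h' t / (2 * √(h t + ε ^ 2))) (Icc 0 1) t := fun t ht =>
      (((hd t ht).add_const (ε ^ 2)).sqrt (hpos t ht).ne').hasDerivWithinAt
    have h2 : ∀ t ∈ Icc (0 : ℝ) 1, ‖h' t / (2 * √(h t + ε ^ 2))‖ ≤ √ρ := by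
      intro t ht
      have hs := Real.sqrt_pos.2 (hpos t ht)
      rw [norm_div, Real.norm_eq_abs, Real.norm_eq_abs, abs_of_pos (mul_pos two_pos hs),
        div_le_iff₀ (by positivity)]
      refine abs_le_of_sq_le_sq ?_ (by positivity)
      rw [mul_pow, mul_pow, Real.sq_sqrt hρ, Real.sq_sqrt (hpos t ht).le]
      nlinarith [hle t ht, mul_nonneg hρ (sq_nonneg ε)]
    have h3 := (convex_Icc (0 : ℝ) 1).norm_image_sub_le_of_norm_hasDerivWithin_le h1 h2
      (left_mem_Icc.2 zero_le_one) (right_mem_Icc.2 zero_le_one)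
    simp only [h0, zero_add, sub_zero, norm_one, mul_one, Real.sqrt_sq hε.le] at h3
    have h4 : √(h 1 + ε ^ 2) ≤ √ρ + ε := by
      have := (le_abs_self _).trans h3
      linarith
    have h5 := Real.sqrt_le_left (by positivity) |>.1 h4
    nlinarith [Real.sq_sqrt hρ]
  refine le_of_forall_pos_le_add fun δ hδ => ?_
  have h1 : 0 < 2 * √ρ + 1 := by positivity
  refine (key (δ / (2 * √ρ + 1)) (by positivity)).trans (add_le_add_right ?_ ρ)
  have h2 : 2 * (δ / (2 * √ρ + 1)) * √ρ = δ * (2 * √ρ) / (2 * √ρ + 1) := by ring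
  rw [h2, div_le_iff₀ h1]
  nlinarith

/-! ### Agreement of the local squared distances -/

namespace IsTubeFunction

variable {g : SmoothMetric m M} {F : SingularRiemannianFoliation g} {i : F.Index}
  {W W' : Set M} {f f' : M → ℝ} {Φ Φ' : M → ℝ → M}

lemma mdifferentiableAt (h : IsTubeFunction F i W f Φ) {p : M} (hp : p ∈ W) :
    MDifferentiableAt (𝓡 m) 𝓘(ℝ, ℝ) f p :=
  (h.contMDiffOn.contMDiffAt (h.isOpen.mem_nhds hp)).mdifferentiableAt (by simp)

/-- Along the curve joining the leaf to `p`, the function `f'` starts at zero, and its derivative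
obeys the gradient bound with constant squared speed `f p`; the comparison estimate gives the value
at the end. -/
lemma le_of_forall_mem (h : IsTubeFunction F i W f Φ) (h' : IsTubeFunction F i W' f' Φ') {p : M}
    (hp : p ∈ W) (hW' : ∀ t ∈ Icc (0 : ℝ) 1, Φ p t ∈ W') : f' p ≤ f p := by
  choose! v hv hvf using h.velocity p hp
  have hd : ∀ t ∈ Icc (0 : ℝ) 1, HasDerivAt (fun t => f' (Φ p t))
      (mvfderiv (𝓡 m) f' (Φ p t) (v t)) t := by
    intro t ht
    have h1 : HasFDerivAt (fun t => f' (Φ p t)) (show ℝ →L[ℝ] ℝ from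
        (mvfderiv (𝓡 m) f' (Φ p t)).comp ((1 : ℝ →L[ℝ] ℝ).smulRight (v t))) t :=
      ((h'.mdifferentiableAt (hW' t ht)).hasMFDerivAt.comp t (hv t ht)).hasFDerivAt
    refine h1.hasDerivAt.congr_deriv ?_
    exact congrArg (mvfderiv (𝓡 m) f' (Φ p t)) (one_smul ℝ (v t))
  have h1 := le_of_deriv_sq_le (h.nonneg p hp) hd (fun t ht => h'.nonneg _ (hW' t ht))
    ((h'.eq_zero_iff _ (hW' 0 (left_mem_Icc.2 zero_le_one))).2 (h.curve_zero p hp))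
    (fun t ht => by
      have := h'.mfderiv_sq_le _ (hW' t ht) (v t)
      rwa [hvf t ht] at this)
  rwa [h.curve_one p hp] at h1

/-- The joining curve of a leaf point `q` is constant. By compactness of `[0, 1]` the joining curves
of points near `q` stay close to `q`, hence inside `W'`. -/
lemma eventually_le (h : IsTubeFunction F i W f Φ) (h' : IsTubeFunction F i W' f' Φ') {q : M}
    (hq : q ∈ W) (hq' : q ∈ W') (hqL : q ∈ F.leafSet i) : ∀ᶠ p in 𝓝 q, f' p ≤ f p := by
  have h1 : ∀ᶠ p in 𝓝 q, ∀ t ∈ Icc (0 : ℝ) 1, t ∈ Icc (0 : ℝ) 1 → Φ p t ∈ W' := by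
    refine isCompact_Icc.eventually_forall_of_forall_eventually fun t ht => ?_
    have h2 := h.continuousOn_curve (q, t) ⟨hq, ht⟩
    have h3 : W' ∈ 𝓝 (Φ q t) := by
      rw [h.curve_const q hq hqL t]
      exact h'.isOpen.mem_nhds hq'
    have h4 := eventually_nhdsWithin_iff.1 (h2.preimage_mem_nhdsWithin h3)
    have h5 : ∀ᶠ z : M × ℝ in 𝓝 (q, t), z.1 ∈ W :=
      continuous_fst.continuousAt.preimage_mem_nhds (h.isOpen.mem_nhds hq)
    filter_upwards [h4, h5] with z hz hzW hzt
    exact hz ⟨hzW, hzt⟩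
  filter_upwards [h1, h.isOpen.mem_nhds hq] with p hp hpW
  exact h.le_of_forall_mem h' hpW fun t ht => hp t ht ht

lemma eventually_eq (h : IsTubeFunction F i W f Φ) (h' : IsTubeFunction F i W' f' Φ') {q : M}
    (hq : q ∈ W) (hq' : q ∈ W') (hqL : q ∈ F.leafSet i) : ∀ᶠ p in 𝓝 q, f p = f' p := by
  filter_upwards [h.eventually_le h' hq hq' hqL, h'.eventually_le h hq' hq hqL] with p h1 h2
  exact le_antisymm h2 h1

end IsTubeFunction

/-! ### Tubes around a leaf and invariant functions -/

namespace SingularRiemannianFoliation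

variable {g : SmoothMetric m M} (F : SingularRiemannianFoliation g)

/-- The local squared distances to a closed leaf fit together. -/
theorem exists_tube [T2Space M] [CompactSpace M] (hF : F.HasClosedLeaves) (i : F.Index) :
    ∃ (U : Set M) (f : M → ℝ), IsOpen U ∧ F.leafSet i ⊆ U ∧
      ∀ p ∈ U, ∃ W f' Φ, p ∈ W ∧ IsTubeFunction F i W f' Φ ∧ f =ᶠ[𝓝 p] f' := by
  choose W f Φ hmem hf using fun l : F.Leaf i => F.exists_isTubeFunction hF l
  obtain ⟨t, ht⟩ := (hF i).isCompact.elim_finite_subcover W (fun l => (hf l).isOpen) (by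
    rintro _ ⟨l, rfl⟩
    exact mem_iUnion.2 ⟨l, hmem l⟩)
  obtain ⟨V, hLV, hVo, hVW⟩ := exists_subset_iUnion_closure_subset (hF i)
    (u := fun l : t => W l) (fun l => (hf l).isOpen) (fun _ _ => toFinite _)
    (by simpa [iUnion_subtype] using ht)
  -- The points where all relevant local functions agree. With closures of the shrunken sets, not
  -- belonging to one of them is an open condition; as there are finitely many, `U₀` is a
  -- neighbourhood of every point of the leaf.
  let U₀ : Set M := {p | ∀ l l' : t, p ∈ closure (V l) → p ∈ closure (V l') → f l p = f l' p}
  have hU₀ : ∀ p ∈ F.leafSet i, U₀ ∈ 𝓝 p := by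
    intro p hp
    refine Filter.eventually_all.2 fun l => Filter.eventually_all.2 fun l' => ?_
    by_cases h1 : p ∈ closure (V l)
    · by_cases h2 : p ∈ closure (V l')
      · filter_upwards [(hf l).eventually_eq (hf l') (hVW l h1) (hVW l' h2) hp] with q hq _ _
          using hq
      · filter_upwards [isClosed_closure.isOpen_compl.mem_nhds h2] with q hq _ h using absurd h hq
    · filter_upwards [isClosed_closure.isOpen_compl.mem_nhds h1] with q hq h using absurd h hq
  classical
  let f₀ : M → ℝ := fun p => if h : ∃ l : t, p ∈ V l then f h.choose p else 0
  refine ⟨interior U₀ ∩ ⋃ l, V l, f₀, isOpen_interior.inter (isOpen_iUnion hVo),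
    fun p hp => ⟨mem_interior_iff_mem_nhds.2 (hU₀ p hp), hLV hp⟩, ?_⟩
  rintro p ⟨hp, hpV⟩
  obtain ⟨l, hl⟩ := mem_iUnion.1 hpV
  refine ⟨W l, f l, Φ l, hVW l (subset_closure hl), hf l, ?_⟩
  filter_upwards [mem_interior_iff_mem_nhds.1 hp, (hVo l).mem_nhds hl] with q hq hql
  have h : ∃ l : t, q ∈ V l := ⟨l, hql⟩
  simp only [f₀, dif_pos h]
  exact hq _ _ (subset_closure h.choose_spec) (subset_closure hql)

/-- A tube around a closed leaf, with a function that is smooth on the tube, vanishes exactly on the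
leaf, is stationary along the leaves, and whose closed superlevel sets are closed in `M`. -/
theorem exists_proper_tube [T2Space M] [CompactSpace M] [ConnectedSpace M]
    (hF : F.HasClosedLeaves) {i : F.Index} (hi : F.leafSet i ≠ univ) :
    ∃ (V : Set M) (f : M → ℝ) (ε : ℝ), 0 < ε ∧ IsOpen V ∧
      (∀ p ∈ V, ContMDiffAt (𝓡 m) 𝓘(ℝ, ℝ) ∞ f p) ∧
      (∀ p ∈ V, ∀ v ∈ F.leafTangent p, mvfderiv (𝓡 m) f p v = 0) ∧
      (∀ a b, b < ε → IsClosed {p ∈ V | f p ∈ Icc a b}) ∧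
      ∀ c, 0 < c → c < ε → ∃ p ∈ V, f p = c := by
  obtain ⟨U, f, hU, hLU, hf⟩ := F.exists_tube hF i
  obtain ⟨V, hV, hLV, hVU⟩ := normal_exists_closure_subset (hF i) hU hLU
  have hsm : ∀ p ∈ U, ContMDiffAt (𝓡 m) 𝓘(ℝ, ℝ) ∞ f p := by
    intro p hp
    obtain ⟨W, f', Φ, hpW, h, he⟩ := hf p hp
    exact (h.contMDiffOn.contMDiffAt (h.isOpen.mem_nhds hpW)).congr_of_eventuallyEq he
  have hzero : ∀ p ∈ U, 0 ≤ f p ∧ (f p = 0 ↔ p ∈ F.leafSet i) := by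
    intro p hp
    obtain ⟨W, f', Φ, hpW, h, he⟩ := hf p hp
    rw [he.eq_of_nhds]
    exact ⟨h.nonneg p hpW, h.eq_zero_iff p hpW⟩
  have hcont : ContinuousOn f (closure V) := fun p hp =>
    (hsm p (hVU hp)).continuousAt.continuousWithinAt
  have hfrpos : ∀ p ∈ frontier V, 0 < f p := by
    intro p hp
    have hpU := hVU (frontier_subset_closure hp)
    refine lt_of_le_of_ne (hzero p hpU).1 fun h => ?_
    have := hLV ((hzero p hpU).2.1 h.symm)
    rw [hV.frontier_eq] at hp
    exact hp.2 this
  -- The leaf lies in the open set `V`, so `f` is positive on the compact frontier. Below the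
  -- minimum there, sublevel sets stay away from the frontier.
  obtain ⟨ε₁, hε₁, hfr⟩ : ∃ ε₁ > 0, ∀ p ∈ frontier V, ε₁ ≤ f p := by
    rcases (frontier V).eq_empty_or_nonempty with h | h
    · exact ⟨1, one_pos, by simp [h]⟩
    · obtain ⟨p, hp, hmin⟩ := isClosed_frontier.isCompact.exists_isMinOn h
        (hcont.mono frontier_subset_closure)
      exact ⟨f p, hfrpos p hp, hmin⟩
  obtain ⟨q, hq⟩ := (ne_univ_iff_exists_notMem _).1 hi
  -- A point `q` off the leaf is kept out of all sublevel sets below `ε`, so that none of them can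
  -- be the whole of `M`.
  obtain ⟨ε, hε, hεε₁, hεq⟩ : ∃ ε > 0, ε ≤ ε₁ ∧ (q ∈ V → ε ≤ f q) := by
    by_cases hqV : q ∈ V
    · have hqU := hVU (subset_closure hqV)
      have h1 : 0 < f q := lt_of_le_of_ne (hzero q hqU).1 fun h => hq ((hzero q hqU).2.1 h.symm)
      exact ⟨min ε₁ (f q), lt_min hε₁ h1, min_le_left _ _, fun _ => min_le_right _ _⟩
    · exact ⟨ε₁, hε₁, le_rfl, fun h => absurd h hqV⟩
  have hclos : ∀ p ∈ closure V, f p < ε → p ∈ V := by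
    intro p hp hpε
    by_contra hpV
    have := hfr p (by rw [hV.frontier_eq]; exact ⟨hp, hpV⟩)
    linarith
  refine ⟨V, f, ε, hε, hV, fun p hp => hsm p (hVU (subset_closure hp)), ?_, ?_, ?_⟩
  · intro p hp v hv
    obtain ⟨W, f', Φ, hpW, h, he⟩ := hf p (hVU (subset_closure hp))
    have h1 := h.mfderiv_leafTangent p hpW v hv
    have h2 : mvfderiv (𝓡 m) f p v = mvfderiv (𝓡 m) f' p v :=
      congrArg (fun L : EuclideanSpace ℝ (Fin m) →L[ℝ] ℝ => L v)
        (he.mfderiv_eq (I := 𝓡 m) (I' := 𝓘(ℝ, ℝ)))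
    exact h2.trans h1
  · intro a b hb
    have h1 : {p ∈ V | f p ∈ Icc a b} = closure V ∩ f ⁻¹' Icc a b := by
      ext p
      exact ⟨fun h => ⟨subset_closure h.1, h.2⟩, fun h =>
        ⟨hclos p h.1 (h.2.2.trans_lt hb), h.2⟩⟩
    rw [h1]
    exact hcont.preimage_isClosed_of_isClosed isClosed_closure isClosed_Icc
  · intro c hc hcε
    by_contra! hne
    have h1 : {p ∈ V | f p < c} = closure V ∩ f ⁻¹' Iic c := by
      ext p
      refine ⟨fun h => ⟨subset_closure h.1, h.2.le⟩, fun h => ?_⟩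
      have hpV := hclos p h.1 (lt_of_le_of_lt h.2 hcε)
      exact ⟨hpV, lt_of_le_of_ne h.2 (hne p hpV)⟩
    -- If the value `c` is omitted, then `f < c` and `f ≤ c` describe the same set. It is clopen and
    -- contains the leaf but not `q`, contradicting connectedness of `M`.
    have h2 : IsClopen {p ∈ V | f p < c} := by
      refine ⟨?_, ?_⟩
      · rw [h1]
        exact hcont.preimage_isClosed_of_isClosed isClosed_closure isClosed_Iic
      · exact (hcont.mono subset_closure).isOpen_inter_preimage hV isOpen_Iio
    obtain ⟨l⟩ : Nonempty (F.Leaf i) := inferInstance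
    have hl : F.incl i l ∈ F.leafSet i := mem_range_self l
    have h3 := h2.eq_univ ⟨F.incl i l, hLV hl, by
      rw [(hzero _ (hLU hl)).2.2 hl]; exact hc⟩
    have h4 : q ∈ {p ∈ V | f p < c} := h3 ▸ mem_univ q
    have := hεq h4.1
    linarith [h4.2]

/-- Functions that are stationary along the leaves are constant on the leaves. -/
lemma eq_of_mvfderiv_leafTangent {u : M → ℝ} (hu : MDifferentiable (𝓡 m) 𝓘(ℝ, ℝ) u)
    (h : ∀ p, ∀ v ∈ F.leafTangent p, mvfderiv (𝓡 m) u p v = 0) {i : F.Index} {p q : M}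
    (hp : p ∈ F.leafSet i) (hq : q ∈ F.leafSet i) : u p = u q := by
  obtain ⟨l, rfl⟩ := hp
  obtain ⟨l', rfl⟩ := hq
  have hloc : IsLocallyConstant (u ∘ F.incl i) := by
    refine (IsLocallyConstant.iff_eventually_eq _).2 fun l => ?_
    set ψ := extChartAt (𝓡 (F.dim i)) l with hψ
    obtain ⟨ε, hε, hεT⟩ := Metric.isOpen_iff.1 (isOpen_extChartAt_target (I := 𝓡 (F.dim i)) l) _
      (mem_extChartAt_target l)
    have hd : ∀ s ∈ Metric.ball (ψ l) ε, HasFDerivAt (fun s => u (F.incl i (ψ.symm s)))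
        (0 : EuclideanSpace ℝ (Fin (F.dim i)) →L[ℝ] ℝ) s := by
      intro s hs
      have h1 := (mdifferentiableAt_extChartAt_symm (hεT hs)).hasMFDerivAt
      have h2 := ((F.contMDiff_incl i).mdifferentiable (by simp) (ψ.symm s)).hasMFDerivAt
      have h3 := ((hu (F.incl i (ψ.symm s))).hasMFDerivAt.comp s (h2.comp s h1)).hasFDerivAt
      refine h3.congr_fderiv ?_
      refine ContinuousLinearMap.ext fun a => ?_
      exact h _ _ ⟨i, ⟨ψ.symm s, mfderiv (𝓡 (F.dim i)) (𝓡 (F.dim i)) ψ.symm s a⟩, rfl⟩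
    have hconst := fun s hs => Metric.isOpen_ball.is_const_of_fderiv_eq_zero (𝕜 := ℝ)
      (convex_ball (ψ l) ε).isPreconnected
      (fun s hs => (hd s hs).differentiableAt.differentiableWithinAt)
      (fun s hs => (hd s hs).fderiv) (x := s) (y := ψ l) hs (Metric.mem_ball_self hε)
    filter_upwards [(continuousAt_extChartAt (I := 𝓡 (F.dim i)) l).preimage_mem_nhds
      (Metric.ball_mem_nhds _ hε), extChartAt_source_mem_nhds (I := 𝓡 (F.dim i)) l] with l' h1 h2
    have h3 := hconst (ψ l') h1
    rwa [ψ.left_inv h2, hψ, extChartAt_to_inv] at h3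
  exact hloc.apply_eq_of_isPreconnected isPreconnected_univ (mem_univ _) (mem_univ _)

open Classical in
/-- A function of the tube radius, extended by zero, is an invariant smooth function. -/
theorem exists_invariantFunction {V : Set M} {f : M → ℝ} (hV : IsOpen V)
    (hf : ∀ p ∈ V, ContMDiffAt (𝓡 m) 𝓘(ℝ, ℝ) ∞ f p)
    (hfL : ∀ p ∈ V, ∀ v ∈ F.leafTangent p, mvfderiv (𝓡 m) f p v = 0)
    {S : Set ℝ} (hS : IsClosed {p ∈ V | f p ∈ S}) {b : ℝ → ℝ} (hb : ContDiff ℝ ∞ b)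
    (hbS : ∀ x ∉ S, b x = 0) :
    ∃ u ∈ F.invariantFunctions, (∀ p, u p = if p ∈ V then b (f p) else 0) ∧
      tsupport u ⊆ {p ∈ V | f p ∈ S} := by
  let u : M → ℝ := fun p => if p ∈ V then b (f p) else 0
  have hout : ∀ p ∉ {p ∈ V | f p ∈ S}, u p = 0 := by
    intro p hp
    by_cases hpV : p ∈ V
    · simp only [u, if_pos hpV]
      exact hbS _ fun h => hp ⟨hpV, h⟩
    · simp only [u, if_neg hpV]
  have hevout : ∀ p ∉ {p ∈ V | f p ∈ S}, u =ᶠ[𝓝 p] fun _ => 0 := fun p hp => by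
    filter_upwards [hS.isOpen_compl.mem_nhds hp] with q hq using hout q hq
  have hevin : ∀ p ∈ V, u =ᶠ[𝓝 p] b ∘ f := fun p hp => by
    filter_upwards [hV.mem_nhds hp] with q hq
    simp only [u, if_pos hq, Function.comp_apply]
  have hsm : ContMDiff (𝓡 m) 𝓘(ℝ, ℝ) ∞ u := by
    intro p
    by_cases hp : p ∈ {p ∈ V | f p ∈ S}
    · exact (hb.contMDiff.contMDiffAt.comp p (hf p hp.1)).congr_of_eventuallyEq (hevin p hp.1)
    · exact contMDiffAt_const.congr_of_eventuallyEq (hevout p hp)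
  -- The differential of the extended function vanishes along leaves at every point of `M`, so it
  -- does not matter whether a leaf that meets `V` stays inside `V`.
  have hdu : ∀ p, ∀ v ∈ F.leafTangent p, mvfderiv (𝓡 m) u p v = 0 := by
    intro p v hv
    have key : ∀ {w : M → ℝ} {L : EuclideanSpace ℝ (Fin m) →L[ℝ] ℝ}, u =ᶠ[𝓝 p] w →
        HasMFDerivAt (𝓡 m) 𝓘(ℝ, ℝ) w p L → L v = 0 → mvfderiv (𝓡 m) u p v = 0 := by
      intro w L he hL hLv
      have h1 : mfderiv (𝓡 m) 𝓘(ℝ, ℝ) u p = L :=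
        (he.mfderiv_eq (I := 𝓡 m) (I' := 𝓘(ℝ, ℝ))).trans hL.mfderiv
      exact (congrArg (fun L : EuclideanSpace ℝ (Fin m) →L[ℝ] ℝ => L v) h1).trans hLv
    by_cases hp : p ∈ {p ∈ V | f p ∈ S}
    · have h1 := ((hf p hp.1).mdifferentiableAt (by simp)).hasMFDerivAt
      have h2 : HasMFDerivAt 𝓘(ℝ, ℝ) 𝓘(ℝ, ℝ) b (f p) (fderiv ℝ b (f p)) :=
        ((hb.differentiable (by simp)) (f p)).hasFDerivAt.hasMFDerivAt
      refine key (hevin p hp.1) (h2.comp p h1) ?_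
      exact (congrArg (fderiv ℝ b (f p)) (hfL p hp.1 v hv)).trans (map_zero _)
    · exact key (hevout p hp) (hasMFDerivAt_const 0 p) rfl
  refine ⟨⟨u, hsm⟩, fun i p hp q hq => F.eq_of_mvfderiv_leafTangent
    (hsm.mdifferentiable (by simp)) hdu hp hq, fun p => rfl, ?_⟩
  refine closure_minimal (fun p hp => ?_) hS
  by_contra h
  exact hp (hout p h)

/-- Invariant bump functions with disjoint supports. -/
theorem exists_disjoint_invariantFunctions [T2Space M] [CompactSpace M] [ConnectedSpace M]
    (hF : F.HasClosedLeaves) {i : F.Index} (hi : F.leafSet i ≠ univ) (k : ℕ) :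
    ∃ u : Fin k → C^∞⟮𝓡 m, M; ℝ⟯, (∀ i, u i ∈ F.invariantFunctions) ∧ (∀ i, u i ≠ 0) ∧
      (∀ i p, 0 ≤ u i p) ∧ Pairwise fun i j => Disjoint (tsupport (u i)) (tsupport (u j)) := by
  classical
  obtain ⟨V, f, ε, hε, hV, hf, hfL, hcl, hval⟩ := F.exists_proper_tube hF hi
  -- The centres divide `(0, ε)` into `k + 1` equal parts of length `4 * r`. Intervals of radius `r`
  -- around them are disjoint and lie in `(0, ε)`; the shift `j + 1` keeps the first one away from
  -- the leaf.
  let c : Fin k → ℝ := fun j => ε * ((j : ℝ) + 1) / (k + 1)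
  let r : ℝ := ε / (4 * (k + 1))
  have hk : (0 : ℝ) < k + 1 := by positivity
  have hr : 0 < r := by positivity
  have hr4 : 4 * r = ε / (k + 1) := by simp only [r]; field_simp
  have hc : ∀ j : Fin k, c j = 4 * r * (j + 1) := fun j => by rw [hr4]; simp only [c]; ring
  have hε' : ε = 4 * r * (k + 1) := by rw [hr4]; field_simp
  have hjk : ∀ j : Fin k, (j : ℝ) + 1 ≤ k := fun j => by exact_mod_cast j.2
  have hcε : ∀ j, c j + r < ε := fun j => by
    rw [hc, hε']
    nlinarith [hjk j]
  have hc0 : ∀ j, 0 < c j := fun j => by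
    rw [hc]
    positivity
  let B : ∀ j, ContDiffBump (c j) := fun j => ⟨r / 2, r, by positivity, by linarith⟩
  have hex := fun j : Fin k => F.exists_invariantFunction hV hf hfL
    (hcl (c j - r) (c j + r) (hcε j)) (b := B j) (B j).contDiff fun x hx => by
      by_contra h
      have h1 : x ∈ Function.support (B j) := h
      rw [(B j).support_eq, Real.ball_eq_Ioo] at h1
      exact hx (Ioo_subset_Icc_self h1)
  choose u huF hu hsupp using hex
  refine ⟨u, huF, fun j h0 => ?_, fun j p => ?_, fun j j' hjj' => ?_⟩
  · obtain ⟨p, hp, hpc⟩ := hval (c j) (hc0 j) (by linarith [hcε j])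
    have h1 := hu j p
    rw [if_pos hp, hpc, h0, (B j).one_of_mem_closedBall
      (Metric.mem_closedBall_self (B j).rIn_pos.le)] at h1
    exact zero_ne_one h1
  · rw [hu]
    split_ifs
    · exact (B j).nonneg
    · exact le_rfl
  · refine Disjoint.mono (hsupp j) (hsupp j') (disjoint_left.2 fun p hp hp' => hjj' ?_)
    have h1 := hp.2
    have h2 := hp'.2
    rw [hc, mem_Icc] at h1 h2
    have h3 : (j : ℝ) < j' + 1 := by
      by_contra! h
      nlinarith [h1.1, h2.2]
    have h4 : (j' : ℝ) < j + 1 := by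
      by_contra! h
      nlinarith [h1.2, h2.1]
    have h3' : (j : ℕ) < j' + 1 := by exact_mod_cast h3
    have h4' : (j' : ℕ) < j + 1 := by exact_mod_cast h4
    exact Fin.ext (by omega)

end SingularRiemannianFoliation

/-! ### Infinite dimension of the invariant Sobolev space -/

lemma det_gramMatrix_pos (g : SmoothMetric m M) (x : M) {y : EuclideanSpace ℝ (Fin m)}
    (hy : y ∈ (extChartAt (𝓡 m) x).target) : 0 < (gramMatrix g x y).det := by
  have hG := isSmoothMetricOn_chartForm g x
  have h : (gramMatrix g x y).PosDef := by
    refine Matrix.PosDef.of_dotProduct_mulVec_pos ?_ fun v hv => ?_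
    · refine Matrix.IsHermitian.ext fun i j => ?_
      exact hG.symm y hy _ _
    · let b := EuclideanSpace.basisFun (Fin m) ℝ
      have h1 : star v ⬝ᵥ (gramMatrix g x y).mulVec v =
          chartForm g x y (∑ i, v i • b i) (∑ j, v j • b j) := by
        simp only [dotProduct, Matrix.mulVec, map_sum, map_smul, sum_apply,
          _root_.smul_apply, smul_eq_mul, star_trivial, gramMatrix, Matrix.of_apply]
        simp only [Finset.mul_sum]
        rw [Finset.sum_comm]
        refine Finset.sum_congr rfl fun i _ => Finset.sum_congr rfl fun j _ => ?_
        rw [chartForm_apply]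
        ring
      rw [h1]
      refine hG.pos y hy _ fun h0 => hv ?_
      funext i
      have := congrArg (fun w : EuclideanSpace ℝ (Fin m) => w i) h0
      simpa [b, Finset.sum_apply, Pi.single_apply] using this
  exact h.det_pos

/-! ### Positivity of the volume and faithfulness of the Sobolev norm -/

section Volume

variable [MeasurableSpace M] [BorelSpace M]

/-- The volume dominates the measure of the chart around any point of the open set, and that chart
measure has a positive density. -/
lemma isOpenPosMeasure_riemannianVolume (g : SmoothMetric m M) :
    (riemannianVolume g).IsOpenPosMeasure := by
  refine ⟨fun O hO ⟨x, hx⟩ => ?_⟩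
  have h1 : chartVolume g x O ≤ riemannianVolume g O := Measure.le_iff'.1 (le_iSup _ x) O
  refine (lt_of_lt_of_le ?_ h1).ne'
  rw [chartVolume_apply g x hO.measurableSet]
  set A := (extChartAt (𝓡 m) x).target ∩ (extChartAt (𝓡 m) x).symm ⁻¹' O with hA
  have hAo : IsOpen A := (continuousOn_extChartAt_symm x).isOpen_inter_preimage
    (isOpen_extChartAt_target x) hO
  have hAn : A.Nonempty := ⟨extChartAt (𝓡 m) x x, mem_extChartAt_target x, by
    rwa [mem_preimage, extChartAt_to_inv]⟩
  have hpos : ∀ y ∈ A, 0 < ENNReal.ofReal √(gramMatrix g x y).det := fun y hy =>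
    ENNReal.ofReal_pos.2 (Real.sqrt_pos.2 (det_gramMatrix_pos g x hy.1))
  rw [pos_iff_ne_zero]
  intro h0
  have hmeas : AEMeasurable (fun y => ENNReal.ofReal √(gramMatrix g x y).det)
      (volume.restrict A) :=
    ((continuousOn_volumeDensity g x).mono inter_subset_left).aemeasurable hAo.measurableSet
  rw [lintegral_eq_zero_iff' hmeas, Filter.EventuallyEq, ae_restrict_iff' hAo.measurableSet] at h0
  have h2 : volume A = 0 := by
    refine measure_mono_null (fun y hy => ?_) h0
    exact fun h => (hpos y hy).ne' (h hy)
  exact hAo.measure_ne_zero volume hAn h2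

variable [CompactSpace M]

/-- The Sobolev inner product is a priori only semidefinite, and completion identifies vectors at
distance zero. A continuous nonnegative integrand with integral zero vanishes almost everywhere,
hence everywhere as open sets have positive volume; its term `u²` then forces `u = 0`. -/
lemma smoothToSobolev_injective (g : SmoothMetric m M) :
    Function.Injective (smoothToSobolev g) := by
  rw [← LinearMap.ker_eq_bot, LinearMap.ker_eq_bot']
  intro u hu
  have := isOpenPosMeasure_riemannianVolume g
  have h1 : ‖(show SmoothFunctions g from u)‖ = 0 := by
    rw [← (UniformSpace.Completion.toComplₗᵢ (𝕜 := ℝ) (E := SmoothFunctions g)).norm_map]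
    exact norm_eq_zero.2 hu
  have h2 : ∫ p, sobolevIntegrand g u u p ∂(riemannianVolume g) = 0 := by
    have h3 := real_inner_self_eq_norm_sq (show SmoothFunctions g from u)
    rw [h1] at h3
    exact h3.trans (by norm_num)
  have hgrad : ∀ p, 0 ≤ g.inner p (gradient g u p) (gradient g u p) := by
    intro p
    rcases eq_or_ne (gradient g u p) 0 with h | h
    · rw [h]
      simp
    · exact (g.pos p _ h).le
  have hnn : ∀ p, 0 ≤ sobolevIntegrand g u u p := fun p => add_nonneg (hgrad p) (mul_self_nonneg _)
  have hc : Continuous (sobolevIntegrand g u u) :=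
    (continuous_inner_gradient g u.contMDiff u.contMDiff).add
      (u.contMDiff.continuous.mul u.contMDiff.continuous)
  rw [integral_eq_zero_iff_of_nonneg hnn (integrable_sobolevIntegrand g u u),
    hc.ae_eq_iff_eq _ continuous_zero] at h2
  ext p
  have h3 : g.inner p (gradient g u p) (gradient g u p) + u p * u p = 0 := congrFun h2 p
  have h4 : u p * u p = 0 := by
    have := mul_self_nonneg (u p)
    linarith [hgrad p]
  exact mul_self_eq_zero.1 h4

end Volume

/-- Evaluating a vanishing combination at a point where `u i ≠ 0` leaves only the `i`-th term. -/
lemma linearIndependent_of_disjoint_tsupport {k : ℕ} {u : Fin k → C^∞⟮𝓡 m, M; ℝ⟯}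
    (h0 : ∀ i, u i ≠ 0) (hd : Pairwise fun i j => Disjoint (tsupport (u i)) (tsupport (u j))) :
    LinearIndependent ℝ u := by
  rw [Fintype.linearIndependent_iff]
  intro c hc i
  obtain ⟨p, hp⟩ : ∃ p, u i p ≠ 0 := by
    by_contra! h
    exact h0 i (ContMDiffMap.ext h)
  have h1 : ∀ j, j ≠ i → u j p = 0 := fun j hj => by
    by_contra hne
    exact disjoint_left.1 (hd hj) (subset_tsupport _ hne) (subset_tsupport _ hp)
  have h2 : ∑ j, c j * u j p = 0 := by
    have h3 := congrArg (ContMDiffMap.coeFnLinearMap (𝕜 := ℝ)) hc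
    rw [map_sum] at h3
    have h4 := congrFun h3 p
    rw [Finset.sum_apply] at h4
    exact h4
  rw [Finset.sum_eq_single i (fun j _ hj => by rw [h1 j hj, mul_zero]) (by simp)] at h2
  exact (mul_eq_zero.1 h2).resolve_right hp

namespace SingularRiemannianFoliation

variable {g : SmoothMetric m M} (F : SingularRiemannianFoliation g)

/-- Leaves are nonempty and disjoint, so a leaf equal to `M` would be the only one. -/
lemma leafSet_ne_univ (hF : F.IsNontrivial) (i : F.Index) : F.leafSet i ≠ univ := by
  intro h
  refine hF.1 (eq_singleton_iff_unique_mem.2 ⟨⟨i, h⟩, ?_⟩)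
  rintro _ ⟨j, rfl⟩
  obtain ⟨l⟩ : Nonempty (F.Leaf j) := inferInstance
  obtain ⟨l', hl'⟩ : F.incl j l ∈ F.leafSet i := h ▸ mem_univ _
  obtain rfl := F.index_eq hl'
  exact h

theorem not_finiteDimensional_sobolevSubspace [MeasurableSpace M] [BorelSpace M] [CompactSpace M]
    (h : ∀ k : ℕ, ∃ u : Fin k → C^∞⟮𝓡 m, M; ℝ⟯,
      (∀ i, u i ∈ F.invariantFunctions) ∧ LinearIndependent ℝ u) :
    ¬ FiniteDimensional ℝ F.sobolevSubspace := by
  intro hfin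
  obtain ⟨u, hu, hli⟩ := h (Module.finrank ℝ F.sobolevSubspace + 1)
  have h1 : LinearIndependent ℝ (fun i => smoothToSobolev g (u i)) :=
    hli.map' _ (LinearMap.ker_eq_bot.2 (smoothToSobolev_injective g))
  have hmem : ∀ i, smoothToSobolev g (u i) ∈ F.sobolevSubspace := fun i =>
    Submodule.le_topologicalClosure _ (Submodule.mem_map_of_mem (hu i))
  have h2 : LinearIndependent ℝ
      (fun i => (⟨smoothToSobolev g (u i), hmem i⟩ : F.sobolevSubspace)) :=
    LinearIndependent.of_comp F.sobolevSubspace.subtype h1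
  have := h2.fintype_card_le_finrank
  simp at this

end SingularRiemannianFoliation

end FoliatedGeometry

theorem mainTheorem8 {m : ℕ} {M : Type*} [TopologicalSpace M] [T2Space M] [CompactSpace M]
    [ConnectedSpace M] [ChartedSpace (EuclideanSpace ℝ (Fin m)) M] [IsManifold (𝓡 m) ∞ M]
    [MeasurableSpace M] [BorelSpace M]
    (g : SmoothMetric m M) (F : SingularRiemannianFoliation g)
    (hclosed : F.HasClosedLeaves) (hnontrivial : F.IsNontrivial) (hkappa : 1 ≤ F.kappa) :
    (∀ k : ℕ, ∃ u : Fin k → C^∞⟮𝓡 m, M; ℝ⟯,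
      (∀ i, u i ∈ F.invariantFunctions) ∧ (∀ i, u i ≠ 0) ∧ (∀ i p, 0 ≤ u i p) ∧
      Pairwise fun i j => Disjoint (tsupport (u i)) (tsupport (u j))) ∧
    ¬ FiniteDimensional ℝ F.sobolevSubspace := by
  -- Any leaf can serve as the centre of the tube.
  obtain ⟨p⟩ : Nonempty M := inferInstance
  obtain ⟨i, -⟩ := F.exists_incl_eq p
  have h := fun k => F.exists_disjoint_invariantFunctions hclosed
    (F.leafSet_ne_univ hnontrivial i) k
  refine ⟨h, F.not_finiteDimensional_sobolevSubspace fun k => ?_⟩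
  obtain ⟨u, hu, h0, -, hd⟩ := h k
  exact ⟨u, hu, linearIndependent_of_disjoint_tsupport h0 hd⟩
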